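/- **Setting.** Let $\Omega\subset\mathbb R^2$ be open, bounded, connected and simply connected. Assume there are finitely many points $x_1,\dots,x_N\in\partial\Omega$ ($N\ge 0$) with pairwise disjoint open neighbourhoods $U_i$ and $C^2$-diffeomorphisms $\varphi_i:U_i\to\varphi_i(U_i)$ onto open sets with $\varphi_i(x_i)=0$, $\varphi_i(\Omega\cap U_i)\subset(0,1)^2$ and $\varphi_i(\partial\Omega\cap U_i)\subset[0,1]\times\{0\}\cup\{0\}\times[0,1]$, and that $\partial\Omega$ is $C^2$ away from $x_1,\dots,x_N$ (near each other boundary point some $C^2$-diffeomorphism maps $\Omega$ to the upper side of a flat boundary). For a bounded open set $U\subset\mathbb R^2$ and $1\le p\le\infty$, $W^{k,p}(U;\mathbb R^m)$ is the usual Sobolev space, with norm $\sum_{|\alpha|\le k}\|\partial^\alpha u\|_{L^p(U)}$. For $U=\Omega$ and for $U=(-\tfrac12,\tfrac12)^2$, $W^{2,p}_0(U;\mathbb R^m)$ is the set of $u\in W^{2,p}(U;\mathbb R^m)$ such that $u$ and $\nabla u$ vanish on $\partial U$ in the sense of traces. For $f:\mathbb R^{m\times 2^2}\to[0,\infty)$,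 Borel measurable and bounded on bounded sets, let $$Q_2f(\xi)=\inf\Big\{\int_{[-1/2,1/2]^2}f(\xi+\nabla^2\varphi)\,dx:\ \varphi\in W^{2,\infty}_0\big((-\tfrac12,\tfrac12)^2;\mathbb R^m\big)\Big\}.$$ **Theorem.** Let $1\le p<\infty$ and let $f:\mathbb R^{m\times 2^2}\to\mathbb R$ be Borel measurable (not necessarily continuous) such that, for some constant $C$, $$0\le f(A)\le C(1+|A|^p)\qquad\text{for all }A\in\mathbb R^{m\times 2^2}.$$ Let $u_0\in W^{2,p}(\Omega;\mathbb R^m)$, $u\in u_0+W^{2,p}_0(\Omega;\mathbb R^m)$ and $\varepsilon>0$. Then there exists $v\in u_0+W^{2,p}_0(\Omega;\mathbb R^m)$ such that $f(\nabla^2v)$ and $Q_2f(\nabla^2u)$ are integrable on $\Omega$ and $$\|u-v\|_{W^{1,p}(\Omega;\mathbb R^m)}<\varepsilon,\qquad \int_\Omega f(\nabla^2v)\,dx<\int_\Omega Q_2f(\nabla^2u)\,dx+\varepsilon .$$ -/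

import Mathlib

open MeasureTheory Filter Topology Set
open scoped ENNReal ContDiff

noncomputable section

/-- The Euclidean plane. -/
abbrev Plane : Type := EuclideanSpace ℝ (Fin 2)

/-- The space `ℝ^{m × 2²}` with its Euclidean norm; the entry `(k, i, j)` of a Hessian is
`∂ⱼ∂ᵢ uₖ`. -/
abbrev HessSpace (m : ℕ) : Type := EuclideanSpace ℝ (Fin m × Fin 2 × Fin 2)

section Sobolev

variable {F : Type*} [NormedAddCommGroup F] [NormedSpace ℝ F]

/-- `g` is the weak partial derivative `∂ᵢ u` in the open set `Ω`. -/
structure HasWeakDeriv (Ω : Set Plane) (i : Fin 2) (u g : Plane → F) : Prop where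
  locallyIntegrableOn : LocallyIntegrableOn u Ω
  locallyIntegrableOn_deriv : LocallyIntegrableOn g Ω
  integral_eq : ∀ φ : Plane → ℝ, ContDiff ℝ ∞ φ → HasCompactSupport φ → tsupport φ ⊆ Ω →
    ∫ x in Ω, (fderiv ℝ φ x (EuclideanSpace.single i 1)) • u x = -∫ x in Ω, φ x • g x

open Classical in
/-- A representative of the weak partial derivative `∂ᵢ u` in `Ω` (which is unique up to null
subsets of `Ω`), and `0` if `u` has none. -/
def weakDeriv (Ω : Set Plane) (i : Fin 2) (u : Plane → F) : Plane → F :=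
  if h : ∃ g, HasWeakDeriv Ω i u g then h.choose else 0

theorem hasWeakDeriv_weakDeriv {Ω : Set Plane} {i : Fin 2} {u g : Plane → F}
    (h : HasWeakDeriv Ω i u g) : HasWeakDeriv Ω i u (weakDeriv Ω i u) := by
  have h' : ∃ g, HasWeakDeriv Ω i u g := ⟨g, h⟩
  rw [weakDeriv, dif_pos h']
  exact h'.choose_spec

/-- `u ∈ W^{1,p}(Ω)`. -/
def MemW1 (Ω : Set Plane) (p : ℝ≥0∞) (u : Plane → F) : Prop :=
  MemLp u p (volume.restrict Ω) ∧
    ∀ i, ∃ g, HasWeakDeriv Ω i u g ∧ MemLp g p (volume.restrict Ω)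

/-- `u ∈ W^{2,p}(Ω)`. -/
def MemW2 (Ω : Set Plane) (p : ℝ≥0∞) (u : Plane → F) : Prop :=
  MemLp u p (volume.restrict Ω) ∧ ∀ i, ∃ g, HasWeakDeriv Ω i u g ∧ MemW1 Ω p g

/-- The norm of `W^{1,p}(Ω)`: the sum of the `L^p` norms of `u` and its first weak partial
derivatives. -/
def normW1 (Ω : Set Plane) (p : ℝ≥0∞) (u : Plane → F) : ℝ≥0∞ :=
  eLpNorm u p (volume.restrict Ω) + ∑ i, eLpNorm (weakDeriv Ω i u) p (volume.restrict Ω)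

/-- `g` is the trace of `u ∈ W^{1,1}(Ω)` on `∂Ω`. The trace operator
`W^{1,1}(Ω) → L¹(∂Ω, ℋ¹)` is the continuous extension of the restriction `w ↦ w|_{∂Ω}` of
functions that are smooth up to the boundary, so `g` is the `L¹(∂Ω, ℋ¹)` limit of such
restrictions along a sequence that converges to `u` in `W^{1,1}(Ω)`. -/
def HasTrace (Ω : Set Plane) (u g : Plane → F) : Prop :=
  MemW1 Ω 1 u ∧ ∃ w : ℕ → Plane → F, (∀ j, ContDiff ℝ ∞ (w j)) ∧
    Tendsto (fun j => normW1 Ω 1 (w j - u)) atTop (𝓝 0) ∧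
    Tendsto (fun j => eLpNorm (w j - g) 1
      ((Measure.hausdorffMeasure 1 : Measure Plane).restrict (frontier Ω))) atTop (𝓝 0)

/-- `u ∈ W₀^{2,p}(Ω)`: `u ∈ W^{2,p}(Ω)`, and `u` and its first derivatives vanish on `∂Ω` in the
sense of traces. -/
def MemW2Zero (Ω : Set Plane) (p : ℝ≥0∞) (u : Plane → F) : Prop :=
  MemW2 Ω p u ∧ HasTrace Ω u 0 ∧ ∀ i, HasTrace Ω (weakDeriv Ω i u) 0

end Sobolev

/-- The weak Hessian `∇²u` of `u : Ω → ℝᵐ`. -/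
def weakHess {m : ℕ} (Ω : Set Plane) (u : Plane → EuclideanSpace ℝ (Fin m)) (x : Plane) :
    HessSpace m :=
  WithLp.toLp 2 fun q => weakDeriv Ω q.2.2 (weakDeriv Ω q.2.1 u) x q.1

/-- The (open) unit square `(-1/2, 1/2)²`. -/
def unitSquare : Set Plane := {x | ∀ i, x i ∈ Ioo (-(1 / 2) : ℝ) (1 / 2)}

/-- The 2-quasiconvexification `Q₂f`. -/
def Q2 {m : ℕ} (f : HessSpace m → ℝ) (ξ : HessSpace m) : ℝ :=
  ⨅ φ : {φ : Plane → EuclideanSpace ℝ (Fin m) // MemW2Zero unitSquare ∞ φ},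
    ∫ x in unitSquare, f (ξ + weakHess unitSquare φ.1 x)

/-- `φ` is a `C²`-diffeomorphism from the open set `φ.source` onto the open set `φ.target`. -/
def IsC2Diffeo (φ : OpenPartialHomeomorph Plane Plane) : Prop :=
  ContDiffOn ℝ 2 φ φ.source ∧ ContDiffOn ℝ 2 φ.symm φ.target

/-- The boundary of `Ω` is `C²` near `x`: in a `C²` chart around `x`, the set `Ω` is the upper
half plane. -/
def IsC2BoundaryAt (Ω : Set Plane) (x : Plane) : Prop :=
  ∃ φ : OpenPartialHomeomorph Plane Plane, IsC2Diffeo φ ∧ x ∈ φ.source ∧ φ x = 0 ∧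
    ∀ y ∈ φ.source, y ∈ Ω ↔ 0 < φ y 1

/-- Bounded, connected, simply connected plane domains whose boundary is `C²` up to finitely many
corners; near each corner a `C²`-diffeomorphism maps `Ω` into the square `(0,1)²` and `∂Ω` into
the two coordinate axes. -/
structure IsCornerDomain (Ω : Set Plane) : Prop where
  isOpen : IsOpen Ω
  isBounded : Bornology.IsBounded Ω
  isConnected : IsConnected Ω
  simplyConnected : IsSimplyConnected Ω
  boundary : ∃ (N : ℕ) (c : Fin N → Plane) (φ : Fin N → OpenPartialHomeomorph Plane Plane),
    (∀ i, c i ∈ frontier Ω) ∧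
    (Pairwise fun i j => Disjoint (φ i).source (φ j).source) ∧
    (∀ i, IsC2Diffeo (φ i) ∧ c i ∈ (φ i).source ∧ φ i (c i) = 0 ∧
      (∀ y ∈ Ω ∩ (φ i).source, ∀ k, φ i y k ∈ Ioo (0 : ℝ) 1) ∧
      (∀ y ∈ frontier Ω ∩ (φ i).source,
        (φ i y 0 ∈ Icc (0 : ℝ) 1 ∧ φ i y 1 = 0) ∨ (φ i y 0 = 0 ∧ φ i y 1 ∈ Icc (0 : ℝ) 1))) ∧
    (∀ x ∈ frontier Ω, (∀ i, x ≠ c i) → IsC2BoundaryAt Ω x)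

end

/-!
The function `v` is obtained from `u` by three corrections supported in a compact subset of `Ω`,
so that the boundary values are kept for a trivial reason (`memW2Zero_of_isCompact`).

* *Smoothing* (`exists_smooth_correction`). A cut-off and a mollification change `u` by a function
  that is small in `W^{2,p}`, and make it smooth on an open set `V` that fills `Ω` up to small
  measure.
* *Piecewise quadratic approximation* (`exists_quadratic_correction`). On small disjoint squares
  that fill `V` up to small measure, the smooth function is replaced, away from a thin layer inside
  each square, by its second Taylor polynomial. On a square of side `h` the remainder, rescaled to
  the unit square, is `O(h)` in `C²`, so the change is small in `C²`. Now the Hessian is constant,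
  equal to `ξ` say, on each of finitely many squares.
* *Oscillation* (`exists_oscillation`). Each of these squares is filled, up to small measure, with
  much finer squares, and on these rescaled copies `t² φ((x - b) / t)` of a near-minimiser `φ` for
  `Q₂f ξ` are added. Near-minimisers are extended by zero to the plane, which is possible because
  their traces vanish (`HasTrace.hasWeakDeriv_indicator`). Scaling makes this correction small in
  `W^{1,p}`, while the Hessians `∇²φ((x - b) / t)` do not change size; the energy on the fine
  squares is almost the integral of `Q₂f` of the Hessian before the oscillation.

Two facts control the energy. Where `v` is not one of the rescaled near-minimisers, its Hessian is
`L^p`-close to `∇²u` and the set is small, so the growth condition bounds the energy there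
(`exists_forall_setIntegral_growth_le`). Elsewhere the energy is compared with the relaxed energy of
a Hessian field that is `L^p`-close to `∇²u`, and the relaxed energy is upper semicontinuous under
such perturbations (`exists_forall_integral_lt_of_upperSemicontinuous`). No continuity of `f` is
needed for that, since `Q₂f` is upper semicontinuous along symmetric matrices for every
locally bounded `f` (`eventually_Q2_lt`): a competitor for `ξ`, shrunk to the square of side `θ < 1`
and surrounded by a transition layer where the Hessian changes by `ξ - ζ`, is a competitor for `ζ`.
In non-symmetric directions `Q₂f` need not be semicontinuous; as Hessians are symmetric, it can be
replaced by `ξ ↦ Q₂f (symHess ξ)`.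
-/

noncomputable section

/-! ### Partial derivatives -/

section Calculus

variable {F : Type*} [NormedAddCommGroup F] [NormedSpace ℝ F]

/-- The classical partial derivative `∂ᵢ u`. -/
def pderiv (i : Fin 2) (u : Plane → F) : Plane → F :=
  fun x => fderiv ℝ u x (EuclideanSpace.single i 1)

theorem contDiff_pderiv {u : Plane → F} (hu : ContDiff ℝ ∞ u) (i : Fin 2) :
    ContDiff ℝ ∞ (pderiv i u) :=
  (hu.fderiv_right (m := ∞) (by simp)).clm_apply contDiff_const

theorem tsupport_pderiv_subset (i : Fin 2) (u : Plane → F) : tsupport (pderiv i u) ⊆ tsupport u :=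
  (closure_mono fun x hx => by
    intro h
    exact hx (by simp [pderiv, h])).trans (tsupport_fderiv_subset ℝ)

theorem hasCompactSupport_pderiv {u : Plane → F} (hu : HasCompactSupport u) (i : Fin 2) :
    HasCompactSupport (pderiv i u) :=
  hu.of_isClosed_subset (isClosed_tsupport _) (tsupport_pderiv_subset i u)

theorem pderiv_comm {u : Plane → F} (hu : ContDiff ℝ ∞ u) (i j : Fin 2) :
    pderiv j (pderiv i u) = pderiv i (pderiv j u) := by
  have hd : Differentiable ℝ (fderiv ℝ u) :=
    (hu.fderiv_right (m := ∞) (by simp)).differentiable (by simp)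
  have key : ∀ i j x, pderiv j (pderiv i u) x
      = fderiv ℝ (fderiv ℝ u) x (EuclideanSpace.single j 1) (EuclideanSpace.single i 1) := by
    intro i j x
    unfold pderiv
    rw [fderiv_clm_apply (hd x) (differentiableAt_const _)]
    simp
  ext1 x
  rw [key, key]
  have := (hu.contDiffAt (x := x)).isSymmSndFDerivAt (by
    rw [minSmoothness_of_isRCLikeNormedField]; exact ENat.LEInfty.out)
  exact this _ _

theorem pderiv_smul {χ : Plane → ℝ} {u : Plane → F} (hχ : ContDiff ℝ ∞ χ) (hu : ContDiff ℝ ∞ u)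
    (i : Fin 2) :
    pderiv i (χ • u) = pderiv i χ • u + χ • pderiv i u := by
  ext1 x
  simp only [pderiv, Pi.add_apply, Pi.smul_apply']
  rw [fderiv_smul (hχ.differentiable (by simp) x) (hu.differentiable (by simp) x)]
  simp [add_comm]

theorem pderiv_add {u v : Plane → F} (hu : ContDiff ℝ ∞ u) (hv : ContDiff ℝ ∞ v)
    (i : Fin 2) : pderiv i (u + v) = pderiv i u + pderiv i v := by
  ext1 x
  simp only [pderiv, Pi.add_apply]
  rw [fderiv_add (hu.differentiable (by simp) x) (hv.differentiable (by simp) x)]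
  simp

theorem pderiv_sub {u v : Plane → F} (hu : ContDiff ℝ ∞ u) (hv : ContDiff ℝ ∞ v)
    (i : Fin 2) : pderiv i (u - v) = pderiv i u - pderiv i v := by
  ext1 x
  simp only [pderiv, Pi.sub_apply]
  rw [fderiv_sub (hu.differentiable (by simp) x) (hv.differentiable (by simp) x)]
  simp

end Calculus

/-! ### Weak derivatives -/

section WeakDerivative

variable {F : Type*} [NormedAddCommGroup F] [NormedSpace ℝ F] {Ω : Set Plane} {i : Fin 2}

theorem integrableOn_smul_of_tsupport_subset {φ : Plane → ℝ} {u : Plane → F}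
    (hu : LocallyIntegrableOn u Ω) (hφ : Continuous φ) (hc : HasCompactSupport φ)
    (hs : tsupport φ ⊆ Ω) : Integrable (fun x => φ x • u x) := by
  have h1 : IntegrableOn u (tsupport φ) := hu.integrableOn_compact_subset hs hc
  have h2 : IntegrableOn (fun x => φ x • u x) (tsupport φ) := h1.continuousOn_smul hφ.continuousOn hc
  exact (integrableOn_iff_integrable_of_support_subset (fun x hx => by
    apply subset_tsupport φ
    intro h
    simp [h] at hx)).1 h2

theorem setIntegral_smul_eq {φ : Plane → ℝ} (u : Plane → F) (hs : tsupport φ ⊆ Ω) :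
    ∫ x in Ω, φ x • u x = ∫ x, φ x • u x := by
  apply setIntegral_eq_integral_of_forall_compl_eq_zero
  intro x hx
  rw [image_eq_zero_of_notMem_tsupport fun h => hx (hs h), zero_smul]

/-- The defining identity of a weak derivative, with integrals over the whole plane. -/
theorem HasWeakDeriv.integral_eq' {u g : Plane → F} (h : HasWeakDeriv Ω i u g) {φ : Plane → ℝ}
    (hφ : ContDiff ℝ ∞ φ) (hc : HasCompactSupport φ) (hs : tsupport φ ⊆ Ω) :
    ∫ x, pderiv i φ x • u x = -∫ x, φ x • g x := by
  have := h.integral_eq φ hφ hc hs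
  rw [setIntegral_smul_eq g hs] at this
  rw [← this]
  exact (setIntegral_smul_eq u ((tsupport_pderiv_subset i φ).trans hs)).symm

theorem hasWeakDeriv_of_integral_eq {u g : Plane → F} (hu : LocallyIntegrableOn u Ω)
    (hg : LocallyIntegrableOn g Ω)
    (h : ∀ φ : Plane → ℝ, ContDiff ℝ ∞ φ → HasCompactSupport φ → tsupport φ ⊆ Ω →
      ∫ x, pderiv i φ x • u x = -∫ x, φ x • g x) : HasWeakDeriv Ω i u g := by
  refine ⟨hu, hg, fun φ hφ hc hs => ?_⟩
  rw [setIntegral_smul_eq g hs, ← h φ hφ hc hs]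
  exact setIntegral_smul_eq u ((tsupport_pderiv_subset i φ).trans hs)

theorem HasWeakDeriv.ae_eq [CompleteSpace F] (hΩ : IsOpen Ω) {u g g' : Plane → F}
    (h : HasWeakDeriv Ω i u g) (h' : HasWeakDeriv Ω i u g') : g =ᵐ[volume.restrict Ω] g' := by
  have := hΩ.ae_eq_zero_of_integral_contDiff_smul_eq_zero
    (h.locallyIntegrableOn_deriv.sub h'.locallyIntegrableOn_deriv) (fun φ hφ hc hs => by
      simp only [Pi.sub_apply, smul_sub]
      rw [integral_sub
        (integrableOn_smul_of_tsupport_subset h.locallyIntegrableOn_deriv hφ.continuous hc hs)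
        (integrableOn_smul_of_tsupport_subset h'.locallyIntegrableOn_deriv hφ.continuous hc hs)]
      have h1 := h.integral_eq' hφ hc hs
      have h2 := h'.integral_eq' hφ hc hs
      rw [h1, neg_inj] at h2
      rw [h2, sub_self])
  rw [Filter.EventuallyEq, ae_restrict_iff' hΩ.measurableSet]
  filter_upwards [this] with x hx hxΩ
  exact sub_eq_zero.1 (hx hxΩ)

theorem HasWeakDeriv.congr {u u' g g' : Plane → F} (h : HasWeakDeriv Ω i u g)
    (hu : u =ᵐ[volume.restrict Ω] u') (hg : g =ᵐ[volume.restrict Ω] g') :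
    HasWeakDeriv Ω i u' g' := by
  refine ⟨h.1.congr hu, h.2.congr hg, fun φ hφ hc hs => ?_⟩
  rw [integral_congr_ae (g := fun x => (fderiv ℝ φ x (EuclideanSpace.single i 1)) • u x),
    h.3 φ hφ hc hs, integral_congr_ae (g := fun x => φ x • g' x)]
  · filter_upwards [hg] with x hx
    rw [hx]
  · filter_upwards [hu] with x hx
    rw [hx]

theorem HasWeakDeriv.mono {u g : Plane → F} {Ω' : Set Plane} (h : HasWeakDeriv Ω i u g)
    (hs : Ω' ⊆ Ω) : HasWeakDeriv Ω' i u g :=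
  hasWeakDeriv_of_integral_eq (h.1.mono_set hs) (h.2.mono_set hs) fun _ hφ hc hs' =>
    h.integral_eq' hφ hc (hs'.trans hs)

theorem HasWeakDeriv.add {u u' g g' : Plane → F} (h : HasWeakDeriv Ω i u g)
    (h' : HasWeakDeriv Ω i u' g') : HasWeakDeriv Ω i (u + u') (g + g') := by
  refine hasWeakDeriv_of_integral_eq (h.1.add h'.1) (h.2.add h'.2) fun φ hφ hc hs => ?_
  have hφ' := (contDiff_pderiv hφ i).continuous
  have hc' := hasCompactSupport_pderiv hc i
  have hs' := (tsupport_pderiv_subset i φ).trans hs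
  simp only [Pi.add_apply, smul_add]
  rw [integral_add (integrableOn_smul_of_tsupport_subset h.1 hφ' hc' hs')
      (integrableOn_smul_of_tsupport_subset h'.1 hφ' hc' hs'),
    integral_add (integrableOn_smul_of_tsupport_subset h.2 hφ.continuous hc hs)
      (integrableOn_smul_of_tsupport_subset h'.2 hφ.continuous hc hs),
    h.integral_eq' hφ hc hs, h'.integral_eq' hφ hc hs, neg_add]

theorem HasWeakDeriv.const_smul {u g : Plane → F} (h : HasWeakDeriv Ω i u g) (c : ℝ) :
    HasWeakDeriv Ω i (c • u) (c • g) := by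
  refine hasWeakDeriv_of_integral_eq (h.1.smul c) (h.2.smul c) fun φ hφ hc hs => ?_
  simp only [Pi.smul_apply, smul_comm _ c]
  rw [integral_smul, integral_smul, h.integral_eq' hφ hc hs, smul_neg]

theorem HasWeakDeriv.neg {u g : Plane → F} (h : HasWeakDeriv Ω i u g) :
    HasWeakDeriv Ω i (-u) (-g) := by
  simpa using h.const_smul (-1)

theorem HasWeakDeriv.sub {u u' g g' : Plane → F} (h : HasWeakDeriv Ω i u g)
    (h' : HasWeakDeriv Ω i u' g') : HasWeakDeriv Ω i (u - u') (g - g') := by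
  simpa [sub_eq_add_neg] using h.add h'.neg

theorem hasWeakDeriv_zero : HasWeakDeriv Ω i (0 : Plane → F) 0 :=
  hasWeakDeriv_of_integral_eq (locallyIntegrableOn_zero) (locallyIntegrableOn_zero) (by simp)

theorem HasWeakDeriv.sum {ι : Type*} (s : Finset ι) {u g : ι → Plane → F}
    (h : ∀ k ∈ s, HasWeakDeriv Ω i (u k) (g k)) :
    HasWeakDeriv Ω i (∑ k ∈ s, u k) (∑ k ∈ s, g k) := by
  classical
  induction s using Finset.induction_on with
  | empty => simpa using hasWeakDeriv_zero
  | insert a s ha ih =>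
    rw [Finset.sum_insert ha, Finset.sum_insert ha]
    exact (h a (Finset.mem_insert_self a s)).add
      (ih fun k hk => h k (Finset.mem_insert_of_mem hk))

theorem hasWeakDeriv_of_contDiff {u : Plane → F} (hu : ContDiff ℝ ∞ u) (i : Fin 2) :
    HasWeakDeriv Ω i u (pderiv i u) := by
  have hl : ∀ {w : Plane → F}, Continuous w → LocallyIntegrableOn w Ω := fun hw =>
    hw.locallyIntegrable.locallyIntegrableOn _
  refine hasWeakDeriv_of_integral_eq (hl hu.continuous)
    (hl (contDiff_pderiv hu i).continuous) fun φ hφ hc hs => ?_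
  have hφ' := (contDiff_pderiv hφ i).continuous
  have hc' := hasCompactSupport_pderiv hc i
  have := integral_smul_fderiv_eq_neg_fderiv_smul_of_integrable (μ := (volume : Measure Plane))
    (f := φ) (g := u) (v := EuclideanSpace.single i 1)
    (hu.continuous.locallyIntegrable.integrable_smul_left_of_hasCompactSupport hφ' hc')
    ((contDiff_pderiv hu i).continuous.locallyIntegrable.integrable_smul_left_of_hasCompactSupport
      hφ.continuous hc)
    (hu.continuous.locallyIntegrable.integrable_smul_left_of_hasCompactSupport hφ.continuous hc)
    (fun x _ => hφ.differentiable (by simp) x) (fun x _ => hu.differentiable (by simp) x)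
  rw [eq_neg_iff_add_eq_zero, add_comm, ← eq_neg_iff_add_eq_zero]
  exact this

/-- The product rule, for a cutoff function supported in `Ω`; the product has a weak derivative on
the whole plane. -/
theorem HasWeakDeriv.cutoff {u g : Plane → F} (h : HasWeakDeriv Ω i u g) {χ : Plane → ℝ}
    (hχ : ContDiff ℝ ∞ χ) (hχc : HasCompactSupport χ) (hχs : tsupport χ ⊆ Ω) :
    HasWeakDeriv univ i (χ • u) (pderiv i χ • u + χ • g) := by
  have hχ' := (contDiff_pderiv hχ i)
  have hχc' := hasCompactSupport_pderiv hχc i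
  have hχs' := (tsupport_pderiv_subset i χ).trans hχs
  have I1 := integrableOn_smul_of_tsupport_subset h.1 hχ.continuous hχc hχs
  have I2 := integrableOn_smul_of_tsupport_subset h.1 hχ'.continuous hχc' hχs'
  have I3 := integrableOn_smul_of_tsupport_subset h.2 hχ.continuous hχc hχs
  refine hasWeakDeriv_of_integral_eq (I1.locallyIntegrable.locallyIntegrableOn _)
    ((I2.add I3).locallyIntegrable.locallyIntegrableOn _) fun φ hφ hc _ => ?_
  have sub : ∀ α β : Plane → ℝ, tsupport (fun x => α x * β x) ⊆ tsupport β :=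
    fun α β => tsupport_mul_subset_right
  have key := h.integral_eq' (φ := fun x => φ x * χ x) (hφ.mul hχ) hχc.mul_left
    ((sub φ χ).trans hχs)
  have J1 : Integrable (fun x => (pderiv i φ x * χ x) • u x) :=
    integrableOn_smul_of_tsupport_subset h.1 ((contDiff_pderiv hφ i).mul hχ).continuous
      hχc.mul_left ((sub _ χ).trans hχs)
  have J2 : Integrable (fun x => (φ x * pderiv i χ x) • u x) :=
    integrableOn_smul_of_tsupport_subset h.1 (hφ.mul hχ').continuous hχc'.mul_left
      ((sub _ _).trans hχs')
  have J3 : Integrable (fun x => (φ x * χ x) • g x) :=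
    integrableOn_smul_of_tsupport_subset h.2 (hφ.mul hχ).continuous hχc.mul_left
      ((sub _ _).trans hχs)
  have e : ∀ x, pderiv i (fun x => φ x * χ x) x = pderiv i φ x * χ x + φ x * pderiv i χ x :=
    fun x => congrFun (pderiv_smul hφ hχ i) x
  have k1 : ∫ x, pderiv i (fun x => φ x * χ x) x • u x
      = (∫ x, (pderiv i φ x * χ x) • u x) + ∫ x, (φ x * pderiv i χ x) • u x := by
    rw [← integral_add J1 J2]
    simp only [e, add_smul]
  have k2 : ∫ x, φ x • (pderiv i χ • u + χ • g) x
      = (∫ x, (φ x * pderiv i χ x) • u x) + ∫ x, (φ x * χ x) • g x := by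
    rw [← integral_add J2 J3]
    simp only [Pi.add_apply, Pi.smul_apply', smul_add, mul_smul]
  have k3 : ∫ x, pderiv i φ x • (χ • u) x = ∫ x, (pderiv i φ x * χ x) • u x := by
    simp only [Pi.smul_apply', mul_smul]
  rw [k3, k2, eq_sub_of_add_eq k1.symm, key]
  abel

/-- Weak derivatives commute. -/
theorem HasWeakDeriv.comm [CompleteSpace F] (hΩ : IsOpen Ω) {j : Fin 2}
    {u g g' h h' : Plane → F} (hg : HasWeakDeriv Ω i u g) (hg' : HasWeakDeriv Ω j u g')
    (hh : HasWeakDeriv Ω j g h) (hh' : HasWeakDeriv Ω i g' h') :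
    h =ᵐ[volume.restrict Ω] h' := by
  refine hh.ae_eq hΩ (hasWeakDeriv_of_integral_eq hh.1 hh'.2 fun φ hφ hc hs => ?_)
  have a1 := hg.integral_eq' (contDiff_pderiv hφ j) (hasCompactSupport_pderiv hc j)
    ((tsupport_pderiv_subset j φ).trans hs)
  have a2 := hg'.integral_eq' (contDiff_pderiv hφ i) (hasCompactSupport_pderiv hc i)
    ((tsupport_pderiv_subset i φ).trans hs)
  have a3 := hh'.integral_eq' hφ hc hs
  rw [pderiv_comm hφ, a2, a3, neg_neg] at a1
  rw [a1, neg_neg]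

theorem weakDeriv_ae_eq [CompleteSpace F] (hΩ : IsOpen Ω) {u g : Plane → F}
    (h : HasWeakDeriv Ω i u g) : weakDeriv Ω i u =ᵐ[volume.restrict Ω] g :=
  (hasWeakDeriv_weakDeriv h).ae_eq hΩ h

end WeakDerivative

/-! ### Weak derivatives under rescaling -/

section Rescaling

variable {F : Type*} [NormedAddCommGroup F] [NormedSpace ℝ F] {i : Fin 2}

theorem HasWeakDeriv.comp_rescale {u g : Plane → F} (h : HasWeakDeriv univ i u g) (a : Plane)
    {s : ℝ} (hs : 0 < s) :
    HasWeakDeriv univ i (fun x => s • u (s⁻¹ • (x - a))) (fun x => g (s⁻¹ • (x - a))) := by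
  have hloc : ∀ w : Plane → F, LocallyIntegrableOn w univ →
      LocallyIntegrableOn (fun x => w (s⁻¹ • (x - a))) univ := by
    intro w hw
    rw [locallyIntegrableOn_univ] at hw ⊢
    rw [locallyIntegrable_iff] at hw ⊢
    intro K hK
    let T : Plane ≃ₜ Plane :=
      (Homeomorph.subRight a).trans (Homeomorph.smulOfNeZero s⁻¹ (by positivity))
    have hT : ∀ x, T x = s⁻¹ • (x - a) := fun x => rfl
    have h1 : IntegrableOn w (T '' K) := hw _ (hK.image T.continuous)
    have h2 : Integrable ((T '' K).indicator w) := by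
      rwa [integrable_indicator_iff (hK.image T.continuous).isClosed.measurableSet]
    have h3 : Integrable (fun x => (T '' K).indicator w (s⁻¹ • (x - a))) :=
      (h2.comp_smul (R := s⁻¹) (by positivity)).comp_sub_right a
    rw [← integrable_indicator_iff hK.isClosed.measurableSet]
    refine h3.congr (Eventually.of_forall fun x => ?_)
    by_cases hx : x ∈ K
    · simp only [indicator_of_mem hx]
      rw [← hT, indicator_of_mem (mem_image_of_mem _ hx)]
    · simp only [indicator_of_notMem hx]
      rw [← hT, indicator_of_notMem]
      rwa [T.injective.mem_set_image]
  refine hasWeakDeriv_of_integral_eq ((hloc u h.1).smul s) (hloc g h.2) fun φ hφ hc _ => ?_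
  have cov : ∀ w : Plane → F, ∫ x, w x = s ^ 2 • ∫ y, w (a + s • y) := by
    intro w
    have e1 : ∫ x, w x = ∫ x, w (a + x) := (integral_add_left_eq_self w a).symm
    have e2 := Measure.integral_comp_smul_of_nonneg (volume : Measure Plane)
      (fun x => w (a + x)) s (hR := hs.le)
    rw [e1, e2, finrank_euclideanSpace, Fintype.card_fin, smul_smul, mul_inv_cancel₀ (by positivity),
      one_smul]
  set ψ : Plane → ℝ := fun y => φ (a + s • y) with hψ
  have hψd : ContDiff ℝ ∞ ψ := hφ.comp (by fun_prop)
  have hψc : HasCompactSupport ψ := by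
    have := hc.comp_homeomorph
      ((Homeomorph.smulOfNeZero s hs.ne').trans (Homeomorph.addLeft a) : Plane ≃ₜ Plane)
    exact this
  have hψ' : ∀ y, pderiv i ψ y = s * pderiv i φ (a + s • y) := by
    intro y
    unfold pderiv
    have h1 : HasFDerivAt (fun y : Plane => a + s • y) (s • ContinuousLinearMap.id ℝ Plane) y :=
      ((hasFDerivAt_id y).const_smul s).const_add a
    have h2 := ((hφ.differentiable (by simp) (a + s • y)).hasFDerivAt.comp y h1)
    rw [show ψ = φ ∘ (fun y : Plane => a + s • y) from rfl, h2.fderiv]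
    simp
  have key := h.integral_eq' hψd hψc (subset_univ _)
  rw [cov (fun x => pderiv i φ x • s • u (s⁻¹ • (x - a))),
    cov (fun x => φ x • g (s⁻¹ • (x - a)))]
  have inv : ∀ y : Plane, s⁻¹ • (a + s • y - a) = y := by
    intro y
    rw [add_sub_cancel_left, smul_smul, inv_mul_cancel₀ hs.ne', one_smul]
  simp only [inv]
  simp only [hψ'] at key
  rw [← smul_neg, ← key]
  congr 2
  ext1 y
  rw [smul_smul, mul_comm]

end Rescaling

/-! ### Weak Hessians on the plane -/

section WeakHessian

variable {F : Type*} [NormedAddCommGroup F] [NormedSpace ℝ F]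

/-- On the whole plane, `D i` is the weak derivative `∂ᵢ u` and `H i j` is `∂ⱼ∂ᵢ u`. -/
structure HasWeakHess (u : Plane → F) (D : Fin 2 → Plane → F) (H : Fin 2 → Fin 2 → Plane → F) :
    Prop where
  grad : ∀ i, HasWeakDeriv univ i u (D i)
  hess : ∀ i j, HasWeakDeriv univ j (D i) (H i j)

variable {u u' : Plane → F} {D D' : Fin 2 → Plane → F} {H H' : Fin 2 → Fin 2 → Plane → F}

theorem HasWeakHess.add (h : HasWeakHess u D H) (h' : HasWeakHess u' D' H') :
    HasWeakHess (u + u') (D + D') (H + H') :=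
  ⟨fun i => (h.1 i).add (h'.1 i), fun i j => (h.2 i j).add (h'.2 i j)⟩

theorem HasWeakHess.sub (h : HasWeakHess u D H) (h' : HasWeakHess u' D' H') :
    HasWeakHess (u - u') (D - D') (H - H') :=
  ⟨fun i => (h.1 i).sub (h'.1 i), fun i j => (h.2 i j).sub (h'.2 i j)⟩

theorem HasWeakHess.sum {ι : Type*} (s : Finset ι) {u : ι → Plane → F}
    {D : ι → Fin 2 → Plane → F} {H : ι → Fin 2 → Fin 2 → Plane → F}
    (h : ∀ k ∈ s, HasWeakHess (u k) (D k) (H k)) :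
    HasWeakHess (∑ k ∈ s, u k) (fun i => ∑ k ∈ s, D k i) (fun i j => ∑ k ∈ s, H k i j) :=
  ⟨fun i => HasWeakDeriv.sum s fun k hk => (h k hk).1 i,
    fun i j => HasWeakDeriv.sum s fun k hk => (h k hk).2 i j⟩

theorem hasWeakHess_of_contDiff (hu : ContDiff ℝ ∞ u) :
    HasWeakHess u (fun i => pderiv i u) (fun i j => pderiv j (pderiv i u)) :=
  ⟨fun i => hasWeakDeriv_of_contDiff hu i,
    fun i j => hasWeakDeriv_of_contDiff (contDiff_pderiv hu i) j⟩

theorem HasWeakHess.comp_rescale (h : HasWeakHess u D H) (a : Plane) {s : ℝ} (hs : 0 < s) :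
    HasWeakHess (fun x => s ^ 2 • u (s⁻¹ • (x - a))) (fun i x => s • D i (s⁻¹ • (x - a)))
      (fun i j x => H i j (s⁻¹ • (x - a))) := by
  refine ⟨fun i => ?_, fun i j => (h.2 i j).comp_rescale a hs⟩
  have := ((h.1 i).comp_rescale a hs).const_smul s
  simpa [Pi.smul_def, smul_smul, pow_two] using this

end WeakHessian

/-! ### Mollification -/

section Mollification

open scoped Convolution

variable {F : Type*} [NormedAddCommGroup F] [NormedSpace ℝ F]

/-- A smooth bump function at the origin, supported in the ball of radius `1 / (k + 1)`. -/
def mollifierBump (k : ℕ) : ContDiffBump (0 : Plane) where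
  rIn := 1 / (2 * (k + 1))
  rOut := 1 / (k + 1)
  rIn_pos := by positivity
  rIn_lt_rOut := by
    apply one_div_lt_one_div_of_lt <;> first | positivity | nlinarith [(Nat.cast_nonneg k : (0:ℝ) ≤ k)]

/-- The standard mollifier: smooth, nonnegative, of integral `1`. -/
def mollifier (k : ℕ) : Plane → ℝ := (mollifierBump k).normed volume

/-- The mollification of `u` at scale `1 / (k + 1)`. -/
def mollify (k : ℕ) (u : Plane → F) : Plane → F :=
  mollifier k ⋆[ContinuousLinearMap.lsmul ℝ ℝ, volume] u

theorem contDiff_mollifier (k : ℕ) : ContDiff ℝ ∞ (mollifier k) :=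
  (mollifierBump k).contDiff_normed

theorem hasCompactSupport_mollifier (k : ℕ) : HasCompactSupport (mollifier k) :=
  (mollifierBump k).hasCompactSupport_normed

theorem mollifier_nonneg (k : ℕ) (x : Plane) : 0 ≤ mollifier k x :=
  (mollifierBump k).nonneg_normed x

theorem integral_mollifier (k : ℕ) : ∫ x, mollifier k x = 1 :=
  (mollifierBump k).integral_normed

theorem mollify_eq_integral (k : ℕ) (u : Plane → F) (x : Plane) :
    mollify k u x = ∫ t, mollifier k t • u (x - t) := rfl

theorem mollify_eq_integral' (k : ℕ) (u : Plane → F) (x : Plane) :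
    mollify k u x = ∫ y, mollifier k (x - y) • u y := by
  rw [mollify, convolution_lsmul_swap]

theorem contDiff_mollify (k : ℕ) {u : Plane → F} (hu : LocallyIntegrable u) :
    ContDiff ℝ ∞ (mollify k u) :=
  (hasCompactSupport_mollifier k).contDiff_convolution_left _ (contDiff_mollifier k) hu

theorem pderiv_mollify (k : ℕ) {i : Fin 2} {u g : Plane → F} (h : HasWeakDeriv univ i u g) :
    pderiv i (mollify k u) = mollify k g := by
  ext1 x
  have hu : LocallyIntegrable u := locallyIntegrableOn_univ.1 h.1
  have h1 := ((hasCompactSupport_mollifier k).hasFDerivAt_convolution_left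
    (ContinuousLinearMap.lsmul ℝ ℝ) ((contDiff_mollifier k).of_le (by simp)) hu x).fderiv
  have hc : HasCompactSupport (fun y => mollifier k (x - y)) :=
    (hasCompactSupport_mollifier k).comp_homeomorph (Homeomorph.subLeft x)
  have hd : ContDiff ℝ ∞ (fun y => mollifier k (x - y)) :=
    (contDiff_mollifier k).comp (contDiff_const.sub contDiff_id)
  have h2 := h.integral_eq' hd hc (subset_univ _)
  have h3 : ∀ y, pderiv i (fun y => mollifier k (x - y)) y = - pderiv i (mollifier k) (x - y) := by
    intro y
    have e : HasFDerivAt (fun y : Plane => x - y) (-ContinuousLinearMap.id ℝ Plane) y :=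
      (hasFDerivAt_id y).const_sub x
    have := (((contDiff_mollifier k).differentiable (by simp) (x - y)).hasFDerivAt.comp y e).fderiv
    unfold pderiv
    rw [show (fun y => mollifier k (x - y)) = mollifier k ∘ (fun y => x - y) from rfl, this]
    simp
  simp only [h3, neg_smul, integral_neg, neg_inj] at h2
  rw [mollify_eq_integral', ← h2]
  change fderiv ℝ (mollifier k ⋆[ContinuousLinearMap.lsmul ℝ ℝ, volume] u) x _ = _
  rw [h1, convolution_eq_swap, ContinuousLinearMap.integral_apply]
  · rfl
  · have := ((hasCompactSupport_mollifier k).fderiv ℝ).convolutionExists_left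
      ((ContinuousLinearMap.lsmul ℝ ℝ : ℝ →L[ℝ] F →L[ℝ] F).precompL Plane)
      ((contDiff_mollifier k).continuous_fderiv (by simp)) hu x
    exact this.integrable_swap

theorem mollify_congr (k : ℕ) {u v : Plane → F} (h : u =ᵐ[volume] v) : mollify k u = mollify k v :=
  convolution_congr _ (EventuallyEq.refl _ _) h

theorem mollify_sub (k : ℕ) {u v : Plane → F} (hu : LocallyIntegrable u)
    (hv : LocallyIntegrable v) : mollify k (u - v) = mollify k u - mollify k v := by
  have E : ∀ w : Plane → F, LocallyIntegrable w → ∀ x,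
      Integrable (fun t => mollifier k t • w (x - t)) := fun w hw x =>
    (hasCompactSupport_mollifier k).convolutionExists_left (ContinuousLinearMap.lsmul ℝ ℝ)
      (contDiff_mollifier k).continuous hw x
  ext1 x
  simp only [Pi.sub_apply, mollify_eq_integral, smul_sub]
  rw [integral_sub (E u hu x) (E v hv x)]

theorem mollify_eq_zero (k : ℕ) {u : Plane → F} {x : Plane}
    (h : ∀ y ∈ Metric.ball x (1 / (k + 1)), u y = 0) : mollify k u x = 0 := by
  rw [mollify_eq_integral']
  refine integral_eq_zero_of_ae (Eventually.of_forall fun y => ?_)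
  by_cases hy : y ∈ Metric.ball x (1 / (k + 1))
  · simp [h y hy]
  · have : mollifier k (x - y) = 0 := by
      by_contra h0
      have : x - y ∈ Function.support (mollifier k) := h0
      rw [mollifier, ContDiffBump.support_normed_eq] at this
      apply hy
      rw [Metric.mem_ball, dist_comm, dist_eq_norm]
      simpa [mollifierBump] using this
    simp [this]

/-- Young's inequality `‖ρ * u‖_p ≤ ‖u‖_p`, by Jensen's inequality for the probability measure
`ρ dx`. -/
theorem eLpNorm_mollify_le (k : ℕ) {u : Plane → F} (hu : AEStronglyMeasurable u)
    {p : ℝ≥0∞} (hp : 1 ≤ p) (hp' : p ≠ ⊤) : eLpNorm (mollify k u) p ≤ eLpNorm u p := by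
  obtain ⟨v, hv, huv⟩ := hu
  rw [mollify_congr k huv, eLpNorm_congr_ae huv]
  have hp0 : p ≠ 0 := (zero_lt_one.trans_le hp).ne'
  have hpr : 0 < p.toReal := ENNReal.toReal_pos hp0 hp'
  have hm : Measurable fun t => ENNReal.ofReal (mollifier k t) :=
    (contDiff_mollifier k).continuous.measurable.ennreal_ofReal
  set ν : Measure Plane := volume.withDensity fun t => ENNReal.ofReal (mollifier k t) with hν
  have hν1 : IsProbabilityMeasure ν := ⟨by
    rw [hν, withDensity_apply _ MeasurableSet.univ, Measure.restrict_univ,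
      ← ofReal_integral_eq_lintegral_ofReal
        ((contDiff_mollifier k).continuous.integrable_of_hasCompactSupport
          (hasCompactSupport_mollifier k)) (Eventually.of_forall (mollifier_nonneg k)),
      integral_mollifier, ENNReal.ofReal_one]⟩
  have hvm : ∀ x, StronglyMeasurable fun t => v (x - t) := fun x =>
    hv.comp_measurable (measurable_const.sub measurable_id)
  have key : ∀ x, ‖mollify k v x‖ₑ ^ p.toReal ≤ ∫⁻ t, ‖v (x - t)‖ₑ ^ p.toReal ∂ν := by
    intro x
    have h1 : ‖mollify k v x‖ₑ ≤ eLpNorm (fun t => v (x - t)) 1 ν := by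
      rw [eLpNorm_one_eq_lintegral_enorm, hν,
        lintegral_withDensity_eq_lintegral_mul _ hm (hvm x).enorm, mollify_eq_integral]
      refine (enorm_integral_le_lintegral_enorm _).trans (lintegral_mono fun t => ?_)
      simp only [Pi.mul_apply, enorm_smul]
      rw [Real.enorm_of_nonneg (mollifier_nonneg k t)]
    have h2 := h1.trans
      (eLpNorm_le_eLpNorm_of_exponent_le hp (hvm x).aestronglyMeasurable)
    rw [eLpNorm_eq_lintegral_rpow_enorm_toReal hp0 hp'] at h2
    calc _ ≤ _ := ENNReal.rpow_le_rpow h2 hpr.le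
      _ = _ := by rw [← ENNReal.rpow_mul, one_div_mul_cancel hpr.ne', ENNReal.rpow_one]
  rw [eLpNorm_eq_lintegral_rpow_enorm_toReal hp0 hp',
    eLpNorm_eq_lintegral_rpow_enorm_toReal hp0 hp']
  refine ENNReal.rpow_le_rpow ?_ (by positivity)
  calc ∫⁻ x, ‖mollify k v x‖ₑ ^ p.toReal ≤ ∫⁻ x, ∫⁻ t, ‖v (x - t)‖ₑ ^ p.toReal ∂ν :=
        lintegral_mono key
    _ = ∫⁻ t, (∫⁻ x, ‖v (x - t)‖ₑ ^ p.toReal) ∂ν := by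
        refine lintegral_lintegral_swap ?_
        exact ((hv.comp_measurable (measurable_fst.sub measurable_snd)).enorm.pow_const
          _).aemeasurable
    _ = ∫⁻ t, (∫⁻ x, ‖v x‖ₑ ^ p.toReal) ∂ν := by
        refine lintegral_congr fun t => ?_
        exact lintegral_sub_right_eq_self (fun x => ‖v x‖ₑ ^ p.toReal) t
    _ = _ := by simp

theorem tendsto_mollify_of_continuous {c : Plane → F} [CompleteSpace F] (hc : Continuous c)
    (hcs : HasCompactSupport c) (p : ℝ≥0∞) :
    Tendsto (fun k => eLpNorm (mollify k c - c) p) atTop (𝓝 0) := by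
  set K := Metric.cthickening 1 (tsupport c) with hK
  have hKc : IsCompact K := IsCompact.cthickening hcs
  have hKm : MeasurableSet K := hKc.isClosed.measurableSet
  have hKμ : volume K ^ (1 / p.toReal) ≠ ⊤ :=
    ENNReal.rpow_ne_top_of_nonneg (by simp) hKc.measure_lt_top.ne
  rw [ENNReal.tendsto_atTop_zero]
  intro ε hε
  obtain ⟨δ, hδ, hδε⟩ : ∃ δ : ℝ, 0 < δ ∧ ENNReal.ofReal δ * volume K ^ (1 / p.toReal) ≤ ε := by
    by_cases he : ε = ⊤
    · exact ⟨1, one_pos, by rw [he]; exact le_top⟩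
    set A := volume K ^ (1 / p.toReal)
    refine ⟨ε.toReal / (A.toReal + 1), div_pos (ENNReal.toReal_pos hε.ne' he) (by positivity), ?_⟩
    nth_rewrite 2 [← ENNReal.ofReal_toReal hKμ]
    rw [← ENNReal.ofReal_mul (by positivity)]
    refine (ENNReal.ofReal_le_ofReal ?_).trans ENNReal.ofReal_toReal_le
    rw [div_mul_eq_mul_div]
    apply div_le_of_le_mul₀ (by positivity) (by positivity)
    exact mul_le_mul_of_nonneg_left (by linarith) (by positivity)
  have huc := hcs.uniformContinuous_of_continuous hc
  obtain ⟨η, hη, hη'⟩ := Metric.uniformContinuous_iff.1 huc δ hδ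
  obtain ⟨N, hN⟩ := exists_nat_one_div_lt hη
  refine ⟨N, fun k hk => ?_⟩
  have hkη : (1 : ℝ) / (k + 1) < η :=
    (one_div_le_one_div_of_le (by positivity) (by exact_mod_cast Nat.succ_le_succ hk)).trans_lt hN
  have hb : ∀ x, ‖(mollify k c - c) x‖ ≤ δ := by
    intro x
    rw [Pi.sub_apply, ← dist_eq_norm]
    refine (mollifierBump k).dist_normed_convolution_le hc.aestronglyMeasurable fun y hy => ?_
    exact (hη' (lt_trans (by simpa [mollifierBump] using hy) hkη)).le
  have hz : ∀ x, x ∉ K → (mollify k c - c) x = 0 := by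
    intro x hx
    have hx' : ∀ y ∈ tsupport c, 1 < dist x y := by
      intro y hy
      by_contra h
      exact hx (Metric.mem_cthickening_of_dist_le x y 1 _ hy (not_lt.1 h))
    have c0 : c x = 0 := image_eq_zero_of_notMem_tsupport fun h => by
      have := hx' x h
      rw [dist_self] at this
      linarith
    rw [Pi.sub_apply, c0, sub_zero]
    refine mollify_eq_zero k fun y hy => image_eq_zero_of_notMem_tsupport fun h => ?_
    have h1 := hx' y h
    rw [Metric.mem_ball, dist_comm] at hy
    have : (1 : ℝ) / (k + 1) ≤ 1 := by
      rw [div_le_one (by positivity)]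
      linarith [(Nat.cast_nonneg k : (0 : ℝ) ≤ k)]
    linarith
  have hle : ∀ x, ‖(mollify k c - c) x‖ ≤ K.indicator (fun _ => δ) x := fun x => by
    by_cases hx : x ∈ K
    · rw [indicator_of_mem hx]; exact hb x
    · rw [indicator_of_notMem hx, hz x hx, norm_zero]
  refine (eLpNorm_mono_real hle).trans ((eLpNorm_indicator_const_le δ p).trans ?_)
  rw [Real.enorm_of_nonneg hδ.le]
  exact hδε

/-- Mollifications converge in `L^p`, `1 ≤ p < ∞`. -/
theorem tendsto_eLpNorm_mollify_sub [CompleteSpace F] {u : Plane → F} {p : ℝ≥0∞} (hp : 1 ≤ p)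
    (hp' : p ≠ ⊤) (hu : MemLp u p) :
    Tendsto (fun k => eLpNorm (mollify k u - u) p) atTop (𝓝 0) := by
  rw [ENNReal.tendsto_atTop_zero]
  intro ε hε
  have hε3 : ε / 3 ≠ 0 := (ENNReal.div_pos hε.ne' (by simp)).ne'
  obtain ⟨c, hcs, hc1, hc, hcm⟩ := hu.exists_hasCompactSupport_eLpNorm_sub_le hp' hε3
  obtain ⟨N, hN⟩ := ENNReal.tendsto_atTop_zero.1 (tendsto_mollify_of_continuous hc hcs p)
    (ε / 3) (pos_iff_ne_zero.2 hε3)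
  have hul := hu.locallyIntegrable hp
  have hcl := hcm.locallyIntegrable hp
  refine ⟨N, fun k hk => ?_⟩
  have e : mollify k u - u = mollify k (u - c) + ((mollify k c - c) - (u - c)) := by
    rw [mollify_sub k hul hcl]; abel
  have m1 : AEStronglyMeasurable (mollify k (u - c)) volume :=
    (contDiff_mollify k (hul.sub hcl)).continuous.aestronglyMeasurable
  have m2 : AEStronglyMeasurable (mollify k c - c) volume :=
    (contDiff_mollify k hcl).continuous.aestronglyMeasurable.sub hc.aestronglyMeasurable
  have m3 : AEStronglyMeasurable (u - c) volume := hu.1.sub hc.aestronglyMeasurable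
  rw [e]
  calc _ ≤ eLpNorm (mollify k (u - c)) p + (eLpNorm (mollify k c - c) p + eLpNorm (u - c) p) :=
        (eLpNorm_add_le m1 (m2.sub m3) hp).trans (by gcongr; exact eLpNorm_sub_le m2 m3 hp)
    _ ≤ ε / 3 + (ε / 3 + ε / 3) := by
        gcongr
        · exact (eLpNorm_mollify_le k m3 hp hp').trans hc1
        · exact hN k hk
    _ = ε := by rw [← add_assoc, ENNReal.add_thirds]

end Mollification

/-! ### Sobolev spaces and traces -/

section SobolevSpaces

variable {F : Type*} [NormedAddCommGroup F] [NormedSpace ℝ F] {Ω : Set Plane} {p : ℝ≥0∞}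

theorem weakDeriv_congr {u u' : Plane → F} (h : u =ᵐ[volume.restrict Ω] u') (i : Fin 2) :
    weakDeriv Ω i u = weakDeriv Ω i u' := by
  have : HasWeakDeriv Ω i u = HasWeakDeriv Ω i u' := by
    ext g
    exact ⟨fun hg => hg.congr h (ae_eq_refl _), fun hg => hg.congr h.symm (ae_eq_refl _)⟩
  classical
  have key : ∀ P Q : (Plane → F) → Prop, P = Q →
      (if h : ∃ g, P g then h.choose else 0) = if h : ∃ g, Q g then h.choose else 0 := by
    rintro P _ rfl
    rfl
  exact key _ _ this

theorem normW1_congr {u u' : Plane → F} (h : u =ᵐ[volume.restrict Ω] u') :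
    normW1 Ω p u = normW1 Ω p u' := by
  simp only [normW1, weakDeriv_congr h, eLpNorm_congr_ae h]

theorem normW1_eq [CompleteSpace F] (hΩ : IsOpen Ω) {u : Plane → F} {D : Fin 2 → Plane → F}
    (h : ∀ i, HasWeakDeriv Ω i u (D i)) :
    normW1 Ω p u = eLpNorm u p (volume.restrict Ω)
      + ∑ i, eLpNorm (D i) p (volume.restrict Ω) := by
  unfold normW1
  congr 1
  exact Finset.sum_congr rfl fun i _ => eLpNorm_congr_ae (weakDeriv_ae_eq hΩ (h i))

theorem MemW1.congr {u u' : Plane → F} (h : MemW1 Ω p u) (hu : u =ᵐ[volume.restrict Ω] u') :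
    MemW1 Ω p u' :=
  ⟨(memLp_congr_ae hu).1 h.1, fun i => by
    obtain ⟨g, hg, hm⟩ := h.2 i
    exact ⟨g, hg.congr hu (ae_eq_refl _), hm⟩⟩

theorem MemW1.add {u u' : Plane → F} (h : MemW1 Ω p u) (h' : MemW1 Ω p u') :
    MemW1 Ω p (u + u') :=
  ⟨h.1.add h'.1, fun i => by
    obtain ⟨g, hg, hm⟩ := h.2 i
    obtain ⟨g', hg', hm'⟩ := h'.2 i
    exact ⟨g + g', hg.add hg', hm.add hm'⟩⟩

theorem MemW2.add {u u' : Plane → F} (h : MemW2 Ω p u) (h' : MemW2 Ω p u') :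
    MemW2 Ω p (u + u') :=
  ⟨h.1.add h'.1, fun i => by
    obtain ⟨g, hg, hm⟩ := h.2 i
    obtain ⟨g', hg', hm'⟩ := h'.2 i
    exact ⟨g + g', hg.add hg', hm.add hm'⟩⟩

theorem normW1_add_le [CompleteSpace F] (hΩ : IsOpen Ω) (hp : 1 ≤ p) {u u' : Plane → F}
    {D D' : Fin 2 → Plane → F}
    (h : ∀ i, HasWeakDeriv Ω i u (D i)) (h' : ∀ i, HasWeakDeriv Ω i u' (D' i)) :
    normW1 Ω p (u + u') ≤ normW1 Ω p u + normW1 Ω p u' := by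
  have m : ∀ {w : Plane → F}, LocallyIntegrableOn w Ω →
      AEStronglyMeasurable w (volume.restrict Ω) := fun hw => hw.aestronglyMeasurable
  rw [normW1_eq hΩ fun i => (h i).add (h' i), normW1_eq hΩ h, normW1_eq hΩ h',
    add_add_add_comm, ← Finset.sum_add_distrib]
  gcongr with i
  · exact eLpNorm_add_le (m (h 0).1) (m (h' 0).1) hp
  · exact eLpNorm_add_le (m (h i).2) (m (h' i).2) hp

theorem HasTrace.congr {u u' g : Plane → F} (h : HasTrace Ω u g)
    (hu : u =ᵐ[volume.restrict Ω] u') : HasTrace Ω u' g := by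
  obtain ⟨h1, w, hw, ht, hf⟩ := h
  refine ⟨h1.congr hu, w, hw, ht.congr fun j => normW1_congr ?_, hf⟩
  filter_upwards [hu] with x hx
  simp [hx]

theorem HasTrace.add [CompleteSpace F] (hΩ : IsOpen Ω) {u u' : Plane → F}
    (h : HasTrace Ω u 0) (h' : HasTrace Ω u' 0) : HasTrace Ω (u + u') 0 := by
  obtain ⟨h1, w, hw, ht, hf⟩ := h
  obtain ⟨h1', w', hw', ht', hf'⟩ := h'
  choose D hD _ using h1.2
  choose D' hD' _ using h1'.2
  refine ⟨h1.add h1', fun j => w j + w' j, fun j => (hw j).add (hw' j), ?_, ?_⟩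
  · refine tendsto_of_tendsto_of_tendsto_of_le_of_le tendsto_const_nhds
      (by simpa using ht.add ht') (fun j => zero_le) fun j => ?_
    rw [show w j + w' j - (u + u') = (w j - u) + (w' j - u') by abel]
    exact normW1_add_le hΩ le_rfl (fun i => (hasWeakDeriv_of_contDiff (hw j) i).sub (hD i))
      (fun i => (hasWeakDeriv_of_contDiff (hw' j) i).sub (hD' i))
  · refine tendsto_of_tendsto_of_tendsto_of_le_of_le tendsto_const_nhds
      (by simpa using hf.add hf') (fun j => zero_le) fun j => ?_
    simp only [sub_zero]
    exact eLpNorm_add_le (hw j).continuous.aestronglyMeasurable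
      (hw' j).continuous.aestronglyMeasurable le_rfl

theorem MemW2Zero.add [CompleteSpace F] (hΩ : IsOpen Ω) {u u' : Plane → F}
    (h : MemW2Zero Ω p u) (h' : MemW2Zero Ω p u') : MemW2Zero Ω p (u + u') := by
  refine ⟨h.1.add h'.1, h.2.1.add hΩ h'.2.1, fun i => ((h.2.2 i).add hΩ (h'.2.2 i)).congr ?_⟩
  obtain ⟨g, hg, -⟩ := h.1.2 i
  obtain ⟨g', hg', -⟩ := h'.1.2 i
  exact (((hasWeakDeriv_weakDeriv hg).add (hasWeakDeriv_weakDeriv hg')).ae_eq hΩ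
    (hasWeakDeriv_weakDeriv (hg.add hg')))

/-- A `W^{1,1}` function that vanishes off a compact subset of `Ω` has trace zero: its
mollifications vanish on `∂Ω` at small scales. -/
theorem hasTrace_zero_of_isCompact [CompleteSpace F] (hΩ : IsOpen Ω) {K : Set Plane}
    (hK : IsCompact K) (hKΩ : K ⊆ Ω) {u : Plane → F} {D : Fin 2 → Plane → F}
    (h : ∀ i, HasWeakDeriv univ i u (D i)) (hu : MemLp u 1) (hD : ∀ i, MemLp (D i) 1)
    (hu0 : ∀ x ∉ K, u x = 0) : HasTrace Ω u 0 := by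
  have hul : LocallyIntegrable u := hu.locallyIntegrable le_rfl
  have hDl := fun i => (hD i).locallyIntegrable le_rfl
  refine ⟨⟨hu.restrict Ω, fun i => ⟨D i, (h i).mono (subset_univ _), (hD i).restrict Ω⟩⟩,
    fun k => mollify k u, fun k => contDiff_mollify k hul, ?_, ?_⟩
  · have e : ∀ k, normW1 Ω 1 (mollify k u - u)
        ≤ eLpNorm (mollify k u - u) 1 + ∑ i, eLpNorm (mollify k (D i) - D i) 1 := by
      intro k
      rw [normW1_eq hΩ (D := fun i => mollify k (D i) - D i) fun i => by
        have := hasWeakDeriv_of_contDiff (Ω := Ω) (contDiff_mollify k hul) i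
        rw [pderiv_mollify k (h i)] at this
        exact this.sub ((h i).mono (subset_univ _))]
      gcongr <;> exact Measure.restrict_le_self
    refine tendsto_of_tendsto_of_tendsto_of_le_of_le tendsto_const_nhds ?_
      (fun j => zero_le) e
    have := (tendsto_eLpNorm_mollify_sub le_rfl (by simp) hu).add
      (tendsto_finsetSum (Finset.univ : Finset (Fin 2)) fun i _ =>
        tendsto_eLpNorm_mollify_sub le_rfl (by simp) (hD i))
    simpa using this
  · obtain ⟨δ, hδ, hδs⟩ := hK.exists_thickening_subset_open hΩ hKΩ
    obtain ⟨N, hN⟩ := exists_nat_one_div_lt hδ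
    refine tendsto_const_nhds.congr' ?_
    filter_upwards [eventually_ge_atTop N] with k hk
    have hkδ : (1 : ℝ) / (k + 1) < δ :=
      (one_div_le_one_div_of_le (by positivity) (by exact_mod_cast Nat.succ_le_succ hk)).trans_lt hN
    symm
    rw [eLpNorm_eq_zero_iff (by
      simpa using (contDiff_mollify k hul).continuous.aestronglyMeasurable) one_ne_zero]
    rw [EventuallyEq, ae_restrict_iff' isClosed_frontier.measurableSet]
    refine Eventually.of_forall fun x hx => ?_
    simp only [sub_zero, Pi.zero_apply]
    refine mollify_eq_zero k fun y hy => hu0 y fun hyK => ?_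
    have : x ∈ Ω := hδs (Metric.mem_thickening_iff.2 ⟨y, hyK, by
      rw [dist_comm]; exact (Metric.mem_ball.1 hy).trans hkδ⟩)
    rw [hΩ.frontier_eq] at hx
    exact hx.2 this

theorem MemLp.one_of_isCompact {G : Type*} [NormedAddCommGroup G] {p : ℝ≥0∞} {K : Set Plane}
    (hK : IsCompact K) (hp : 1 ≤ p) {u : Plane → G}
    (hu : MemLp u p) (h0 : ∀ x ∉ K, u x = 0) : MemLp u 1 := by
  have hm := hK.isClosed.measurableSet
  have : IsFiniteMeasure (volume.restrict K) := ⟨by simpa using hK.measure_lt_top⟩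
  have h1 : MemLp u 1 (volume.restrict K) := (hu.restrict K).mono_exponent hp
  rw [← memLp_indicator_iff_restrict hm] at h1
  rwa [indicator_eq_self.2 fun x hx => by_contra fun h => hx (h0 x h)] at h1

/-- A `W^{2,p}` function on the plane that vanishes off a compact subset of `Ω` is in
`W₀^{2,p}(Ω)`. -/
theorem memW2Zero_of_isCompact [CompleteSpace F] (hΩ : IsOpen Ω) (hp : 1 ≤ p) {K : Set Plane}
    (hK : IsCompact K) (hKΩ : K ⊆ Ω) {u : Plane → F} {D : Fin 2 → Plane → F}
    {H : Fin 2 → Fin 2 → Plane → F} (h : HasWeakHess u D H) (hu : MemLp u p)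
    (hD : ∀ i, MemLp (D i) p) (hH : ∀ i j, MemLp (H i j) p) (hu0 : ∀ x ∉ K, u x = 0)
    (hD0 : ∀ i, ∀ x ∉ K, D i x = 0) (hH0 : ∀ i j, ∀ x ∉ K, H i j x = 0) :
    MemW2Zero Ω p u := by
  have hu1 := MemLp.one_of_isCompact hK hp hu hu0
  have hD1 := fun i => MemLp.one_of_isCompact hK hp (hD i) (hD0 i)
  have hH1 := fun i j => MemLp.one_of_isCompact hK hp (hH i j) (hH0 i j)
  refine ⟨⟨hu.restrict Ω, fun i => ⟨D i, (h.1 i).mono (subset_univ _), (hD i).restrict Ω,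
    fun j => ⟨H i j, (h.2 i j).mono (subset_univ _), (hH i j).restrict Ω⟩⟩⟩,
    hasTrace_zero_of_isCompact hΩ hK hKΩ h.1 hu1 hD1 hu0, fun i => ?_⟩
  exact (hasTrace_zero_of_isCompact hΩ hK hKΩ (h.2 i) (hD1 i) (hH1 i) (hD0 i)).congr
    (weakDeriv_ae_eq hΩ ((h.1 i).mono (subset_univ _))).symm

end SobolevSpaces

/-! ### The unit square and extension by zero -/

section UnitSquare

theorem isOpen_unitSquare : IsOpen unitSquare := by
  have : unitSquare = ⋂ i : Fin 2, (fun x : Plane => x i) ⁻¹' Ioo (-(1 / 2) : ℝ) (1 / 2) := by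
    ext x; simp [unitSquare]
  rw [this]
  exact isOpen_iInter_of_finite fun i => isOpen_Ioo.preimage (by fun_prop)

theorem norm_lt_one_of_mem_unitSquare {x : Plane} (hx : x ∈ unitSquare) : ‖x‖ < 1 := by
  have h0 := hx 0
  have h1 := hx 1
  rw [← sq_lt_one_iff₀ (norm_nonneg _), EuclideanSpace.real_norm_sq_eq, Fin.sum_univ_two]
  have a0 : x 0 ^ 2 < (1 / 2) ^ 2 := sq_lt_sq' h0.1 h0.2
  have a1 : x 1 ^ 2 < (1 / 2) ^ 2 := sq_lt_sq' h1.1 h1.2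
  linarith

/-- The point whose `i`-th coordinate is `y.2` and whose other coordinate is `y.1`. -/
def planeOfProd (i : Fin 2) (y : ℝ × ℝ) : Plane := WithLp.toLp 2 fun k => if k = i then y.2 else y.1

theorem measurePreserving_planeOfProd (i : Fin 2) :
    MeasurePreserving (planeOfProd i) (volume : Measure (ℝ × ℝ)) volume := by
  have h1 := (volume_preserving_finTwoArrow ℝ).symm
  have h2 := (PiLp.volume_preserving_toLp (Fin 2))
  have h3 := h2.comp h1
  fin_cases i
  · have h4 := h3.comp (Measure.measurePreserving_swap (μ := (volume : Measure ℝ)) (ν := volume))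
    have e : planeOfProd 0 = (WithLp.toLp 2 ∘ ⇑(MeasurableEquiv.finTwoArrow (α := ℝ)).symm)
        ∘ Prod.swap := by
      funext y
      refine PiLp.ext fun k => ?_
      fin_cases k <;> rfl
    exact e ▸ h4
  · have e : planeOfProd 1 = WithLp.toLp 2 ∘ ⇑(MeasurableEquiv.finTwoArrow (α := ℝ)).symm := by
      funext y
      refine PiLp.ext fun k => ?_
      fin_cases k <;> rfl
    exact e ▸ h3

theorem measurableEmbedding_planeOfProd (i : Fin 2) : MeasurableEmbedding (planeOfProd i) := by
  refine (measurePreserving_planeOfProd i).measurable.measurableEmbedding fun y z h => ?_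
  have h1 := congrArg (fun x : Plane => x i) h
  have h2 := congrArg (fun x : Plane => x (i + 1)) h
  have : i + 1 ≠ i := by fin_cases i <;> decide
  simp only [planeOfProd, if_true, if_neg this] at h1 h2
  exact Prod.ext h2 h1

theorem planeOfProd_preimage_unitSquare (i : Fin 2) :
    planeOfProd i ⁻¹' unitSquare = Ioo (-(1 / 2) : ℝ) (1 / 2) ×ˢ Ioo (-(1 / 2) : ℝ) (1 / 2) := by
  ext y
  fin_cases i <;> simp [planeOfProd, unitSquare, Fin.forall_fin_two, and_comm]

theorem continuous_planeOfProd (i : Fin 2) : Continuous (planeOfProd i) := by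
  unfold planeOfProd
  refine (PiLp.continuous_toLp 2 _).comp (continuous_pi fun k => ?_)
  split_ifs <;> fun_prop

theorem hasDerivAt_planeOfProd (i : Fin 2) (t s : ℝ) :
    HasDerivAt (fun s => planeOfProd i (t, s)) (EuclideanSpace.single i 1) s := by
  have e : (fun s => planeOfProd i (t, s))
      = fun s => planeOfProd i (t, 0) + s • (EuclideanSpace.single i 1 : Plane) := by
    funext s
    refine PiLp.ext fun k => ?_
    by_cases h : k = i <;> simp [planeOfProd, h]
  rw [e]
  simpa using ((hasDerivAt_id' s).smul_const (EuclideanSpace.single i 1 : Plane)).const_add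
    (planeOfProd i (t, 0))

theorem isometry_planeOfProd (i : Fin 2) (c : ℝ) : Isometry fun t => planeOfProd i (t, c) := by
  refine Isometry.of_dist_eq fun t t' => ?_
  rw [EuclideanSpace.dist_eq, Fin.sum_univ_two]
  fin_cases i <;> simp [planeOfProd, Real.sqrt_sq_eq_abs, Real.dist_eq]

theorem planeOfProd_mem_frontier (i : Fin 2) {c t : ℝ} (hc : c = 1 / 2 ∨ c = -(1 / 2))
    (ht : t ∈ Ioo (-(1 / 2) : ℝ) (1 / 2)) : planeOfProd i (t, c) ∈ frontier unitSquare := by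
  have hmem : ∀ s, planeOfProd i (t, s) ∈ unitSquare ↔ s ∈ Ioo (-(1 / 2) : ℝ) (1 / 2) := by
    intro s
    have := Set.ext_iff.1 (planeOfProd_preimage_unitSquare i) (t, s)
    rw [mem_preimage, mem_prod] at this
    rw [this]
    exact and_iff_right ht
  rw [isOpen_unitSquare.frontier_eq]
  refine ⟨?_, ?_⟩
  · have hcl : c ∈ closure (Ioo (-(1 / 2) : ℝ) (1 / 2)) := by
      rw [closure_Ioo (by norm_num)]
      rcases hc with rfl | rfl <;> norm_num
    refine map_mem_closure (f := fun s => planeOfProd i (t, s)) ?_ hcl fun s hs => (hmem s).2 hs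
    exact (continuous_planeOfProd i).comp (by fun_prop)
  · rw [hmem]
    rcases hc with rfl | rfl <;> norm_num

variable {F : Type*} [NormedAddCommGroup F] [NormedSpace ℝ F]

/-- Each edge of the unit square, parametrised isometrically, is a part of its boundary, measured
by `ℋ¹`. -/
theorem lintegral_edge_le (i : Fin 2) {c : ℝ} (hc : c = 1 / 2 ∨ c = -(1 / 2)) (f : Plane → ℝ≥0∞) :
    ∫⁻ t in Ioo (-(1 / 2) : ℝ) (1 / 2), f (planeOfProd i (t, c))
      ≤ ∫⁻ x in frontier unitSquare, f x ∂(Measure.hausdorffMeasure 1 : Measure Plane) := by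
  have hi := isometry_planeOfProd i c
  have hmp : MeasurePreserving (fun t => planeOfProd i (t, c)) volume
      ((Measure.hausdorffMeasure 1 : Measure Plane).restrict
        (range fun t => planeOfProd i (t, c))) := by
    refine ⟨hi.continuous.measurable, ?_⟩
    rw [← hausdorffMeasure_real]
    exact hi.map_hausdorffMeasure (Or.inl zero_le_one)
  have hemb : MeasurableEmbedding fun t => planeOfProd i (t, c) :=
    hi.isClosedEmbedding.measurableEmbedding
  rw [hmp.setLIntegral_comp_emb hemb]
  refine lintegral_mono' ?_ le_rfl
  refine (Measure.restrict_mono_measure Measure.restrict_le_self _).trans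
    (Measure.restrict_mono ?_ le_rfl)
  rintro _ ⟨t, ht, rfl⟩
  exact planeOfProd_mem_frontier i hc ht

/-- The divergence theorem on the unit square, as an inequality. -/
theorem enorm_setIntegral_pderiv_le [CompleteSpace F] {W : Plane → F} (hW : ContDiff ℝ ∞ W)
    (i : Fin 2) :
    ‖∫ x in unitSquare, pderiv i W x‖ₑ
      ≤ 2 * ∫⁻ x in frontier unitSquare, ‖W x‖ₑ ∂(Measure.hausdorffMeasure 1 : Measure Plane) := by
  set I := Ioo (-(1 / 2) : ℝ) (1 / 2) with hI
  have hc : Continuous (pderiv i W) := (contDiff_pderiv hW i).continuous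
  have hint : IntegrableOn (fun y => pderiv i W (planeOfProd i y)) (I ×ˢ I)
      ((volume : Measure ℝ).prod volume) := by
    have : IntegrableOn (fun y => pderiv i W (planeOfProd i y))
        (Icc (-(1 / 2) : ℝ) (1 / 2) ×ˢ Icc (-(1 / 2) : ℝ) (1 / 2))
        ((volume : Measure ℝ).prod volume) :=
      (hc.comp (continuous_planeOfProd i)).continuousOn.integrableOn_compact
        (isCompact_Icc.prod isCompact_Icc)
    exact this.mono_set (prod_mono Ioo_subset_Icc_self Ioo_subset_Icc_self)
  have h1 : ∫ x in unitSquare, pderiv i W x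
      = ∫ t in I, ∫ s in I, pderiv i W (planeOfProd i (t, s)) := by
    rw [← (measurePreserving_planeOfProd i).setIntegral_preimage_emb
      (measurableEmbedding_planeOfProd i), planeOfProd_preimage_unitSquare]
    exact setIntegral_prod _ hint
  have h2 : ∀ t, ∫ s in I, pderiv i W (planeOfProd i (t, s))
      = W (planeOfProd i (t, 1 / 2)) - W (planeOfProd i (t, -(1 / 2))) := by
    intro t
    rw [hI, ← integral_Ioc_eq_integral_Ioo,
      ← intervalIntegral.integral_of_le (by norm_num)]
    refine intervalIntegral.integral_eq_sub_of_hasDerivAt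
      (f := fun s => W (planeOfProd i (t, s))) (fun s _ => ?_) ?_
    · exact (hW.differentiable (by simp) _).hasFDerivAt.comp_hasDerivAt s
        (hasDerivAt_planeOfProd i t s)
    · exact (hc.comp ((continuous_planeOfProd i).comp (by fun_prop))).intervalIntegrable _ _
  have hm : ∀ c, Measurable fun t => ‖W (planeOfProd i (t, c))‖ₑ := fun c =>
    (hW.continuous.comp ((continuous_planeOfProd i).comp (by fun_prop))).enorm.measurable
  rw [h1]
  simp only [h2]
  calc _ ≤ ∫⁻ t in I, ‖W (planeOfProd i (t, 1 / 2)) - W (planeOfProd i (t, -(1 / 2)))‖ₑ :=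
        enorm_integral_le_lintegral_enorm _
    _ ≤ ∫⁻ t in I, (‖W (planeOfProd i (t, 1 / 2))‖ₑ + ‖W (planeOfProd i (t, -(1 / 2)))‖ₑ) :=
        lintegral_mono fun t => enorm_sub_le
    _ = _ := lintegral_add_left (hm _) _
    _ ≤ _ := by
        rw [two_mul]
        exact add_le_add (lintegral_edge_le i (Or.inl rfl) fun x => ‖W x‖ₑ)
          (lintegral_edge_le i (Or.inr rfl) fun x => ‖W x‖ₑ)

/-- A function with trace zero, extended by zero, is weakly differentiable on the plane: in the
integration by parts for smooth functions that approximate it, the boundary term is bounded by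
their `L¹(∂Q, ℋ¹)` norm. -/
theorem HasTrace.hasWeakDeriv_indicator [CompleteSpace F] {u : Plane → F}
    (h : HasTrace unitSquare u 0) (i : Fin 2) :
    HasWeakDeriv univ i (unitSquare.indicator u)
      (unitSquare.indicator (weakDeriv unitSquare i u)) := by
  set Q := unitSquare with hQ
  have hQm : MeasurableSet Q := isOpen_unitSquare.measurableSet
  obtain ⟨⟨hu, hu'⟩, w, hw, ht, hf⟩ := h
  have hg : ∀ i, HasWeakDeriv Q i u (weakDeriv Q i u) ∧ IntegrableOn (weakDeriv Q i u) Q := by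
    intro i
    obtain ⟨g, hg, hm⟩ := hu' i
    exact ⟨hasWeakDeriv_weakDeriv hg,
      (memLp_one_iff_integrable.1 hm).congr (weakDeriv_ae_eq isOpen_unitSquare hg).symm⟩
  have hu1 : IntegrableOn u Q := memLp_one_iff_integrable.1 hu
  have hi : ∀ {v : Plane → F}, IntegrableOn v Q → LocallyIntegrableOn (Q.indicator v) univ :=
    fun hv => ((integrable_indicator_iff hQm).2 hv).locallyIntegrable.locallyIntegrableOn _
  refine hasWeakDeriv_of_integral_eq (hi hu1) (hi (hg i).2) fun φ hφ hc _ => ?_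
  have hφ' := contDiff_pderiv hφ i
  obtain ⟨B, hB⟩ := hφ.continuous.bounded_above_of_compact_support hc
  obtain ⟨B', hB'⟩ := hφ'.continuous.bounded_above_of_compact_support
    (hasCompactSupport_pderiv hc i)
  set M : ℝ := max B B' with hM
  have eM : ∀ x, ‖φ x‖ₑ ≤ ENNReal.ofReal M := fun x => by
    rw [← ofReal_norm]; exact ENNReal.ofReal_le_ofReal ((hB x).trans (le_max_left _ _))
  have eM' : ∀ x, ‖pderiv i φ x‖ₑ ≤ ENNReal.ofReal M := fun x => by
    rw [← ofReal_norm]; exact ENNReal.ofReal_le_ofReal ((hB' x).trans (le_max_right _ _))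
  have e1 : ∀ (ψ : Plane → ℝ) (v : Plane → F),
      ∫ x, ψ x • Q.indicator v x = ∫ x in Q, ψ x • v x := by
    intro ψ v
    rw [← integral_indicator hQm]
    congr 1; ext x
    by_cases hx : x ∈ Q
    · simp [hx]
    · simp [hx]
  have bi : ∀ {ψ : Plane → ℝ} {v : Plane → F}, Continuous ψ →
      (∀ x, ‖ψ x‖ ≤ M) → IntegrableOn v Q → IntegrableOn (fun x => ψ x • v x) Q :=
    fun hψ hb hv => hv.bdd_smul M hψ.aestronglyMeasurable (Eventually.of_forall hb)
  have bM := fun x => (hB x).trans (le_max_left B B')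
  have bM' := fun x => (hB' x).trans (le_max_right B B')
  have I1 := bi hφ'.continuous bM' hu1
  have I2 := bi hφ.continuous bM (hg i).2
  rw [e1, e1, eq_neg_iff_add_eq_zero, ← integral_add I1 I2, ← enorm_eq_zero, ← nonpos_iff_eq_zero]
  have key : ∀ n, ‖∫ x in Q, (pderiv i φ x • u x + φ x • weakDeriv Q i u x)‖ₑ
      ≤ ENNReal.ofReal M * normW1 Q 1 (w n - u) + 2 * (ENNReal.ofReal M *
        eLpNorm (w n - 0) 1 ((Measure.hausdorffMeasure 1 : Measure Plane).restrict (frontier Q))) := by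
    intro n
    have hwi : IntegrableOn (w n) Q := by
      have := (hw n).continuous.continuousOn.integrableOn_compact (μ := volume)
        (isCompact_closedBall (0 : Plane) 1)
      exact this.mono_set fun x hx => by
        simpa using (norm_lt_one_of_mem_unitSquare hx).le
    have hwi' : IntegrableOn (pderiv i (w n)) Q := by
      have := (contDiff_pderiv (hw n) i).continuous.continuousOn.integrableOn_compact (μ := volume)
        (isCompact_closedBall (0 : Plane) 1)
      exact this.mono_set fun x hx => by
        simpa using (norm_lt_one_of_mem_unitSquare hx).le
    have J1 := bi hφ'.continuous bM' (hwi.sub hu1)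
    have J2 := bi hφ.continuous bM (hwi'.sub (hg i).2)
    have J3 := bi hφ'.continuous bM' hwi
    have J4 := bi hφ.continuous bM hwi'
    have a1 : ∫ x in Q, (pderiv i φ x • u x + φ x • weakDeriv Q i u x)
        = (∫ x in Q, pderiv i (φ • w n) x) - ((∫ x in Q, pderiv i φ x • (w n - u) x)
          + ∫ x in Q, φ x • (pderiv i (w n) - weakDeriv Q i u) x) := by
      rw [← integral_add J1 J2, pderiv_smul hφ (hw n)]
      refine Eq.trans ?_ (integral_sub (J3.add J4) (J1.add J2))
      refine integral_congr_ae (Eventually.of_forall fun x => ?_)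
      simp only [Pi.add_apply, Pi.smul_apply', Pi.sub_apply, smul_sub]
      abel
    have a2 : ‖∫ x in Q, pderiv i (φ • w n) x‖ₑ ≤ 2 * (ENNReal.ofReal M *
        eLpNorm (w n - 0) 1
          ((Measure.hausdorffMeasure 1 : Measure Plane).restrict (frontier Q))) := by
      refine (enorm_setIntegral_pderiv_le (hφ.smul (hw n)) i).trans ?_
      gcongr
      rw [sub_zero, eLpNorm_one_eq_lintegral_enorm,
        ← lintegral_const_mul _ (hw n).continuous.enorm.measurable]
      refine lintegral_mono fun x => ?_
      rw [Pi.smul_apply', enorm_smul]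
      gcongr
      exact eM x
    have a3 : ∀ {ψ : Plane → ℝ} {v : Plane → F}, (∀ x, ‖ψ x‖ₑ ≤ ENNReal.ofReal M) →
        ‖∫ x in Q, ψ x • v x‖ₑ ≤ ENNReal.ofReal M * eLpNorm v 1 (volume.restrict Q) := by
      intro ψ v hψ
      refine (enorm_integral_le_lintegral_enorm _).trans ?_
      rw [eLpNorm_one_eq_lintegral_enorm, ← lintegral_const_mul' _ _ ENNReal.ofReal_ne_top]
      refine lintegral_mono fun x => ?_
      rw [enorm_smul]
      gcongr
      exact hψ x
    have a4 : ENNReal.ofReal M * eLpNorm (w n - u) 1 (volume.restrict Q)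
        + ENNReal.ofReal M * eLpNorm (pderiv i (w n) - weakDeriv Q i u) 1 (volume.restrict Q)
        ≤ ENNReal.ofReal M * normW1 Q 1 (w n - u) := by
      rw [normW1_eq isOpen_unitSquare fun j => (hasWeakDeriv_of_contDiff (hw n) j).sub (hg j).1,
        ← mul_add]
      gcongr
      exact Finset.single_le_sum
        (f := fun j => eLpNorm (pderiv j (w n) - weakDeriv Q j u) 1 (volume.restrict Q))
        (fun j _ => zero_le) (Finset.mem_univ i)
    rw [a1]
    calc _ ≤ _ + (_ + _) := enorm_sub_le.trans (by gcongr; exact enorm_add_le _ _)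
      _ ≤ _ + ENNReal.ofReal M * normW1 Q 1 (w n - u) :=
          add_le_add a2 ((add_le_add (a3 eM') (a3 eM)).trans a4)
      _ = _ := add_comm _ _
  have t1 := ENNReal.Tendsto.const_mul (a := ENNReal.ofReal M) ht (Or.inr ENNReal.ofReal_ne_top)
  have t2 := ENNReal.Tendsto.const_mul (a := (2 : ℝ≥0∞))
    (ENNReal.Tendsto.const_mul (a := ENNReal.ofReal M) hf (Or.inr ENNReal.ofReal_ne_top))
    (Or.inr (by simp))
  have t3 := ge_of_tendsto' (t1.add t2) key
  simpa using t3

end UnitSquare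

/-! ### Bounded competitors on the unit square -/

section CellBump

variable {F : Type*} [NormedAddCommGroup F] [NormedSpace ℝ F]

/-- `u` is a `W^{2,∞}` function on the plane that vanishes outside the unit square; `u` and its
gradient are bounded by `M` and its Hessian by `τ`. -/
structure IsCellBump (M τ : ℝ) (u : Plane → F) (D : Fin 2 → Plane → F)
    (H : Fin 2 → Fin 2 → Plane → F) : Prop where
  hess : HasWeakHess u D H
  le : ∀ x, ‖u x‖ ≤ M
  grad_le : ∀ i x, ‖D i x‖ ≤ M
  hess_le : ∀ i j x, ‖H i j x‖ ≤ τ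
  eq_zero : ∀ x ∉ unitSquare, u x = 0
  grad_eq_zero : ∀ i, ∀ x ∉ unitSquare, D i x = 0
  hess_eq_zero : ∀ i j, ∀ x ∉ unitSquare, H i j x = 0

/-- A representative, bounded everywhere, of the extension by zero of an `L^∞` function. -/
theorem exists_bounded_ae_eq_indicator {G : Type*} [NormedAddCommGroup G] {Q : Set Plane}
    (hQ : MeasurableSet Q) {w : Plane → G} (hw : MemLp w ⊤ (volume.restrict Q)) :
    ∃ (w' : Plane → G) (M : ℝ), 0 ≤ M ∧ Q.indicator w =ᵐ[volume] w' ∧ (∀ x, ‖w' x‖ ≤ M) ∧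
      ∀ x ∉ Q, w' x = 0 := by
  classical
  obtain ⟨M, hM⟩ : ∃ M, ∀ᵐ x ∂(volume.restrict Q), ‖w x‖ ≤ M := by
    refine ⟨(eLpNorm w ⊤ (volume.restrict Q)).toReal, ?_⟩
    filter_upwards [ae_le_eLpNormEssSup (f := w) (μ := volume.restrict Q)] with x hx
    rw [← toReal_enorm]
    exact ENNReal.toReal_mono hw.2.ne (by rwa [eLpNorm_exponent_top])
  refine ⟨fun x => if x ∈ Q ∧ ‖w x‖ ≤ M then w x else 0, max M 0, le_max_right _ _, ?_, ?_, ?_⟩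
  · rw [ae_restrict_iff' hQ] at hM
    filter_upwards [hM] with x hx
    by_cases hxQ : x ∈ Q
    · simp [hxQ, hx hxQ]
    · simp [hxQ]
  · intro x
    dsimp only
    split_ifs with h
    · exact h.2.trans (le_max_left _ _)
    · simp
  · intro x hx
    simp [hx]

/-- Extension by zero of a function in `W₀^{2,∞}` of the unit square. -/
theorem MemW2Zero.exists_isCellBump [CompleteSpace F] {φ : Plane → F}
    (h : MemW2Zero unitSquare ⊤ φ) :
    ∃ (u : Plane → F) (D : Fin 2 → Plane → F) (H : Fin 2 → Fin 2 → Plane → F) (M : ℝ),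
      IsCellBump M M u D H ∧ ∀ i j,
        weakDeriv unitSquare j (weakDeriv unitSquare i φ) =ᵐ[volume.restrict unitSquare] H i j := by
  set Q := unitSquare with hQ
  have hQm : MeasurableSet Q := isOpen_unitSquare.measurableSet
  obtain ⟨⟨hφ, hφ'⟩, htr, htr'⟩ := h
  have m1 : ∀ i, MemLp (weakDeriv Q i φ) ⊤ (volume.restrict Q) := by
    intro i
    obtain ⟨g, hg, hm, -⟩ := hφ' i
    exact (memLp_congr_ae (weakDeriv_ae_eq isOpen_unitSquare hg)).2 hm
  have m2 : ∀ i j, MemLp (weakDeriv Q j (weakDeriv Q i φ)) ⊤ (volume.restrict Q) := by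
    intro i j
    obtain ⟨g, hg, -, hm⟩ := hφ' i
    obtain ⟨g', hg', hm'⟩ := hm j
    rw [weakDeriv_congr (weakDeriv_ae_eq isOpen_unitSquare hg)]
    exact (memLp_congr_ae (weakDeriv_ae_eq isOpen_unitSquare hg')).2 hm'
  obtain ⟨u, M0, hM0, hu, hub, hu0⟩ := exists_bounded_ae_eq_indicator hQm hφ
  choose D M1 hM1 hD hDb hD0 using fun i => exists_bounded_ae_eq_indicator hQm (m1 i)
  choose H M2 hM2 hH hHb hH0 using fun i j => exists_bounded_ae_eq_indicator hQm (m2 i j)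
  have l1 : ∀ i, M1 i ≤ ∑ i, M1 i := fun i =>
    Finset.single_le_sum (fun i _ => hM1 i) (Finset.mem_univ i)
  have l2 : ∀ i j, M2 i j ≤ ∑ i, ∑ j, M2 i j := fun i j =>
    (Finset.single_le_sum (f := fun j => M2 i j) (fun j _ => hM2 i j) (Finset.mem_univ j)).trans
      (Finset.single_le_sum (f := fun i => ∑ j, M2 i j)
        (fun i _ => Finset.sum_nonneg fun j _ => hM2 i j) (Finset.mem_univ i))
  have l1' : 0 ≤ ∑ i, M1 i := Finset.sum_nonneg fun i _ => hM1 i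
  have l2' : 0 ≤ ∑ i, ∑ j, M2 i j :=
    Finset.sum_nonneg fun i _ => Finset.sum_nonneg fun j _ => hM2 i j
  refine ⟨u, D, H, M0 + (∑ i, M1 i) + ∑ i, ∑ j, M2 i j, ⟨⟨fun i => ?_, fun i j => ?_⟩,
    fun x => (hub x).trans (by linarith), fun i x => (hDb i x).trans (by linarith [l1 i]),
    fun i j x => (hHb i j x).trans (by linarith [l2 i j]), hu0, hD0, hH0⟩, fun i j => ?_⟩
  · exact (htr.hasWeakDeriv_indicator i).congr (by simpa using hu) (by simpa using hD i)
  · exact ((htr' i).hasWeakDeriv_indicator j).congr (by simpa using hD i) (by simpa using hH i j)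
  · rw [EventuallyEq, ae_restrict_iff' hQm]
    filter_upwards [hH i j] with x hx hxQ
    rw [← hx, indicator_of_mem hxQ]

end CellBump

/-! ### Squares and grids -/

section Cells

/-- The open square with centre `a` and side length `s`. -/
def cell (a : Plane) (s : ℝ) : Set Plane := {x | s⁻¹ • (x - a) ∈ unitSquare}

theorem isOpen_cell (a : Plane) (s : ℝ) : IsOpen (cell a s) :=
  isOpen_unitSquare.preimage (by fun_prop : Continuous fun x : Plane => s⁻¹ • (x - a))

theorem measurableSet_cell (a : Plane) (s : ℝ) : MeasurableSet (cell a s) :=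
  (isOpen_cell a s).measurableSet

theorem volume_unitSquare : volume unitSquare = 1 := by
  rw [← (measurePreserving_planeOfProd 0).measure_preimage_emb (measurableEmbedding_planeOfProd 0),
    planeOfProd_preimage_unitSquare, Measure.volume_eq_prod, Measure.prod_prod, Real.volume_Ioo]
  norm_num

theorem setIntegral_cell {F : Type*} [NormedAddCommGroup F] [NormedSpace ℝ F] (a : Plane) {s : ℝ}
    (hs : 0 < s) (f : Plane → F) :
    ∫ x in cell a s, f (s⁻¹ • (x - a)) = s ^ 2 • ∫ y in unitSquare, f y := by
  rw [← integral_indicator (measurableSet_cell a s),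
    ← integral_indicator isOpen_unitSquare.measurableSet]
  have e : (cell a s).indicator (fun x => f (s⁻¹ • (x - a)))
      = fun x => unitSquare.indicator f (s⁻¹ • (x - a)) := by
    ext x
    by_cases h : s⁻¹ • (x - a) ∈ unitSquare
    · rw [indicator_of_mem h, indicator_of_mem (show x ∈ cell a s from h)]
    · rw [indicator_of_notMem h, indicator_of_notMem (show x ∉ cell a s from h)]
  rw [e, integral_sub_right_eq_self (fun x => unitSquare.indicator f (s⁻¹ • x)) a,
    Measure.integral_comp_inv_smul_of_nonneg _ _ hs.le, finrank_euclideanSpace, Fintype.card_fin]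

theorem volume_cell (a : Plane) {s : ℝ} (hs : 0 < s) :
    volume (cell a s) = ENNReal.ofReal (s ^ 2) := by
  have h := Measure.addHaar_preimage_smul (volume : Measure Plane) (inv_ne_zero hs.ne') unitSquare
  rw [volume_unitSquare, mul_one, finrank_euclideanSpace, Fintype.card_fin, inv_pow, inv_inv,
    abs_of_nonneg (by positivity)] at h
  rw [← h]
  have hm : MeasurableSet ((fun x : Plane => s⁻¹ • x) ⁻¹' unitSquare) :=
    isOpen_unitSquare.measurableSet.preimage (measurable_const_smul _)
  exact (measurePreserving_sub_right volume a).measure_preimage hm.nullMeasurableSet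

theorem mem_cell_iff {a x : Plane} {s : ℝ} (hs : 0 < s) :
    x ∈ cell a s ↔ ∀ i, a i - s / 2 < x i ∧ x i < a i + s / 2 := by
  unfold cell unitSquare
  simp only [mem_ofPred_eq, PiLp.smul_apply, PiLp.sub_apply, smul_eq_mul, mem_Ioo]
  refine forall_congr' fun i => ?_
  rw [inv_mul_eq_div, lt_div_iff₀ hs, div_lt_iff₀ hs]
  constructor <;> rintro ⟨h1, h2⟩ <;> constructor <;> linarith

theorem closure_cell_zero_subset {θ : ℝ} (hθ0 : 0 < θ) (hθ1 : θ < 1) :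
    closure (cell 0 θ) ⊆ unitSquare := by
  have : closure (cell 0 θ) ⊆ {x : Plane | ∀ i, -(θ / 2) ≤ x i ∧ x i ≤ θ / 2} := by
    refine closure_minimal (fun x hx i => ?_) ?_
    · have := (mem_cell_iff hθ0).1 hx i
      simp only [PiLp.zero_apply] at this
      exact ⟨by linarith [this.1], by linarith [this.2]⟩
    · have e : {x : Plane | ∀ i, -(θ / 2) ≤ x i ∧ x i ≤ θ / 2}
          = ⋂ i : Fin 2, (fun x : Plane => x i) ⁻¹' Icc (-(θ / 2)) (θ / 2) := by
        ext x; simp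
      rw [e]
      exact isClosed_iInter fun i => isClosed_Icc.preimage (by fun_prop)
  intro x hx i
  have := this hx i
  exact ⟨by linarith [this.1], by linarith [this.2]⟩

theorem volume_hyperplane (i : Fin 2) (c : ℝ) : volume {x : Plane | x i = c} = 0 := by
  have h := (PiLp.volume_preserving_toLp (Fin 2)).measure_preimage_emb
    (MeasurableEquiv.toLp 2 (Fin 2 → ℝ)).measurableEmbedding {x : Plane | x i = c}
  rw [← h]
  exact Measure.pi_hyperplane (fun _ : Fin 2 => (volume : Measure ℝ)) i c

/-- An open set of finite measure is exhausted, up to small measure, by finitely many disjoint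
squares of an arbitrarily fine grid. -/
theorem exists_cells {G : Set Plane} (hG : IsOpen G) (hGv : volume G ≠ ⊤) {η : ℝ≥0∞} (hη : η ≠ 0)
    {s₀ : ℝ} (hs₀ : 0 < s₀) :
    ∃ s, 0 < s ∧ s < s₀ ∧ ∃ A : Finset Plane, (∀ a ∈ A, cell a s ⊆ G) ∧
      (∀ a ∈ A, ∀ b ∈ A, a ≠ b → Disjoint (cell a s) (cell b s)) ∧
      volume (G \ ⋃ a ∈ A, cell a s) < η := by
  obtain ⟨K, hKG, hK, hKη⟩ := hG.measurableSet.exists_isCompact_sdiff_lt hGv hη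
  obtain ⟨δ, hδ, hδG⟩ := hK.exists_thickening_subset_open hG hKG
  set s := min s₀ δ / 2 with hs
  have hs0 : 0 < s := by have := lt_min hs₀ hδ; positivity
  have hss : s < s₀ := by have := min_le_left s₀ δ; linarith
  have hsδ : 2 * s ≤ δ := by have := min_le_right s₀ δ; linarith
  let c : (Fin 2 → ℤ) → Plane := fun k => WithLp.toLp 2 fun i => s * k i
  have hdisj : ∀ k l, k ≠ l → Disjoint (cell (c k) s) (cell (c l) s) := by
    intro k l hkl
    rw [Set.disjoint_left]
    intro x hx hx'
    apply hkl
    funext i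
    have h1 := (mem_cell_iff hs0).1 hx i
    have h2 := (mem_cell_iff hs0).1 hx' i
    simp only [c] at h1 h2
    have h3 : s * ((k i : ℝ) - l i) < s * 1 := by linarith [h1.1, h2.2]
    have h4 : s * ((l i : ℝ) - k i) < s * 1 := by linarith [h1.2, h2.1]
    have h5 := lt_of_mul_lt_mul_left h3 hs0.le
    have h6 := lt_of_mul_lt_mul_left h4 hs0.le
    have h7 : k i - l i < 1 := by exact_mod_cast h5
    have h8 : l i - k i < 1 := by exact_mod_cast h6
    omega
  let S : Set (Fin 2 → ℤ) := {k | cell (c k) s ⊆ G}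
  -- disjoint squares of equal positive area in a set of finite measure
  have hSfin : S.Finite := by
    have h1 := Measure.finite_const_le_meas_of_disjoint_iUnion (volume : Measure Plane)
      (ε := ENNReal.ofReal (s ^ 2)) (by simp; positivity)
      (As := fun k : S => cell (c k) s) (fun k => measurableSet_cell _ _)
      (fun k l hkl => hdisj _ _ fun h => hkl (Subtype.ext h))
      (((measure_mono (iUnion_subset fun k => k.2)).trans_lt hGv.lt_top).ne)
    have h2 : {k : S | ENNReal.ofReal (s ^ 2) ≤ volume (cell (c k) s)} = univ :=
      eq_univ_of_forall fun k => (volume_cell _ hs0).ge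
    rw [h2] at h1
    exact finite_coe_iff.1 (finite_univ_iff.1 h1)
  classical
  -- the points in no square lie on the grid lines
  have hN : volume {x : Plane | ∀ k, x ∉ cell (c k) s} = 0 := by
    refine measure_mono_null (t := ⋃ i : Fin 2, ⋃ n : ℤ, {x : Plane | x i = s * (n - 1 / 2)}) ?_
      (measure_iUnion_null fun i => measure_iUnion_null fun n => volume_hyperplane i _)
    intro x hx
    by_contra h
    simp only [mem_iUnion, mem_ofPred_eq, not_exists] at h
    refine hx (fun i => ⌊x i / s + 1 / 2⌋) ((mem_cell_iff hs0).2 fun i => ?_)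
    have e : s * (x i / s) = x i := mul_div_cancel₀ _ hs0.ne'
    have h1 := mul_le_mul_of_nonneg_left (Int.floor_le (x i / s + 1 / 2)) hs0.le
    have h2 := mul_lt_mul_of_pos_left (Int.lt_floor_add_one (x i / s + 1 / 2)) hs0
    have h3 := h i ⌊x i / s + 1 / 2⌋
    simp only [c]
    constructor
    · refine lt_of_le_of_ne (by linarith) fun h4 => h3 (by linarith)
    · linarith
  refine ⟨s, hs0, hss, hSfin.toFinset.image c, ?_, ?_, ?_⟩
  · intro a ha
    obtain ⟨k, hk, rfl⟩ := Finset.mem_image.1 ha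
    exact (hSfin.mem_toFinset.1 hk : k ∈ S)
  · intro a ha b hb hab
    obtain ⟨k, hk, rfl⟩ := Finset.mem_image.1 ha
    obtain ⟨l, hl, rfl⟩ := Finset.mem_image.1 hb
    exact hdisj k l fun h => hab (by rw [h])
  · refine lt_of_le_of_lt ?_ hKη
    refine (measure_mono (t := (G \ K) ∪ {x : Plane | ∀ k, x ∉ cell (c k) s}) ?_).trans
      ((measure_union_le _ _).trans (by rw [hN, add_zero]))
    rintro x ⟨hxG, hx⟩
    by_cases hxK : x ∈ K
    · right
      intro k hk
      apply hx
      -- a square that meets `K` has diameter less than `2 * s ≤ δ`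
      have hkS : k ∈ S := by
        intro y hy
        apply hδG
        refine Metric.mem_thickening_iff.2 ⟨x, hxK, ?_⟩
        have n1 : ∀ z ∈ cell (c k) s, ‖z - c k‖ < s := by
          intro z hz
          have := norm_lt_one_of_mem_unitSquare (hz : s⁻¹ • (z - c k) ∈ unitSquare)
          rwa [norm_smul, Real.norm_of_nonneg (by positivity), inv_mul_lt_iff₀ hs0, mul_one] at this
        calc dist y x ≤ dist y (c k) + dist x (c k) := dist_triangle_right _ _ _
          _ < s + s := by rw [dist_eq_norm, dist_eq_norm]; exact add_lt_add (n1 y hy) (n1 x hk)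
          _ ≤ δ := by linarith
      simp only [mem_iUnion]
      exact ⟨c k, Finset.mem_image.2 ⟨k, hSfin.mem_toFinset.2 hkS, rfl⟩, hk⟩
    · exact Or.inl ⟨hxG, hxK⟩

end Cells

/-! ### Pasting rescaled functions -/

section Pasting

variable {F : Type*} [NormedAddCommGroup F] [NormedSpace ℝ F]

/-- The sum over `a ∈ A` of the functions `w a`, transported from the unit square to the square
of centre `a` and side `s` and multiplied by `c`. With `c = s ^ 2`, `s` and `1` this transports
functions, their gradients and their Hessians. -/
def paste (A : Finset Plane) (s c : ℝ) (w : Plane → Plane → F) : Plane → F :=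
  ∑ a ∈ A, fun x => c • w a (s⁻¹ • (x - a))

variable {A : Finset Plane} {s c : ℝ} {w : Plane → Plane → F}

theorem paste_of_mem
    (hA : ∀ a ∈ A, ∀ b ∈ A, a ≠ b → Disjoint (cell a s) (cell b s))
    (hw : ∀ a ∈ A, ∀ x ∉ unitSquare, w a x = 0) {a x : Plane} (ha : a ∈ A) (hx : x ∈ cell a s) :
    paste A s c w x = c • w a (s⁻¹ • (x - a)) := by
  rw [paste, Finset.sum_apply, Finset.sum_eq_single_of_mem a ha]
  intro b hb hba
  rw [hw b hb, smul_zero]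
  exact fun h => Set.disjoint_left.1 (hA b hb a ha hba) h hx

theorem paste_of_notMem (hw : ∀ a ∈ A, ∀ x ∉ unitSquare, w a x = 0) {x : Plane}
    (hx : x ∉ ⋃ a ∈ A, cell a s) : paste A s c w x = 0 := by
  rw [paste, Finset.sum_apply]
  refine Finset.sum_eq_zero fun a ha => ?_
  rw [hw a ha, smul_zero]
  exact fun h => hx (mem_biUnion ha h)

theorem norm_paste_le (hA : ∀ a ∈ A, ∀ b ∈ A, a ≠ b → Disjoint (cell a s) (cell b s))
    (hw : ∀ a ∈ A, ∀ x ∉ unitSquare, w a x = 0) {M : ℝ} (hM0 : 0 ≤ M) (hc : 0 ≤ c)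
    (hM : ∀ a ∈ A, ∀ x, ‖w a x‖ ≤ M) (x : Plane) : ‖paste A s c w x‖ ≤ c * M := by
  by_cases hx : x ∈ ⋃ a ∈ A, cell a s
  · obtain ⟨a, ha, hxa⟩ := mem_iUnion₂.1 hx
    rw [paste_of_mem hA hw ha hxa, norm_smul, Real.norm_of_nonneg hc]
    exact mul_le_mul_of_nonneg_left (hM a ha _) hc
  · rw [paste_of_notMem hw hx, norm_zero]
    positivity

theorem hasWeakHess_paste (hs : 0 < s) {D : Plane → Fin 2 → Plane → F}
    {H : Plane → Fin 2 → Fin 2 → Plane → F} (h : ∀ a ∈ A, HasWeakHess (w a) (D a) (H a)) :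
    HasWeakHess (paste A s (s ^ 2) w) (fun i => paste A s s fun a => D a i)
      (fun i j => paste A s 1 fun a => H a i j) := by
  have := HasWeakHess.sum A fun a ha => (h a ha).comp_rescale a hs
  simpa only [paste, one_smul] using this

end Pasting

/-! ### Cutoff functions and quadratic polynomials -/

section Cutoff

variable {F : Type*} [NormedAddCommGroup F] [NormedSpace ℝ F]

theorem exists_cutoff {K U : Set Plane} (hK : IsCompact K) (hU : IsOpen U) (hKU : K ⊆ U) :
    ∃ χ : Plane → ℝ, ContDiff ℝ ∞ χ ∧ HasCompactSupport χ ∧ tsupport χ ⊆ U ∧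
      ∃ V, IsOpen V ∧ K ⊆ V ∧ ∀ x ∈ V, χ x = 1 := by
  obtain ⟨L, hL, hKL, hLU⟩ := exists_compact_between hK hU hKU
  obtain ⟨χ, h1, h0, -⟩ := exists_contMDiffMap_one_nhds_of_subset_interior (n := (⊤ : ℕ∞))
    (modelWithCornersSelf ℝ Plane) hK.isClosed hKL
  have hs : tsupport χ ⊆ L := closure_minimal (fun x hx => by
    by_contra h
    exact hx (h0 x h)) hL.isClosed
  obtain ⟨V, hV, hKV, hV1⟩ := mem_nhdsSet_iff_exists.1 h1
  exact ⟨χ, χ.contMDiff.contDiff, hL.of_isClosed_subset (isClosed_tsupport _) hs, hs.trans hLU,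
    V, hV, hKV, fun x hx => hV1 hx⟩

theorem pderiv_eqOn {V : Set Plane} (hV : IsOpen V) {u v : Plane → F} (h : EqOn u v V)
    (i : Fin 2) : EqOn (pderiv i u) (pderiv i v) V := by
  intro x hx
  unfold pderiv
  rw [(h.eventuallyEq_of_mem (hV.mem_nhds hx)).fderiv_eq]

theorem pderiv_eq_zero_of_notMem_tsupport {u : Plane → F} {x : Plane} (h : x ∉ tsupport u)
    (i : Fin 2) : pderiv i u x = 0 :=
  image_eq_zero_of_notMem_tsupport fun hx => h (tsupport_pderiv_subset i u hx)

/-- Cutting off a smooth function costs a constant factor, which only depends on the cutoff, in the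
bounds for the function and its derivatives up to order two. -/
theorem exists_isCellBump_cutoff {χ : Plane → ℝ} (hχ : ContDiff ℝ ∞ χ) (hχc : HasCompactSupport χ)
    (hχs : tsupport χ ⊆ unitSquare) :
    ∃ C, 0 ≤ C ∧ ∀ (R : Plane → F) (τ : ℝ), 0 ≤ τ → ContDiff ℝ ∞ R →
      (∀ x ∈ unitSquare, ‖R x‖ ≤ τ) → (∀ i, ∀ x ∈ unitSquare, ‖pderiv i R x‖ ≤ τ) →
      (∀ i j, ∀ x ∈ unitSquare, ‖pderiv j (pderiv i R) x‖ ≤ τ) →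
      IsCellBump (C * τ) (C * τ) (χ • R) (fun i => pderiv i (χ • R))
        (fun i j => pderiv j (pderiv i (χ • R))) := by
  have bdd : ∀ {w : Plane → ℝ}, ContDiff ℝ ∞ w → HasCompactSupport w →
      ∃ C, ∀ x, ‖w x‖ ≤ C := fun hw hc => hw.continuous.bounded_above_of_compact_support hc
  have hχ' := contDiff_pderiv hχ
  have hχc' := hasCompactSupport_pderiv hχc
  have hχ'' := fun i j => contDiff_pderiv (hχ' i) j
  obtain ⟨B0, hB0⟩ := bdd hχ hχc
  choose B1 hB1 using fun i => bdd (hχ' i) (hχc' i)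
  choose B2 hB2 using fun i j => bdd (hχ'' i j) (hasCompactSupport_pderiv (hχc' i) j)
  have p0 : 0 ≤ B0 := (norm_nonneg _).trans (hB0 0)
  have p1 : ∀ i, 0 ≤ B1 i := fun i => (norm_nonneg _).trans (hB1 i 0)
  have p2 : ∀ i j, 0 ≤ B2 i j := fun i j => (norm_nonneg _).trans (hB2 i j 0)
  set B := B0 + (∑ i, B1 i) + ∑ i, ∑ j, B2 i j with hB
  have s1 : 0 ≤ ∑ i, B1 i := Finset.sum_nonneg fun i _ => p1 i
  have s2 : 0 ≤ ∑ i, ∑ j, B2 i j := Finset.sum_nonneg fun i _ => Finset.sum_nonneg fun j _ => p2 i j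
  have l1 : ∀ i, B1 i ≤ ∑ i, B1 i := fun i =>
    Finset.single_le_sum (fun i _ => p1 i) (Finset.mem_univ i)
  have l2 : ∀ i j, B2 i j ≤ ∑ i, ∑ j, B2 i j := fun i j =>
    (Finset.single_le_sum (f := fun j => B2 i j) (fun j _ => p2 i j) (Finset.mem_univ j)).trans
      (Finset.single_le_sum (f := fun i => ∑ j, B2 i j)
        (fun i _ => Finset.sum_nonneg fun j _ => p2 i j) (Finset.mem_univ i))
  have b0 : ∀ x, ‖χ x‖ ≤ B := fun x => (hB0 x).trans (by linarith)
  have b1 : ∀ i x, ‖pderiv i χ x‖ ≤ B := fun i x => (hB1 i x).trans (by linarith [l1 i])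
  have b2 : ∀ i j x, ‖pderiv j (pderiv i χ) x‖ ≤ B := fun i j x =>
    (hB2 i j x).trans (by linarith [l2 i j])
  have pB : 0 ≤ B := by positivity
  refine ⟨4 * B, by positivity, fun R τ hτ hR r0 r1 r2 => ?_⟩
  have hBτ : 0 ≤ B * τ := by positivity
  have hsm : ∀ {α : ℝ} {v : F}, ‖α‖ ≤ B → ‖v‖ ≤ τ → ‖α • v‖ ≤ B * τ := fun ha hv => by
    rw [norm_smul]; exact mul_le_mul ha hv (norm_nonneg _) pB
  have hR' := contDiff_pderiv hR
  have e1 : ∀ i, pderiv i (χ • R) = pderiv i χ • R + χ • pderiv i R := pderiv_smul hχ hR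
  have e2 : ∀ i j, pderiv j (pderiv i (χ • R)) = (pderiv j (pderiv i χ) • R
      + pderiv i χ • pderiv j R) + (pderiv j χ • pderiv i R + χ • pderiv j (pderiv i R)) := by
    intro i j
    rw [e1, pderiv_add ((hχ' i).smul hR) (hχ.smul (hR' i)), pderiv_smul (hχ' i) hR,
      pderiv_smul hχ (hR' i)]
  have hts : tsupport (χ • R) ⊆ tsupport χ := tsupport_smul_subset_left χ R
  have z0 : ∀ x ∉ unitSquare, (χ • R) x = 0 := fun x hx =>
    image_eq_zero_of_notMem_tsupport fun h => hx (hχs (hts h))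
  have z1 : ∀ i, ∀ x ∉ unitSquare, pderiv i (χ • R) x = 0 := fun i x hx =>
    pderiv_eq_zero_of_notMem_tsupport (fun h => hx (hχs (hts h))) i
  have z2 : ∀ i j, ∀ x ∉ unitSquare, pderiv j (pderiv i (χ • R)) x = 0 := fun i j x hx =>
    pderiv_eq_zero_of_notMem_tsupport
      (fun h => hx (hχs (hts (tsupport_pderiv_subset i _ h)))) j
  refine ⟨hasWeakHess_of_contDiff (hχ.smul hR), fun x => ?_, fun i x => ?_, fun i j x => ?_,
    z0, z1, z2⟩
  · by_cases hx : x ∈ unitSquare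
    · exact (hsm (b0 x) (r0 x hx)).trans (by linarith)
    · rw [z0 x hx, norm_zero]; linarith
  · by_cases hx : x ∈ unitSquare
    · rw [e1]
      refine (norm_add_le _ _).trans ?_
      simp only [Pi.smul_apply']
      linarith [hsm (b1 i x) (r0 x hx), hsm (b0 x) (r1 i x hx)]
    · rw [z1 i x hx, norm_zero]; linarith
  · by_cases hx : x ∈ unitSquare
    · rw [e2]
      refine (norm_add_le _ _).trans ((add_le_add (norm_add_le _ _) (norm_add_le _ _)).trans ?_)
      simp only [Pi.smul_apply']
      linarith [hsm (b2 i j x) (r0 x hx), hsm (b1 i x) (r1 j x hx), hsm (b1 j x) (r1 i x hx),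
        hsm (b0 x) (r2 i j x hx)]
    · rw [z2 i j x hx, norm_zero]; linarith

/-- The quadratic polynomial with value `c`, gradient `b` and Hessian `A` at the origin. -/
def quadPoly (c : F) (b : Fin 2 → F) (A : Fin 2 → Fin 2 → F) (y : Plane) : F :=
  c + ∑ i, y i • b i + (1 / 2 : ℝ) • ∑ i, ∑ j, (y i * y j) • A i j

theorem contDiff_quadPoly (c : F) (b : Fin 2 → F) (A : Fin 2 → Fin 2 → F) :
    ContDiff ℝ ∞ (quadPoly c b A) := by
  unfold quadPoly
  have hy : ∀ i, ContDiff ℝ ∞ fun y : Plane => y i := fun i => by fun_prop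
  exact (contDiff_const.add (ContDiff.sum fun i _ => (hy i).smul contDiff_const)).add
    (contDiff_const.smul (ContDiff.sum fun i _ => ContDiff.sum fun j _ =>
      ((hy i).mul (hy j)).smul contDiff_const))

theorem pderiv_quadPoly (c : F) (b : Fin 2 → F) {A : Fin 2 → Fin 2 → F}
    (hA : ∀ i j, A i j = A j i) (i : Fin 2) :
    pderiv i (quadPoly c b A) = fun y => b i + ∑ j, y j • A i j := by
  ext1 y
  have h : ∀ i, HasFDerivAt (fun y : Plane => y i) (EuclideanSpace.proj (𝕜 := ℝ) i) y := fun i =>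
    (EuclideanSpace.proj i : Plane →L[ℝ] ℝ).hasFDerivAt
  have key := ((hasFDerivAt_const c y).add (((h 0).smul_const (b 0)).add ((h 1).smul_const (b 1)))).add
    (((((h 0).mul (h 0)).smul_const (A 0 0)).add (((h 0).mul (h 1)).smul_const (A 0 1))).add
      ((((h 1).mul (h 0)).smul_const (A 1 0)).add (((h 1).mul (h 1)).smul_const (A 1 1)))
      |>.const_smul (1 / 2 : ℝ))
  have e : quadPoly c b A = fun y => c + (y 0 • b 0 + y 1 • b 1)
      + (1 / 2 : ℝ) • (((y 0 * y 0) • A 0 0 + (y 0 * y 1) • A 0 1)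
        + ((y 1 * y 0) • A 1 0 + (y 1 * y 1) • A 1 1)) := by
    funext y
    simp [quadPoly, Fin.sum_univ_two]
  unfold pderiv
  rw [e]
  refine (congrArg (fun L : Plane →L[ℝ] F => L (EuclideanSpace.single i 1)) key.fderiv).trans ?_
  have h10 := hA 1 0
  fin_cases i
  · simp [Fin.sum_univ_two, h10]
    module
  · simp [Fin.sum_univ_two, h10]
    module

theorem pderiv_pderiv_quadPoly (c : F) (b : Fin 2 → F) {A : Fin 2 → Fin 2 → F}
    (hA : ∀ i j, A i j = A j i) (i j : Fin 2) :
    pderiv j (pderiv i (quadPoly c b A)) = fun _ => A i j := by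
  rw [pderiv_quadPoly c b hA]
  have : (fun y : Plane => b i + ∑ j, y j • A i j) = quadPoly (b i) (A i) (fun _ _ => 0) := by
    funext y
    simp [quadPoly]
  rw [this, pderiv_quadPoly _ _ (fun _ _ => rfl)]
  simp

end Cutoff

/-! ### Arrays of second derivatives -/

section HessianMatrix

variable {m : ℕ}

/-- The Hessian whose `(i, j)` entry is `v` and whose other entries vanish. -/
def hessIncl (i j : Fin 2) : EuclideanSpace ℝ (Fin m) →L[ℝ] HessSpace m :=
  LinearMap.toContinuousLinearMap
    { toFun := fun v => WithLp.toLp 2 fun q => if q.2 = (i, j) then v q.1 else 0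
      map_add' := fun v w => by
        refine PiLp.ext fun q => ?_
        by_cases h : q.2 = (i, j) <;> simp [h]
      map_smul' := fun c v => by
        refine PiLp.ext fun q => ?_
        by_cases h : q.2 = (i, j) <;> simp [h] }

/-- The element of `ℝ^{m × 2²}` with the vectors `H i j` as entries. -/
def hessOf (H : Fin 2 → Fin 2 → EuclideanSpace ℝ (Fin m)) : HessSpace m :=
  ∑ i, ∑ j, hessIncl i j (H i j)

/-- The vector of the `(i, j)` entries of `ξ`. -/
def hessEntry (ξ : HessSpace m) (i j : Fin 2) : EuclideanSpace ℝ (Fin m) :=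
  WithLp.toLp 2 fun k => ξ (k, i, j)

theorem hessIncl_apply (i j : Fin 2) (v : EuclideanSpace ℝ (Fin m)) (q : Fin m × Fin 2 × Fin 2) :
    hessIncl i j v q = if q.2 = (i, j) then v q.1 else 0 := rfl

theorem hessOf_apply (H : Fin 2 → Fin 2 → EuclideanSpace ℝ (Fin m)) (q : Fin m × Fin 2 × Fin 2) :
    hessOf H q = H q.2.1 q.2.2 q.1 := by
  obtain ⟨k, i, j⟩ := q
  simp only [hessOf, Fin.sum_univ_two, PiLp.add_apply, hessIncl_apply, Prod.mk.injEq]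
  fin_cases i <;> fin_cases j <;> simp

theorem weakHess_eq_hessOf (Ω : Set Plane) (u : Plane → EuclideanSpace ℝ (Fin m)) (x : Plane) :
    weakHess Ω u x = hessOf fun i j => weakDeriv Ω j (weakDeriv Ω i u) x :=
  PiLp.ext fun q => by
    rw [hessOf_apply]
    rfl

theorem hessOf_hessEntry (ξ : HessSpace m) : hessOf (hessEntry ξ) = ξ :=
  PiLp.ext fun q => hessOf_apply _ q

theorem hessOf_add (H H' : Fin 2 → Fin 2 → EuclideanSpace ℝ (Fin m)) :
    hessOf (H + H') = hessOf H + hessOf H' :=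
  PiLp.ext fun q => by simp only [PiLp.add_apply, hessOf_apply, Pi.add_apply]

theorem hessOf_zero : hessOf (0 : Fin 2 → Fin 2 → EuclideanSpace ℝ (Fin m)) = 0 :=
  PiLp.ext fun q => by simp only [PiLp.zero_apply, hessOf_apply, Pi.zero_apply]

theorem norm_hessIncl_le (i j : Fin 2) (v : EuclideanSpace ℝ (Fin m)) :
    ‖hessIncl i j v‖ ≤ ‖v‖ := by
  rw [← sq_le_sq₀ (norm_nonneg _) (norm_nonneg _), EuclideanSpace.real_norm_sq_eq,
    EuclideanSpace.real_norm_sq_eq, Fintype.sum_prod_type]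
  refine Finset.sum_le_sum fun k _ => ?_
  rw [Finset.sum_eq_single_of_mem (i, j) (Finset.mem_univ _) fun b _ hb => by
    rw [hessIncl_apply, if_neg hb]; simp]
  rw [hessIncl_apply, if_pos rfl]

theorem norm_hessOf_le {H : Fin 2 → Fin 2 → EuclideanSpace ℝ (Fin m)} {τ : ℝ}
    (h : ∀ i j, ‖H i j‖ ≤ τ) : ‖hessOf H‖ ≤ 4 * τ := by
  unfold hessOf
  refine (norm_sum_le _ _).trans ?_
  have : ∀ i : Fin 2, ‖∑ j, hessIncl i j (H i j)‖ ≤ 2 * τ := fun i => by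
    refine (norm_sum_le _ _).trans ?_
    rw [Fin.sum_univ_two]
    linarith [(norm_hessIncl_le i 0 (H i 0)).trans (h i 0),
      (norm_hessIncl_le i 1 (H i 1)).trans (h i 1)]
  rw [Fin.sum_univ_two]
  linarith [this 0, this 1]

theorem norm_hessEntry_le (ξ : HessSpace m) (i j : Fin 2) : ‖hessEntry ξ i j‖ ≤ ‖ξ‖ := by
  rw [← sq_le_sq₀ (norm_nonneg _) (norm_nonneg _), EuclideanSpace.real_norm_sq_eq,
    EuclideanSpace.real_norm_sq_eq, Fintype.sum_prod_type]
  refine Finset.sum_le_sum fun k _ => ?_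
  exact Finset.single_le_sum (f := fun y => ξ (k, y) ^ 2) (fun y _ => sq_nonneg _)
    (Finset.mem_univ (i, j))

theorem aestronglyMeasurable_hessOf {μ : Measure Plane}
    {H : Fin 2 → Fin 2 → Plane → EuclideanSpace ℝ (Fin m)}
    (h : ∀ i j, AEStronglyMeasurable (H i j) μ) :
    AEStronglyMeasurable (fun x => hessOf fun i j => H i j x) μ := by
  unfold hessOf
  exact Finset.aestronglyMeasurable_fun_sum _ fun i _ =>
    Finset.aestronglyMeasurable_fun_sum _ fun j _ =>
      (hessIncl i j).continuous.comp_aestronglyMeasurable (h i j)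

theorem memLp_hessOf {μ : Measure Plane} {p : ℝ≥0∞}
    {H : Fin 2 → Fin 2 → Plane → EuclideanSpace ℝ (Fin m)}
    (h : ∀ i j, MemLp (H i j) p μ) : MemLp (fun x => hessOf fun i j => H i j x) p μ := by
  unfold hessOf
  exact memLp_finsetSum _ fun i _ => memLp_finsetSum _ fun j _ =>
    (hessIncl i j).comp_memLp' (h i j)

theorem eLpNorm_hessOf_le {μ : Measure Plane} {p : ℝ≥0∞} (hp : 1 ≤ p)
    {H : Fin 2 → Fin 2 → Plane → EuclideanSpace ℝ (Fin m)}
    (h : ∀ i j, AEStronglyMeasurable (H i j) μ) :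
    eLpNorm (fun x => hessOf fun i j => H i j x) p μ ≤ ∑ i, ∑ j, eLpNorm (H i j) p μ := by
  have hm := fun i j => (hessIncl i j).continuous.comp_aestronglyMeasurable (h i j)
  have e : (fun x => hessOf fun i j => H i j x) = ∑ i, ∑ j, fun x => hessIncl i j (H i j x) := by
    funext x
    simp [hessOf, Finset.sum_apply]
  rw [e]
  refine (eLpNorm_sum_le (fun i _ => Finset.aestronglyMeasurable_sum _ fun j _ => hm i j)
    hp).trans ?_
  refine Finset.sum_le_sum fun i _ => ?_
  refine (eLpNorm_sum_le (fun j _ => hm i j) hp).trans ?_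
  refine Finset.sum_le_sum fun j _ => ?_
  exact eLpNorm_mono fun x => norm_hessIncl_le i j _

end HessianMatrix

/-! ### Upper semicontinuity of the quasiconvexification -/

section Quasiconvexification

variable {m : ℕ} {f : HessSpace m → ℝ}

theorem integrable_comp_of_bounded (hf : Measurable f) (hb : ∀ R, ∃ B, ∀ A, ‖A‖ ≤ R → ‖f A‖ ≤ B)
    {μ : Measure Plane} [IsFiniteMeasure μ] {G : Plane → HessSpace m} {R : ℝ}
    (hG : AEStronglyMeasurable G μ) (hR : ∀ x, ‖G x‖ ≤ R) : Integrable (fun x => f (G x)) μ := by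
  obtain ⟨B, hB⟩ := hb R
  exact Integrable.of_bound (hf.comp_aemeasurable hG.aemeasurable).aestronglyMeasurable B
    (Eventually.of_forall fun x => hB _ (hR x))

theorem isFiniteMeasure_restrict_unitSquare : IsFiniteMeasure (volume.restrict unitSquare) :=
  ⟨by simp [volume_unitSquare]⟩

theorem weakHess_ae_eq {Ω : Set Plane} (hΩ : IsOpen Ω) {u : Plane → EuclideanSpace ℝ (Fin m)}
    {D : Fin 2 → Plane → EuclideanSpace ℝ (Fin m)}
    {H : Fin 2 → Fin 2 → Plane → EuclideanSpace ℝ (Fin m)}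
    (hD : ∀ i, HasWeakDeriv Ω i u (D i)) (hH : ∀ i j, HasWeakDeriv Ω j (D i) (H i j)) :
    weakHess Ω u =ᵐ[volume.restrict Ω] fun x => hessOf fun i j => H i j x := by
  have h : ∀ i j, weakDeriv Ω j (weakDeriv Ω i u) =ᵐ[volume.restrict Ω] H i j := fun i j => by
    rw [weakDeriv_congr (weakDeriv_ae_eq hΩ (hD i))]
    exact weakDeriv_ae_eq hΩ (hH i j)
  have h' := eventually_all.2 fun i => eventually_all.2 fun j => h i j
  filter_upwards [h'] with x hx
  rw [weakHess_eq_hessOf]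
  congr 1
  funext i j
  exact hx i j

theorem Q2_nonneg (hf0 : ∀ A, 0 ≤ f A) (ξ : HessSpace m) : 0 ≤ Q2 f ξ :=
  Real.iInf_nonneg fun _ => integral_nonneg fun _ => hf0 _

/-- Bounded Hessian fields of functions with compact support in the unit square compete in the
definition of `Q₂f`. -/
theorem Q2_le_of_isCompact (hf0 : ∀ A, 0 ≤ f A) (ξ : HessSpace m) {K : Set Plane}
    (hK : IsCompact K) (hKQ : K ⊆ unitSquare) {M τ : ℝ} {u : Plane → EuclideanSpace ℝ (Fin m)}
    {D : Fin 2 → Plane → EuclideanSpace ℝ (Fin m)}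
    {H : Fin 2 → Fin 2 → Plane → EuclideanSpace ℝ (Fin m)} (h : HasWeakHess u D H)
    (hu : ∀ x, ‖u x‖ ≤ M) (hD : ∀ i x, ‖D i x‖ ≤ M) (hH : ∀ i j x, ‖H i j x‖ ≤ τ)
    (hu0 : ∀ x ∉ K, u x = 0) (hD0 : ∀ i, ∀ x ∉ K, D i x = 0)
    (hH0 : ∀ i j, ∀ x ∉ K, H i j x = 0) :
    Q2 f ξ ≤ ∫ x in unitSquare, f (ξ + hessOf fun i j => H i j x) := by
  have top : ∀ {w : Plane → EuclideanSpace ℝ (Fin m)} {B : ℝ}, LocallyIntegrableOn w univ →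
      (∀ x, ‖w x‖ ≤ B) → MemLp w ⊤ := fun hw hB =>
    memLp_top_of_bound (locallyIntegrableOn_univ.1 hw).aestronglyMeasurable _
      (Eventually.of_forall hB)
  have hmem : MemW2Zero unitSquare ⊤ u :=
    memW2Zero_of_isCompact isOpen_unitSquare le_top hK hKQ h (top (h.1 0).1 hu)
      (fun i => top (h.1 i).2 (hD i)) (fun i j => top (h.2 i j).2 (hH i j)) hu0 hD0 hH0
  refine (ciInf_le ⟨0, ?_⟩ (⟨u, hmem⟩ :
    {φ : Plane → EuclideanSpace ℝ (Fin m) // MemW2Zero unitSquare ⊤ φ})).trans_eq ?_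
  · rintro _ ⟨φ, rfl⟩
    exact integral_nonneg fun _ => hf0 _
  · refine integral_congr_ae ?_
    filter_upwards [weakHess_ae_eq isOpen_unitSquare (fun i => (h.1 i).mono (subset_univ _))
      (fun i j => (h.2 i j).mono (subset_univ _))] with x hx
    rw [hx]

theorem Q2_le_self (hf0 : ∀ A, 0 ≤ f A) (ξ : HessSpace m) : Q2 f ξ ≤ f ξ := by
  have h := Q2_le_of_isCompact hf0 ξ (K := ∅) isCompact_empty (empty_subset _) (M := 0) (τ := 0)
    (u := 0) (D := 0) (H := 0) ⟨fun _ => hasWeakDeriv_zero, fun _ _ => hasWeakDeriv_zero⟩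
    (by simp) (by simp) (by simp) (by simp) (by simp) (by simp)
  have e : (fun _ : Plane => f (ξ + hessOf fun i j =>
      (0 : Fin 2 → Fin 2 → Plane → EuclideanSpace ℝ (Fin m)) i j 0)) = fun _ => f ξ := by
    funext x
    have : (fun i j => (0 : Fin 2 → Fin 2 → Plane → EuclideanSpace ℝ (Fin m)) i j 0) = 0 := rfl
    rw [this, hessOf_zero, add_zero]
  refine h.trans_eq ?_
  calc _ = ∫ x in unitSquare, f ξ := congrArg (fun g => ∫ x in unitSquare, g x) e
    _ = f ξ := by simp [measureReal_def, volume_unitSquare]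

/-- Near-minimisers for `Q₂f`, extended by zero to the plane. -/
theorem exists_isCellBump_of_Q2_lt {ξ : HessSpace m} {t : ℝ} (h : Q2 f ξ < t) :
    ∃ (u : Plane → EuclideanSpace ℝ (Fin m)) (D : Fin 2 → Plane → EuclideanSpace ℝ (Fin m))
      (H : Fin 2 → Fin 2 → Plane → EuclideanSpace ℝ (Fin m)) (M : ℝ), IsCellBump M M u D H ∧
        ∫ x in unitSquare, f (ξ + hessOf fun i j => H i j x) < t := by
  have : Nonempty {φ : Plane → EuclideanSpace ℝ (Fin m) // MemW2Zero unitSquare ⊤ φ} :=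
    ⟨0, memW2Zero_of_isCompact (D := 0) (H := 0) isOpen_unitSquare le_top isCompact_empty
      (empty_subset _) ⟨fun _ => hasWeakDeriv_zero, fun _ _ => hasWeakDeriv_zero⟩ MemLp.zero
      (fun _ => MemLp.zero) (fun _ _ => MemLp.zero) (by simp) (by simp) (by simp)⟩
  obtain ⟨⟨φ, hφ⟩, hlt⟩ := exists_lt_of_ciInf_lt h
  obtain ⟨u, D, H, M, hb, hH⟩ := hφ.exists_isCellBump
  refine ⟨u, D, H, M, hb, lt_of_eq_of_lt (integral_congr_ae ?_) hlt⟩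
  have h' := eventually_all.2 fun i => eventually_all.2 fun j => hH i j
  filter_upwards [h'] with x hx
  simp only [weakHess_eq_hessOf, hx]

/-- The Hessian `ξ` is symmetric in its last two indices. -/
def IsSymmHess (ξ : HessSpace m) : Prop := ∀ i j, hessEntry ξ i j = hessEntry ξ j i

/-- `Q₂f` is upper semicontinuous at symmetric `ξ`. A competitor for `ξ`, shrunk to a slightly
smaller square and corrected by a cut-off quadratic polynomial with Hessian `ξ - ζ`, is a
competitor for `ζ` of almost the same energy. -/
theorem eventually_Q2_lt (hfm : Measurable f) (hf0 : ∀ A, 0 ≤ f A)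
    (hb : ∀ R, ∃ B, ∀ A, ‖A‖ ≤ R → ‖f A‖ ≤ B) {ξ : HessSpace m} (hξ : IsSymmHess ξ) {t : ℝ}
    (ht : Q2 f ξ < t) :
    ∃ ρ > 0, ∀ ζ : HessSpace m, IsSymmHess ζ → ‖ξ - ζ‖ < ρ → Q2 f ζ < t := by
  have := isFiniteMeasure_restrict_unitSquare
  obtain ⟨u, D, H, M, hbump, hlt⟩ := exists_isCellBump_of_Q2_lt ht
  set J := ∫ x in unitSquare, f (ξ + hessOf fun i j => H i j x) with hJ
  have hJ0 : 0 ≤ J := integral_nonneg fun _ => hf0 _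
  obtain ⟨B, hB⟩ := hb (‖ξ‖ + 2)
  have hB0 : 0 ≤ B := (norm_nonneg _).trans (hB 0 (by rw [norm_zero]; positivity))
  -- On the layer between the squares of sides `θ` and `1`, of area `1 - θ ^ 2`, only the bound `B`
  -- is available for the energy.
  obtain ⟨θ, hθ0, hθ1, hθB⟩ : ∃ θ : ℝ, 0 < θ ∧ θ < 1 ∧ (1 - θ ^ 2) * B < t - J := by
    have hc : Tendsto (fun θ : ℝ => (1 - θ ^ 2) * B) (𝓝[<] 1) (𝓝 0) := by
      have : Continuous fun θ : ℝ => (1 - θ ^ 2) * B := by fun_prop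
      have h1 := this.tendsto 1
      simp only [one_pow, sub_self, zero_mul] at h1
      exact h1.mono_left nhdsWithin_le_nhds
    have h1 := hc.eventually (gt_mem_nhds (sub_pos.2 hlt))
    have h2 : ∀ᶠ θ : ℝ in 𝓝[<] 1, θ ∈ Ioo (0 : ℝ) 1 := Ioo_mem_nhdsLT one_pos
    obtain ⟨θ, h3, h4⟩ := (h1.and h2).exists
    exact ⟨θ, h4.1, h4.2, h3⟩
  have hcl := closure_cell_zero_subset hθ0 hθ1
  have hclc : IsCompact (closure (cell 0 θ)) :=
    (isCompact_closedBall (0 : Plane) 1).of_isClosed_subset isClosed_closure fun x hx => by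
      simpa using (norm_lt_one_of_mem_unitSquare (hcl hx)).le
  obtain ⟨χ, hχ, hχc, hχs, V, hV, hKV, hV1⟩ := exists_cutoff hclc isOpen_unitSquare hcl
  obtain ⟨C, hC0, hC⟩ := exists_isCellBump_cutoff (F := EuclideanSpace ℝ (Fin m)) hχ hχc hχs
  refine ⟨min 1 (1 / (16 * C + 1)), by positivity, fun ζ hζ hζξ => ?_⟩
  have hζ1 : ‖ξ - ζ‖ < 1 := hζξ.trans_le (min_le_left _ _)
  have hζ2 : 16 * C * ‖ξ - ζ‖ ≤ 1 := by
    have h1 := (hζξ.trans_le (min_le_right _ _)).le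
    rw [le_div_iff₀ (by positivity)] at h1
    nlinarith [norm_nonneg (ξ - ζ)]
  have hAs : ∀ i j, hessEntry (ξ - ζ) i j = hessEntry (ξ - ζ) j i := by
    intro i j
    refine PiLp.ext fun k => ?_
    have e1 := congrArg (fun v : EuclideanSpace ℝ (Fin m) => v k) (hξ i j)
    have e2 := congrArg (fun v : EuclideanSpace ℝ (Fin m) => v k) (hζ i j)
    simp only [hessEntry] at e1 e2
    simp [hessEntry, e1, e2]
  -- The transition layer carries a cut-off of the quadratic polynomial with Hessian `ξ - ζ`.
  set P : Plane → EuclideanSpace ℝ (Fin m) := quadPoly 0 0 (hessEntry (ξ - ζ)) with hP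
  have hPd := contDiff_quadPoly (0 : EuclideanSpace ℝ (Fin m)) 0 (hessEntry (ξ - ζ))
  have hP2 := pderiv_pderiv_quadPoly (0 : EuclideanSpace ℝ (Fin m)) 0 hAs
  have hxi : ∀ x ∈ unitSquare, ∀ i, ‖x i‖ ≤ 1 := fun x hx i =>
    (PiLp.norm_apply_le x i).trans (norm_lt_one_of_mem_unitSquare hx).le
  have hA := norm_hessEntry_le (ξ - ζ)
  have hPb := hC P (4 * ‖ξ - ζ‖) (by positivity) hPd
    (fun x hx => by
      have h1 : ∀ i j, ‖(x i * x j) • hessEntry (ξ - ζ) i j‖ ≤ ‖ξ - ζ‖ := fun i j => by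
        rw [norm_smul, norm_mul]
        calc _ ≤ (1 * 1) * ‖ξ - ζ‖ := by
              gcongr
              · exact hxi x hx i
              · exact hxi x hx j
              · exact hA i j
          _ = _ := by ring
      have h2 : ‖∑ i, ∑ j, (x i * x j) • hessEntry (ξ - ζ) i j‖ ≤ 4 * ‖ξ - ζ‖ := by
        simp only [Fin.sum_univ_two]
        refine (norm_add_le _ _).trans ((add_le_add (norm_add_le _ _) (norm_add_le _ _)).trans ?_)
        linarith [h1 0 0, h1 0 1, h1 1 0, h1 1 1]
      simp only [hP, quadPoly, Pi.zero_apply, smul_zero, Finset.sum_const_zero, zero_add]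
      rw [norm_smul, Real.norm_of_nonneg (by norm_num)]
      linarith [norm_nonneg (ξ - ζ)])
    (fun i x hx => by
      have h1 : ∀ j, ‖x j • hessEntry (ξ - ζ) i j‖ ≤ ‖ξ - ζ‖ := fun j => by
        rw [norm_smul]
        calc _ ≤ 1 * ‖ξ - ζ‖ := by
              gcongr
              · exact hxi x hx j
              · exact hA i j
          _ = _ := by ring
      rw [hP, pderiv_quadPoly _ _ hAs]
      simp only [Pi.zero_apply, zero_add, Fin.sum_univ_two]
      refine (norm_add_le _ _).trans ?_
      linarith [h1 0, h1 1, norm_nonneg (ξ - ζ)])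
    (fun i j x hx => by
      rw [hP, hP2]
      linarith [hA i j, norm_nonneg (ξ - ζ)])
  have hcellA : ∀ a ∈ ({0} : Finset Plane), ∀ b ∈ ({0} : Finset Plane), a ≠ b →
      Disjoint (cell a θ) (cell b θ) := by
    intro a ha b hb hab
    rw [Finset.mem_singleton] at ha hb
    exact absurd (ha.trans hb.symm) hab
  have hM0 : 0 ≤ M := (norm_nonneg _).trans (hbump.le 0)
  have hw := hPb.hess.add (hasWeakHess_paste (A := {0}) hθ0 (w := fun _ => u) (D := fun _ => D)
    (H := fun _ => H) fun _ _ => hbump.hess)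
  have hts : tsupport (χ • P) ⊆ tsupport χ := tsupport_smul_subset_left χ P
  have hcellV : cell 0 θ ⊆ V := subset_closure.trans hKV
  have hVχ : V ⊆ tsupport χ := fun x hx => subset_tsupport χ (by simp [hV1 x hx])
  have hnot : ∀ x ∉ tsupport χ, x ∉ ⋃ a ∈ ({0} : Finset Plane), cell a θ := by
    intro x hx h
    simp only [Finset.mem_singleton, iUnion_iUnion_eq_left] at h
    exact hx (hVχ (hcellV h))
  have hQ := Q2_le_of_isCompact hf0 ζ hχc hχs (M := C * (4 * ‖ξ - ζ‖) + M)
    (τ := C * (4 * ‖ξ - ζ‖) + M) hw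
    (fun x => (norm_add_le _ _).trans (add_le_add (hPb.le x)
      ((norm_paste_le hcellA (fun _ _ => hbump.eq_zero) hM0 (by positivity)
        (fun _ _ => hbump.le) x).trans (mul_le_of_le_one_left hM0 (by nlinarith)))))
    (fun i x => (norm_add_le _ _).trans (add_le_add (hPb.grad_le i x)
      ((norm_paste_le hcellA (fun _ _ => hbump.grad_eq_zero i) hM0 (by positivity)
        (fun _ _ => hbump.grad_le i) x).trans (mul_le_of_le_one_left hM0 hθ1.le))))
    (fun i j x => (norm_add_le _ _).trans (add_le_add (hPb.hess_le i j x)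
      ((norm_paste_le hcellA (fun _ _ => hbump.hess_eq_zero i j) hM0 (by positivity)
        (fun _ _ => hbump.hess_le i j) x).trans (mul_le_of_le_one_left hM0 le_rfl))))
    (fun x hx => by
      rw [Pi.add_apply, paste_of_notMem (fun _ _ => hbump.eq_zero) (hnot x hx), add_zero]
      exact image_eq_zero_of_notMem_tsupport fun h => hx (hts h))
    (fun i x hx => by
      rw [Pi.add_apply, Pi.add_apply, paste_of_notMem (fun _ _ => hbump.grad_eq_zero i) (hnot x hx),
        add_zero]
      exact pderiv_eq_zero_of_notMem_tsupport (fun h => hx (hts h)) i)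
    (fun i j x hx => by
      simp only [Pi.add_apply]
      rw [paste_of_notMem (fun _ _ => hbump.hess_eq_zero i j) (hnot x hx), add_zero]
      exact pderiv_eq_zero_of_notMem_tsupport
        (fun h => hx (hts (tsupport_pderiv_subset i _ h))) j)
  refine hQ.trans_lt ?_
  set G : Plane → HessSpace m := fun x => ζ + hessOf fun i j =>
    ((fun i j => pderiv j (pderiv i (χ • P))) + fun i j => paste {0} θ 1 fun _ => H i j) i j x
    with hG
  have hGm : AEStronglyMeasurable G volume :=
    aestronglyMeasurable_const.add (aestronglyMeasurable_hessOf fun i j =>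
      (locallyIntegrableOn_univ.1 (hw.2 i j).2).aestronglyMeasurable)
  have hG1 : ∀ x ∈ cell 0 θ, G x = ξ + hessOf fun i j => H i j (θ⁻¹ • (x - 0)) := by
    intro x hx
    have e1 : ∀ i j, pderiv j (pderiv i (χ • P)) x = hessEntry (ξ - ζ) i j := by
      intro i j
      have e : EqOn (χ • P) P V := fun y hy => by simp [hV1 y hy]
      rw [pderiv_eqOn hV (pderiv_eqOn hV e i) j (hcellV hx), hP, hP2]
    have e2 : ∀ i j, paste {0} θ 1 (fun _ => H i j) x = H i j (θ⁻¹ • (x - 0)) := by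
      intro i j
      rw [paste_of_mem hcellA (fun _ _ => hbump.hess_eq_zero i j) (Finset.mem_singleton_self _) hx,
        one_smul]
    have e3 : (fun i j => ((fun i j => pderiv j (pderiv i (χ • P))) + fun i j =>
        paste {0} θ 1 fun _ => H i j) i j x)
        = hessEntry (ξ - ζ) + fun i j => H i j (θ⁻¹ • (x - 0)) := by
      funext i j
      simp only [Pi.add_apply, e1, e2]
    rw [hG]
    simp only
    rw [e3, hessOf_add, hessOf_hessEntry]
    abel
  have hG2 : ∀ x ∉ cell 0 θ, ‖G x‖ ≤ ‖ξ‖ + 2 := by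
    intro x hx
    have e3 : (fun i j => ((fun i j => pderiv j (pderiv i (χ • P))) + fun i j =>
        paste {0} θ 1 fun _ => H i j) i j x) = fun i j => pderiv j (pderiv i (χ • P)) x := by
      funext i j
      simp only [Pi.add_apply]
      rw [paste_of_notMem (fun _ _ => hbump.hess_eq_zero i j) (by simpa using hx), add_zero]
    rw [hG]
    simp only
    rw [e3]
    have h1 := norm_hessOf_le fun i j => hPb.hess_le i j x
    have h2 : ‖ζ‖ ≤ ‖ξ‖ + ‖ξ - ζ‖ := by
      rw [← sub_sub_cancel ξ ζ]
      simpa using norm_sub_le ξ (ξ - ζ)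
    refine (norm_add_le _ _).trans ?_
    linarith
  have hGb : ∀ x, ‖G x‖ ≤ ‖ξ‖ + 2 + 4 * M := by
    intro x
    by_cases hx : x ∈ cell 0 θ
    · rw [hG1 x hx]
      refine (norm_add_le _ _).trans ?_
      linarith [norm_hessOf_le fun i j => hbump.hess_le i j (θ⁻¹ • (x - 0))]
    · linarith [hG2 x hx]
  have hcQ : cell 0 θ ⊆ unitSquare := subset_closure.trans hcl
  have hint : IntegrableOn (fun x => f (G x)) unitSquare :=
    integrable_comp_of_bounded hfm hb hGm.restrict hGb
  have hsplit := integral_add_compl₀ (μ := volume.restrict unitSquare) (f := fun x => f (G x))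
    (measurableSet_cell 0 θ).nullMeasurableSet hint
  rw [Measure.restrict_restrict (measurableSet_cell 0 θ),
    Measure.restrict_restrict (measurableSet_cell 0 θ).compl, inter_eq_left.2 hcQ] at hsplit
  have i1 : ∫ x in cell 0 θ, f (G x) = θ ^ 2 * J := by
    rw [setIntegral_congr_fun (measurableSet_cell 0 θ) fun x hx => congrArg f (hG1 x hx)]
    exact setIntegral_cell 0 hθ0 fun y => f (ξ + hessOf fun i j => H i j y)
  have v1 : volume ((cell 0 θ)ᶜ ∩ unitSquare) = ENNReal.ofReal (1 - θ ^ 2) := by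
    rw [inter_comm, ← sdiff_eq, measure_sdiff hcQ (measurableSet_cell 0 θ).nullMeasurableSet
      (by rw [volume_cell _ hθ0]; exact ENNReal.ofReal_ne_top), volume_cell _ hθ0,
      volume_unitSquare, ← ENNReal.ofReal_one, ← ENNReal.ofReal_sub _ (by positivity)]
  have i2 : ∫ x in (cell 0 θ)ᶜ ∩ unitSquare, f (G x) ≤ (1 - θ ^ 2) * B := by
    have h1 := norm_setIntegral_le_of_norm_le_const (μ := volume) (C := B)
      (s := (cell 0 θ)ᶜ ∩ unitSquare) (f := fun x => f (G x))
      (by rw [v1]; exact ENNReal.ofReal_lt_top) (fun x hx => hB _ (hG2 x hx.1))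
    rw [measureReal_def, v1, ENNReal.toReal_ofReal (by nlinarith)] at h1
    linarith [Real.le_norm_self (∫ x in (cell 0 θ)ᶜ ∩ unitSquare, f (G x))]
  rw [← hsplit, i1]
  have : θ ^ 2 * J ≤ J := mul_le_of_le_one_left hJ0 (by nlinarith)
  linarith

/-- The symmetric part of `ξ`. -/
def symHess (ξ : HessSpace m) : HessSpace m :=
  hessOf fun i j => (1 / 2 : ℝ) • (hessEntry ξ i j + hessEntry ξ j i)

theorem hessEntry_hessOf (H : Fin 2 → Fin 2 → EuclideanSpace ℝ (Fin m)) (i j : Fin 2) :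
    hessEntry (hessOf H) i j = H i j :=
  PiLp.ext fun k => by simp [hessEntry, hessOf_apply]

theorem isSymmHess_symHess (ξ : HessSpace m) : IsSymmHess (symHess ξ) := fun i j => by
  rw [symHess, hessEntry_hessOf, hessEntry_hessOf, add_comm]

theorem symHess_eq_self {ξ : HessSpace m} (h : IsSymmHess ξ) : symHess ξ = ξ := by
  unfold symHess
  conv_rhs => rw [← hessOf_hessEntry ξ]
  congr 1
  funext i j
  rw [h j i, ← two_smul ℝ, smul_smul]
  norm_num

theorem norm_symHess_le (ξ : HessSpace m) : ‖symHess ξ‖ ≤ 4 * ‖ξ‖ := by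
  refine norm_hessOf_le fun i j => ?_
  rw [norm_smul]
  norm_num
  linarith [(norm_add_le (hessEntry ξ i j) (hessEntry ξ j i)), norm_hessEntry_le ξ i j,
    norm_hessEntry_le ξ j i]

theorem continuous_symHess : Continuous (symHess : HessSpace m → HessSpace m) := by
  have h : ∀ i j, Continuous fun ξ : HessSpace m => hessEntry ξ i j := fun i j => by
    unfold hessEntry
    exact (PiLp.continuous_toLp 2 _).comp (continuous_pi fun k => by fun_prop)
  unfold symHess hessOf
  exact continuous_finsetSum _ fun i _ => continuous_finsetSum _ fun j _ =>
    (hessIncl i j).continuous.comp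
      (by have := h i j; have := h j i; fun_prop :
        Continuous fun ξ => (1 / 2 : ℝ) • (hessEntry ξ i j + hessEntry ξ j i))

/-- Composed with the symmetric part, `Q₂f` is upper semicontinuous on the whole space. -/
theorem upperSemicontinuous_Q2_symHess (hfm : Measurable f) (hf0 : ∀ A, 0 ≤ f A)
    (hb : ∀ R, ∃ B, ∀ A, ‖A‖ ≤ R → ‖f A‖ ≤ B) :
    UpperSemicontinuous fun ξ : HessSpace m => Q2 f (symHess ξ) := by
  intro ξ t ht
  obtain ⟨ρ, hρ, h⟩ := eventually_Q2_lt hfm hf0 hb (isSymmHess_symHess ξ) ht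
  have := (continuous_symHess (m := m)).tendsto ξ
  filter_upwards [this (Metric.ball_mem_nhds _ hρ)] with ζ hζ
  refine h _ (isSymmHess_symHess ζ) ?_
  rw [← dist_eq_norm, dist_comm]
  exact hζ

end Quasiconvexification

/-! ### Integrands of `p`-growth -/

section Semicontinuity

variable {X E : Type*} [MeasurableSpace X] {μ : Measure X} [NormedAddCommGroup E]

theorem rpow_norm_le_two_rpow_mul {p : ℝ} (hp : 1 ≤ p) (a b : E) :
    ‖a‖ ^ p ≤ 2 ^ p * (‖b‖ ^ p + ‖a - b‖ ^ p) := by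
  have h0 : 0 ≤ p := zero_le_one.trans hp
  have h1 : ‖a‖ ≤ 2 * max ‖b‖ ‖a - b‖ := by
    have := norm_add_le b (a - b)
    rw [add_sub_cancel] at this
    linarith [le_max_left ‖b‖ ‖a - b‖, le_max_right ‖b‖ ‖a - b‖]
  calc ‖a‖ ^ p ≤ (2 * max ‖b‖ ‖a - b‖) ^ p := Real.rpow_le_rpow (norm_nonneg _) h1 h0
    _ = 2 ^ p * (max ‖b‖ ‖a - b‖) ^ p :=
        Real.mul_rpow (by norm_num) (le_max_of_le_left (norm_nonneg _))
    _ ≤ _ := by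
        gcongr
        rcases max_cases ‖b‖ ‖a - b‖ with h | h <;> rw [h.1]
        · exact le_add_of_nonneg_right (by positivity)
        · exact le_add_of_nonneg_left (by positivity)

theorem lintegral_ofReal_rpow_norm {p : ℝ} (hp : 1 ≤ p) (w : X → E) :
    ∫⁻ x, ENNReal.ofReal (‖w x‖ ^ p) ∂μ = eLpNorm w (ENNReal.ofReal p) μ ^ p := by
  have h0 : 0 < p := zero_lt_one.trans_le hp
  rw [eLpNorm_eq_lintegral_rpow_enorm_toReal (by simpa using h0) ENNReal.ofReal_ne_top,
    ENNReal.toReal_ofReal h0.le, ← ENNReal.rpow_mul, one_div_mul_cancel h0.ne', ENNReal.rpow_one]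
  refine lintegral_congr fun x => ?_
  rw [← ofReal_norm, ENNReal.ofReal_rpow_of_nonneg (norm_nonneg _) h0.le]

theorem integrable_mul_one_add_rpow [IsFiniteMeasure μ] {p : ℝ} (hp : 1 ≤ p) (c : ℝ) {w : X → E}
    (hw : MemLp w (ENNReal.ofReal p) μ) : Integrable (fun x => c * (1 + ‖w x‖ ^ p)) μ := by
  have h0 : 0 < p := zero_lt_one.trans_le hp
  have := hw.integrable_norm_rpow (by simpa using h0) ENNReal.ofReal_ne_top
  rw [ENNReal.toReal_ofReal h0.le] at this
  exact ((integrable_const 1).add this).const_mul c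

/-- Functions of `p`-growth have uniformly small integrals over small sets, for arguments near a
fixed `H ∈ L^p`. -/
theorem exists_forall_setIntegral_growth_le [IsFiniteMeasure μ] {p : ℝ} (hp : 1 ≤ p) {c : ℝ}
    (hc : 0 ≤ c) {H : X → E} (hH : MemLp H (ENNReal.ofReal p) μ) {ε : ℝ} (hε : 0 < ε) :
    ∃ η : ℝ, 0 < η ∧ ∀ H' : X → E, MemLp H' (ENNReal.ofReal p) μ →
      eLpNorm (H' - H) (ENNReal.ofReal p) μ < ENNReal.ofReal η →
      ∀ S, MeasurableSet S → μ S < ENNReal.ofReal η →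
        ∫ x in S, c * (1 + ‖H' x‖ ^ p) ∂μ ≤ ε := by
  have h0 : 0 < p := zero_lt_one.trans_le hp
  set c' := c * 2 ^ p with hc'
  have hc'0 : 0 ≤ c' := by positivity
  have hi := integrable_mul_one_add_rpow hp c' hH
  obtain ⟨δ, hδ, hδS⟩ := exists_pos_setLIntegral_lt_of_measure_lt (μ := μ)
    (f := fun x => ENNReal.ofReal (c' * (1 + ‖H x‖ ^ p))) hi.lintegral_lt_top.ne
    (ε := ENNReal.ofReal (ε / 2)) (by simpa using hε)
  obtain ⟨δ', hδ', hδ'δ⟩ : ∃ δ' : ℝ, 0 < δ' ∧ ENNReal.ofReal δ' ≤ δ := by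
    by_cases h : δ = ⊤
    · exact ⟨1, one_pos, h ▸ le_top⟩
    · exact ⟨δ.toReal, ENNReal.toReal_pos hδ.ne' h, ENNReal.ofReal_toReal_le⟩
  obtain ⟨κ, hκ, hκε⟩ : ∃ κ : ℝ, 0 < κ ∧ c' * κ ^ p ≤ ε / 2 := by
    have hcont : ContinuousAt (fun κ : ℝ => c' * κ ^ p) 0 :=
      continuousAt_const.mul (Real.continuousAt_rpow_const 0 p (Or.inr h0.le))
    have h1 : Tendsto (fun κ : ℝ => c' * κ ^ p) (𝓝[>] 0) (𝓝 0) := by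
      have := hcont.tendsto
      simp only [Real.zero_rpow h0.ne', mul_zero] at this
      exact this.mono_left nhdsWithin_le_nhds
    obtain ⟨κ, h2, h3⟩ := ((h1.eventually (gt_mem_nhds (half_pos hε))).and
      self_mem_nhdsWithin).exists
    exact ⟨κ, h3, h2.le⟩
  refine ⟨min δ' κ, lt_min hδ' hκ, fun H' hH' hHH' S hS hμS => ?_⟩
  have hi' := integrable_mul_one_add_rpow hp c hH'
  rw [← ENNReal.ofReal_le_ofReal_iff hε.le, ofReal_integral_eq_lintegral_ofReal hi'.integrableOn
    (Eventually.of_forall fun x => by positivity)]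
  have e1 : ∀ x, ENNReal.ofReal (c * (1 + ‖H' x‖ ^ p))
      ≤ ENNReal.ofReal (c' * (1 + ‖H x‖ ^ p)) + ENNReal.ofReal c' *
        ENNReal.ofReal (‖(H' - H) x‖ ^ p) := by
    intro x
    rw [← ENNReal.ofReal_mul hc'0, ← ENNReal.ofReal_add (by positivity) (by positivity)]
    refine ENNReal.ofReal_le_ofReal ?_
    have h1 := rpow_norm_le_two_rpow_mul hp (H' x) (H x)
    have h2 : (1 : ℝ) ≤ 2 ^ p := Real.one_le_rpow (by norm_num) h0.le
    rw [hc', Pi.sub_apply]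
    calc c * (1 + ‖H' x‖ ^ p) ≤ c * (2 ^ p + 2 ^ p * (‖H x‖ ^ p + ‖H' x - H x‖ ^ p)) := by gcongr
      _ = _ := by ring
  have hm : AEMeasurable (fun x => ENNReal.ofReal (‖(H' - H) x‖ ^ p)) μ :=
    ((hH'.1.sub hH.1).norm.aemeasurable.pow_const p).ennreal_ofReal
  calc _ ≤ ∫⁻ x in S, (ENNReal.ofReal (c' * (1 + ‖H x‖ ^ p)) + ENNReal.ofReal c' *
        ENNReal.ofReal (‖(H' - H) x‖ ^ p)) ∂μ := lintegral_mono e1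
    _ = (∫⁻ x in S, ENNReal.ofReal (c' * (1 + ‖H x‖ ^ p)) ∂μ) + ENNReal.ofReal c' *
        ∫⁻ x in S, ENNReal.ofReal (‖(H' - H) x‖ ^ p) ∂μ := by
        rw [lintegral_add_left' hi.1.aemeasurable.ennreal_ofReal.restrict,
          lintegral_const_mul'' _ hm.restrict]
    _ ≤ ENNReal.ofReal (ε / 2) + ENNReal.ofReal c' * ENNReal.ofReal κ ^ p := by
        gcongr
        · exact (hδS S (hμS.trans_le ((ENNReal.ofReal_le_ofReal (min_le_left _ _)).trans hδ'δ))).le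
        · refine (setLIntegral_le_lintegral S _).trans ?_
          rw [lintegral_ofReal_rpow_norm hp]
          exact ENNReal.rpow_le_rpow (hHH'.le.trans (ENNReal.ofReal_le_ofReal (min_le_right _ _)))
            h0.le
    _ ≤ ENNReal.ofReal ε := by
        rw [ENNReal.ofReal_rpow_of_pos hκ, ← ENNReal.ofReal_mul hc'0,
          ← ENNReal.ofReal_add (by positivity) (by positivity)]
        exact ENNReal.ofReal_le_ofReal (by linarith)

variable [MeasurableSpace E] [BorelSpace E]

theorem integrable_of_growth [IsFiniteMeasure μ] {p : ℝ} (hp : 1 ≤ p) {c : ℝ} {g : E → ℝ}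
    (hg : Measurable g) (hg0 : ∀ A, 0 ≤ g A) (hgc : ∀ A, g A ≤ c * (1 + ‖A‖ ^ p)) {H : X → E}
    (hH : MemLp H (ENNReal.ofReal p) μ) : Integrable (fun x => g (H x)) μ := by
  refine (integrable_mul_one_add_rpow hp c hH).mono'
    (hg.comp_aemeasurable hH.1.aemeasurable).aestronglyMeasurable (Eventually.of_forall fun x => ?_)
  rw [Real.norm_of_nonneg (hg0 _)]
  exact hgc _

/-- The integral of an upper semicontinuous integrand of `p`-growth is upper semicontinuous along
strong convergence in `L^p`, by the reverse Fatou lemma. -/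
theorem eventually_integral_lt_of_upperSemicontinuous [IsFiniteMeasure μ] {p : ℝ} (hp : 1 ≤ p)
    {c : ℝ} (hc : 0 ≤ c) {g : E → ℝ} (hg : UpperSemicontinuous g) (hg0 : ∀ A, 0 ≤ g A)
    (hgc : ∀ A, g A ≤ c * (1 + ‖A‖ ^ p)) {H : X → E} (hH : MemLp H (ENNReal.ofReal p) μ)
    (hHm : Measurable H) {Hn : ℕ → X → E} (hHn : ∀ n, MemLp (Hn n) (ENNReal.ofReal p) μ)
    (hHnm : ∀ n, Measurable (Hn n))
    (hlim : Tendsto (fun n => eLpNorm (Hn n - H) (ENNReal.ofReal p) μ) atTop (𝓝 0))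
    (hae : ∀ᵐ x ∂μ, Tendsto (fun n => Hn n x) atTop (𝓝 (H x))) {ε : ℝ} (hε : 0 < ε) :
    ∀ᶠ n in atTop, ∫ x, g (Hn n x) ∂μ < (∫ x, g (H x) ∂μ) + ε := by
  have h0 : 0 < p := zero_lt_one.trans_le hp
  have hgm : Measurable g := hg.measurable
  have hgi : ∀ {w : X → E}, MemLp w (ENNReal.ofReal p) μ → Integrable (fun x => g (w x)) μ :=
    fun hw => integrable_of_growth hp hgm hg0 hgc hw
  set c' := c * 2 ^ p with hc'
  have hc'0 : 0 ≤ c' := by positivity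
  set B : X → ℝ := fun x => c' * (1 + ‖H x‖ ^ p) with hB
  have hBi : Integrable B μ := integrable_mul_one_add_rpow hp c' hH
  have hBm : Measurable B := ((hHm.norm.pow_const p).const_add 1).const_mul c'
  -- Only the truncations by `B` are dominated; the excess over `B` is at most
  -- `c' * ‖Hn n - H‖ ^ p`, which tends to zero in `L¹`.
  have key := limsup_lintegral_le (μ := μ) (f := fun n x => ENNReal.ofReal (min (g (Hn n x)) (B x)))
    (fun x => ENNReal.ofReal (B x))
    (fun n => ((hgm.comp (hHnm n)).min hBm).ennreal_ofReal)
    (fun n => Eventually.of_forall fun x => ENNReal.ofReal_le_ofReal (min_le_right _ _))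
    hBi.lintegral_lt_top.ne
  have key2 : ∫⁻ x, limsup (fun n => ENNReal.ofReal (min (g (Hn n x)) (B x))) atTop ∂μ
      ≤ ∫⁻ x, ENNReal.ofReal (g (H x)) ∂μ := by
    refine lintegral_mono_ae ?_
    filter_upwards [hae] with x hx
    refine le_of_forall_gt fun t ht => ?_
    obtain ⟨t', ht1, ht2⟩ := exists_between ht
    refine lt_of_le_of_lt (limsup_le_of_le (by isBoundedDefault) ?_) ht2
    have hgt : g (H x) < t'.toReal := by
      rwa [ENNReal.ofReal_lt_iff_lt_toReal (hg0 _) (ht2.trans_le le_top).ne] at ht1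
    filter_upwards [hx.eventually (hg (H x) _ hgt)] with n hn
    exact ENNReal.ofReal_le_of_le_toReal ((min_le_left _ _).trans hn.le)
  have hfin : ∫⁻ x, ENNReal.ofReal (g (H x)) ∂μ ≠ ⊤ := (hgi hH).lintegral_lt_top.ne
  have ev1 : ∀ᶠ n in atTop, ∫⁻ x, ENNReal.ofReal (min (g (Hn n x)) (B x)) ∂μ
      < (∫⁻ x, ENNReal.ofReal (g (H x)) ∂μ) + ENNReal.ofReal (ε / 2) := by
    refine eventually_lt_of_limsup_lt ((key.trans key2).trans_lt ?_) (by isBoundedDefault)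
    exact ENNReal.lt_add_right hfin (by simpa using hε)
  have ev2 : ∀ᶠ n in atTop, ENNReal.ofReal c' *
      eLpNorm (Hn n - H) (ENNReal.ofReal p) μ ^ p < ENNReal.ofReal (ε / 2) := by
    have h1 : Tendsto (fun n => ENNReal.ofReal c' * eLpNorm (Hn n - H) (ENNReal.ofReal p) μ ^ p)
        atTop (𝓝 0) := by
      have := ENNReal.Tendsto.const_mul (a := ENNReal.ofReal c')
        ((ENNReal.continuous_rpow_const (y := p)).tendsto 0 |>.comp hlim)
        (Or.inr ENNReal.ofReal_ne_top)
      simpa [ENNReal.zero_rpow_of_pos h0] using this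
    exact h1.eventually (gt_mem_nhds (by simpa using hε))
  filter_upwards [ev1, ev2] with n h1 h2
  have hI0 : 0 ≤ ∫ x, g (H x) ∂μ := integral_nonneg fun x => hg0 _
  rw [← ENNReal.ofReal_lt_ofReal_iff (by linarith), ENNReal.ofReal_add hI0 hε.le,
    ofReal_integral_eq_lintegral_ofReal (hgi hH) (Eventually.of_forall fun x => hg0 _),
    ofReal_integral_eq_lintegral_ofReal (hgi (hHn n)) (Eventually.of_forall fun x => hg0 _)]
  have e1 : ∀ x, ENNReal.ofReal (g (Hn n x)) ≤ ENNReal.ofReal (min (g (Hn n x)) (B x))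
      + ENNReal.ofReal c' * ENNReal.ofReal (‖(Hn n - H) x‖ ^ p) := by
    intro x
    have hB0 : 0 ≤ B x := by positivity
    rw [← ENNReal.ofReal_mul hc'0,
      ← ENNReal.ofReal_add (le_min (hg0 _) hB0) (by positivity)]
    refine ENNReal.ofReal_le_ofReal ?_
    have h1 := rpow_norm_le_two_rpow_mul hp (Hn n x) (H x)
    have h2 : (1 : ℝ) ≤ 2 ^ p := Real.one_le_rpow (by norm_num) h0.le
    have h3 : g (Hn n x) ≤ B x + c' * ‖(Hn n - H) x‖ ^ p := by
      rw [hB, hc', Pi.sub_apply]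
      calc g (Hn n x) ≤ c * (1 + ‖Hn n x‖ ^ p) := hgc _
        _ ≤ c * (2 ^ p + 2 ^ p * (‖H x‖ ^ p + ‖Hn n x - H x‖ ^ p)) := by gcongr
        _ = _ := by ring
    have h4 : 0 ≤ c' * ‖(Hn n - H) x‖ ^ p := by positivity
    rcases min_cases (g (Hn n x)) (B x) with h | h <;> rw [h.1] <;> linarith
  have hm : AEMeasurable (fun x => ENNReal.ofReal (‖(Hn n - H) x‖ ^ p)) μ :=
    (((hHn n).1.sub hH.1).norm.aemeasurable.pow_const p).ennreal_ofReal
  have hmin : Measurable fun x => ENNReal.ofReal (min (g (Hn n x)) (B x)) :=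
    ((hgm.comp (hHnm n)).min hBm).ennreal_ofReal
  calc _ ≤ ∫⁻ x, (ENNReal.ofReal (min (g (Hn n x)) (B x))
      + ENNReal.ofReal c' * ENNReal.ofReal (‖(Hn n - H) x‖ ^ p)) ∂μ := lintegral_mono e1
    _ = (∫⁻ x, ENNReal.ofReal (min (g (Hn n x)) (B x)) ∂μ)
      + ENNReal.ofReal c' * eLpNorm (Hn n - H) (ENNReal.ofReal p) μ ^ p := by
        rw [lintegral_add_left hmin,
          lintegral_const_mul'' _ hm, lintegral_ofReal_rpow_norm hp]
    _ < _ := ENNReal.add_lt_add h1 h2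
    _ = _ := by
        rw [add_assoc, ← ENNReal.ofReal_add (by positivity) (by positivity), add_halves]

/-- Upper semicontinuity, in `L^p`, of the integral of an upper semicontinuous integrand of
`p`-growth: a sequence violating it would have a subsequence that converges almost everywhere. -/
theorem exists_forall_integral_lt_of_upperSemicontinuous [SecondCountableTopology E]
    [IsFiniteMeasure μ] {p : ℝ} (hp : 1 ≤ p)
    {c : ℝ} (hc : 0 ≤ c) {g : E → ℝ} (hg : UpperSemicontinuous g) (hg0 : ∀ A, 0 ≤ g A)
    (hgc : ∀ A, g A ≤ c * (1 + ‖A‖ ^ p)) {H : X → E} (hH : MemLp H (ENNReal.ofReal p) μ)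
    {ε : ℝ} (hε : 0 < ε) :
    ∃ η : ℝ, 0 < η ∧ ∀ H' : X → E, MemLp H' (ENNReal.ofReal p) μ →
      eLpNorm (H' - H) (ENNReal.ofReal p) μ < ENNReal.ofReal η →
      ∫ x, g (H' x) ∂μ < (∫ x, g (H x) ∂μ) + ε := by
  have h0 : 0 < p := zero_lt_one.trans_le hp
  by_contra! hcon
  choose Hn hHn hlt hge using fun n : ℕ => hcon (1 / (n + 1)) (by positivity)
  -- Pass to Borel representatives, for which the reverse Fatou lemma is available.
  set H₁ := hH.1.mk H with hH₁
  have a1 : H =ᵐ[μ] H₁ := hH.1.ae_eq_mk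
  set Kn := fun n => (hHn n).1.mk (Hn n) with hKn
  have a2 : ∀ n, Hn n =ᵐ[μ] Kn n := fun n => (hHn n).1.ae_eq_mk
  have m1 : MemLp H₁ (ENNReal.ofReal p) μ := (memLp_congr_ae a1).1 hH
  have m2 : ∀ n, MemLp (Kn n) (ENNReal.ofReal p) μ := fun n => (memLp_congr_ae (a2 n)).1 (hHn n)
  have hlim : Tendsto (fun n => eLpNorm (Kn n - H₁) (ENNReal.ofReal p) μ) atTop (𝓝 0) := by
    have h1 : Tendsto (fun n : ℕ => ENNReal.ofReal (1 / ((n : ℝ) + 1))) atTop (𝓝 0) := by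
      simpa using ENNReal.tendsto_ofReal tendsto_one_div_add_atTop_nhds_zero_nat
    refine tendsto_of_tendsto_of_tendsto_of_le_of_le tendsto_const_nhds h1 (fun n => zero_le)
      fun n => ?_
    rw [← eLpNorm_congr_ae ((a2 n).sub a1)]
    exact (hlt n).le
  obtain ⟨ns, hns, hae⟩ := (tendstoInMeasure_of_tendsto_eLpNorm (by simpa using h0)
    (fun n => (m2 n).1) m1.1 hlim).exists_seq_tendsto_ae
  have ev := eventually_integral_lt_of_upperSemicontinuous hp hc hg hg0 hgc m1
    hH.1.stronglyMeasurable_mk.measurable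
    (fun n => m2 (ns n)) (fun n => (hHn (ns n)).1.stronglyMeasurable_mk.measurable)
    (hlim.comp hns.tendsto_atTop) hae hε
  obtain ⟨n, hn⟩ := ev.exists
  have e1 : ∫ x, g (Kn (ns n) x) ∂μ = ∫ x, g (Hn (ns n) x) ∂μ := integral_congr_ae (by
    filter_upwards [a2 (ns n)] with x hx
    rw [hx])
  have e2 : ∫ x, g (H₁ x) ∂μ = ∫ x, g (H x) ∂μ := integral_congr_ae (by
    filter_upwards [a1] with x hx
    rw [hx])
  rw [e1, e2] at hn
  exact absurd (hge (ns n)) (not_le.2 hn)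

end Semicontinuity

/-! ### Quadratic approximation and oscillation -/

section PiecewiseQuadratic

variable {F : Type*} [NormedAddCommGroup F] [NormedSpace ℝ F]

theorem convex_unitSquare : Convex ℝ unitSquare := by
  intro x hx y hy a b ha hb hab i
  exact convex_Ioo (-(1 / 2) : ℝ) (1 / 2) (hx i) (hy i) ha hb hab

theorem zero_mem_unitSquare : (0 : Plane) ∈ unitSquare := fun i => by
  simp only [PiLp.zero_apply]
  norm_num

theorem norm_fderiv_le_of_pderiv {w : Plane → F} {x : Plane} {τ : ℝ}
    (h : ∀ i, ‖pderiv i w x‖ ≤ τ) : ‖fderiv ℝ w x‖ ≤ 2 * τ := by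
  have hτ : 0 ≤ τ := (norm_nonneg _).trans (h 0)
  refine ContinuousLinearMap.opNorm_le_bound _ (by positivity) fun v => ?_
  have e : v = v 0 • EuclideanSpace.single 0 (1 : ℝ) + v 1 • EuclideanSpace.single 1 (1 : ℝ) := by
    refine PiLp.ext fun k => ?_
    fin_cases k <;> simp
  have e2 : fderiv ℝ w x v = v 0 • pderiv 0 w x + v 1 • pderiv 1 w x := by
    conv_lhs => rw [e]
    simp only [map_add, map_smul, pderiv]
  have h1 : ∀ i, ‖v i • pderiv i w x‖ ≤ τ * ‖v‖ := fun i => by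
    rw [norm_smul, mul_comm]
    exact mul_le_mul (h i) (PiLp.norm_apply_le v i) (norm_nonneg _) hτ
  rw [e2]
  refine (norm_add_le _ _).trans ?_
  linarith [h1 0, h1 1]

theorem norm_le_on_unitSquare {w : Plane → F} (hw : ContDiff ℝ ∞ w) (h0 : w 0 = 0) {τ : ℝ}
    (h : ∀ i, ∀ x ∈ unitSquare, ‖pderiv i w x‖ ≤ τ) : ∀ x ∈ unitSquare, ‖w x‖ ≤ 2 * τ := by
  intro x hx
  have hτ : 0 ≤ τ := (norm_nonneg _).trans (h 0 x hx)
  have h1 := convex_unitSquare.norm_image_sub_le_of_norm_fderiv_le (𝕜 := ℝ) (f := w)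
    (fun y _ => hw.differentiable (by simp) y)
    (fun y hy => norm_fderiv_le_of_pderiv fun i => h i y hy) zero_mem_unitSquare hx
  rw [h0, sub_zero, sub_zero] at h1
  exact h1.trans (mul_le_of_le_one_right (by positivity) (norm_lt_one_of_mem_unitSquare hx).le)

theorem exists_lipschitz_pderiv {w : Plane → F} (hw : ContDiff ℝ ∞ w) (hc : HasCompactSupport w) :
    ∃ L, 0 ≤ L ∧ ∀ x y, ‖w x - w y‖ ≤ L * ‖x - y‖ := by
  obtain ⟨L, hL⟩ := (hw.continuous_fderiv (by simp)).bounded_above_of_compact_support (hc.fderiv ℝ)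
  exact ⟨L, (norm_nonneg _).trans (hL 0), fun x y =>
    convex_univ.norm_image_sub_le_of_norm_fderiv_le (𝕜 := ℝ)
      (fun z _ => hw.differentiable (by simp) z) (fun z _ => hL z) (mem_univ y) (mem_univ x)⟩

theorem pderiv_comp_rescale {w : Plane → F} (hw : ContDiff ℝ ∞ w) (a : Plane) (h : ℝ) (i : Fin 2) :
    pderiv i (fun y => w (a + h • y)) = fun y => h • pderiv i w (a + h • y) := by
  ext1 y
  have h1 : HasFDerivAt (fun y : Plane => a + h • y) (h • ContinuousLinearMap.id ℝ Plane) y :=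
    ((hasFDerivAt_id y).const_smul h).const_add a
  have h2 := (hw.differentiable (by simp) (a + h • y)).hasFDerivAt.comp y h1
  unfold pderiv
  rw [show (fun y => w (a + h • y)) = w ∘ (fun y : Plane => a + h • y) from rfl, h2.fderiv]
  simp

theorem pderiv_const_smul {w : Plane → F} (hw : ContDiff ℝ ∞ w) (c : ℝ) (i : Fin 2) :
    pderiv i (c • w) = c • pderiv i w := by
  ext1 y
  unfold pderiv
  rw [fderiv_const_smul (hw.differentiable (by simp) y)]
  rfl

/-- The difference of the second Taylor polynomial of `w` at `a` and of `w`, rescaled from the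
square of side `h` around `a` to the unit square. -/
def taylorRemainder (w : Plane → F) (h : ℝ) (a : Plane) : Plane → F :=
  quadPoly (h⁻¹ ^ 2 • w a) (fun i => h⁻¹ • pderiv i w a) (fun i j => pderiv j (pderiv i w) a)
    - h⁻¹ ^ 2 • fun y => w (a + h • y)

theorem contDiff_comp_rescale {w : Plane → F} (hw : ContDiff ℝ ∞ w) (a : Plane) (h : ℝ) :
    ContDiff ℝ ∞ fun y => w (a + h • y) :=
  hw.comp (by fun_prop)

theorem contDiff_taylorRemainder {w : Plane → F} (hw : ContDiff ℝ ∞ w) (h : ℝ) (a : Plane) :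
    ContDiff ℝ ∞ (taylorRemainder w h a) :=
  (contDiff_quadPoly _ _ _).sub ((contDiff_comp_rescale hw a h).const_smul _)

theorem pderiv_taylorRemainder {w : Plane → F} (hw : ContDiff ℝ ∞ w) {h : ℝ} (hh : 0 < h)
    (a : Plane) (i : Fin 2) :
    pderiv i (taylorRemainder w h a) = (fun y => h⁻¹ • pderiv i w a
      + ∑ j, y j • pderiv j (pderiv i w) a) - h⁻¹ • fun y => pderiv i w (a + h • y) := by
  have hc := contDiff_comp_rescale hw a h
  have hcs : ContDiff ℝ ∞ (h⁻¹ ^ 2 • fun y => w (a + h • y)) := hc.const_smul _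
  rw [taylorRemainder, pderiv_sub (contDiff_quadPoly _ _ _) hcs,
    pderiv_quadPoly _ _ fun i j => congrFun (pderiv_comm hw i j) a, pderiv_const_smul hc,
    pderiv_comp_rescale hw]
  congr 1
  funext y
  simp only [Pi.smul_apply, smul_smul]
  congr 1
  field_simp

theorem pderiv_pderiv_taylorRemainder {w : Plane → F} (hw : ContDiff ℝ ∞ w) {h : ℝ} (hh : 0 < h)
    (a : Plane) (i j : Fin 2) (y : Plane) :
    pderiv j (pderiv i (taylorRemainder w h a)) y
      = pderiv j (pderiv i w) a - pderiv j (pderiv i w) (a + h • y) := by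
  have hc := contDiff_comp_rescale hw a h
  have hcs : ContDiff ℝ ∞ (h⁻¹ ^ 2 • fun y => w (a + h • y)) := hc.const_smul _
  have hc' : ContDiff ℝ ∞ (fun y => h • pderiv i w (a + h • y)) :=
    (contDiff_comp_rescale (contDiff_pderiv hw i) a h).const_smul h
  rw [taylorRemainder, pderiv_sub (contDiff_quadPoly _ _ _) hcs,
    pderiv_sub (contDiff_pderiv (contDiff_quadPoly _ _ _) i) (contDiff_pderiv hcs i),
    pderiv_pderiv_quadPoly _ _ fun i j => congrFun (pderiv_comm hw i j) a, pderiv_const_smul hc,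
    pderiv_comp_rescale hw, pderiv_const_smul hc']
  have e : (fun y => h • pderiv i w (a + h • y)) = h • fun y => pderiv i w (a + h • y) := rfl
  rw [e, pderiv_const_smul (contDiff_comp_rescale (contDiff_pderiv hw i) a h),
    pderiv_comp_rescale (contDiff_pderiv hw i)]
  simp only [Pi.sub_apply, Pi.smul_apply, smul_smul]
  congr 1
  rw [show h⁻¹ ^ 2 * h * h = 1 by field_simp, one_smul]

/-- The rescaled Taylor remainders are `O(h)` in `C²` of the unit square, uniformly in the
centre. -/
theorem exists_taylorRemainder_le {w : Plane → F} (hw : ContDiff ℝ ∞ w) (hc : HasCompactSupport w) :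
    ∃ L, 0 ≤ L ∧ ∀ h, 0 < h → ∀ a, ∀ y ∈ unitSquare, ‖taylorRemainder w h a y‖ ≤ L * h ∧
      (∀ i, ‖pderiv i (taylorRemainder w h a) y‖ ≤ L * h) ∧
      ∀ i j, ‖pderiv j (pderiv i (taylorRemainder w h a)) y‖ ≤ L * h := by
  choose L hL0 hL using fun i j => exists_lipschitz_pderiv
    (contDiff_pderiv (contDiff_pderiv hw i) j)
    (hasCompactSupport_pderiv (hasCompactSupport_pderiv hc i) j)
  set S := ∑ i, ∑ j, L i j with hS
  have hS0 : 0 ≤ S := Finset.sum_nonneg fun i _ => Finset.sum_nonneg fun j _ => hL0 i j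
  have hLS : ∀ i j, L i j ≤ S := fun i j =>
    (Finset.single_le_sum (f := fun j => L i j) (fun j _ => hL0 i j) (Finset.mem_univ j)).trans
      (Finset.single_le_sum (f := fun i => ∑ j, L i j)
        (fun i _ => Finset.sum_nonneg fun j _ => hL0 i j) (Finset.mem_univ i))
  refine ⟨4 * S, by positivity, fun h hh a => ?_⟩
  have b2 : ∀ i j, ∀ y ∈ unitSquare, ‖pderiv j (pderiv i (taylorRemainder w h a)) y‖ ≤ S * h := by
    intro i j y hy
    rw [pderiv_pderiv_taylorRemainder hw hh]
    refine (hL i j _ _).trans ?_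
    have : ‖a - (a + h • y)‖ ≤ h := by
      rw [sub_add_cancel_left, norm_neg, norm_smul, Real.norm_of_nonneg hh.le]
      exact mul_le_of_le_one_right hh.le (norm_lt_one_of_mem_unitSquare hy).le
    exact mul_le_mul (hLS i j) this (norm_nonneg _) hS0
  have hR := contDiff_taylorRemainder hw h a
  have b1 : ∀ i, ∀ y ∈ unitSquare, ‖pderiv i (taylorRemainder w h a) y‖ ≤ 2 * (S * h) := by
    intro i
    refine norm_le_on_unitSquare (contDiff_pderiv hR i) ?_ fun j => b2 i j
    rw [pderiv_taylorRemainder hw hh]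
    simp
  have b0 : ∀ y ∈ unitSquare, ‖taylorRemainder w h a y‖ ≤ 2 * (2 * (S * h)) := by
    refine norm_le_on_unitSquare hR ?_ b1
    simp [taylorRemainder, quadPoly]
  have hSh : 0 ≤ S * h := by positivity
  exact fun y hy => ⟨(b0 y hy).trans (by linarith), fun i => (b1 i y hy).trans (by linarith),
    fun i j => (b2 i j y hy).trans (by linarith)⟩

theorem cell_subset_cell {a : Plane} {θ h : ℝ} (hθ : 0 < θ) (hθ1 : θ ≤ 1) (hh : 0 < h) :
    cell a (θ * h) ⊆ cell a h := by
  intro x hx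
  rw [mem_cell_iff hh]
  intro i
  have h1 := (mem_cell_iff (mul_pos hθ hh)).1 hx i
  have h2 : θ * h ≤ h := mul_le_of_le_one_left hh.le hθ1
  exact ⟨by linarith [h1.1], by linarith [h1.2]⟩

/-- A smooth function `w` becomes exactly quadratic on most of an open set `V`, namely on finitely
many disjoint squares, after adding a function that is small in `C²`: the cut-off second Taylor
remainders at the centres of the squares. -/
theorem exists_quadratic_correction {w : Plane → F} (hw : ContDiff ℝ ∞ w)
    (hc : HasCompactSupport w) {V : Set Plane} (hV : IsOpen V) (hVv : volume V ≠ ⊤) {κ : ℝ}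
    (hκ : 0 < κ) {η : ℝ≥0∞} (hη : η ≠ 0) :
    ∃ (ψ : Plane → F) (D : Fin 2 → Plane → F) (H : Fin 2 → Fin 2 → Plane → F) (A : Finset Plane)
      (s : ℝ) (Ξ : Plane → Fin 2 → Fin 2 → F), HasWeakHess ψ D H ∧ 0 < s ∧
      (∀ x, ‖ψ x‖ ≤ κ) ∧ (∀ i x, ‖D i x‖ ≤ κ) ∧ (∀ i j x, ‖H i j x‖ ≤ κ) ∧
      (∀ x ∉ V, ψ x = 0) ∧ (∀ i, ∀ x ∉ V, D i x = 0) ∧ (∀ i j, ∀ x ∉ V, H i j x = 0) ∧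
      (∀ a ∈ A, cell a s ⊆ V) ∧
      (∀ a ∈ A, ∀ b ∈ A, a ≠ b → Disjoint (cell a s) (cell b s)) ∧
      volume (V \ ⋃ a ∈ A, cell a s) < η ∧ (∀ a i j, Ξ a i j = Ξ a j i) ∧
      ∀ a ∈ A, ∀ x ∈ cell a s, ∀ i j, pderiv j (pderiv i w) x + H i j x = Ξ a i j := by
  -- The cutoff is `1` on the square of side `θ`, so each square of the grid loses the fraction
  -- `1 - θ ^ 2` of its area.
  obtain ⟨θ, hθ0, hθ1, hθη⟩ : ∃ θ : ℝ, 0 < θ ∧ θ < 1 ∧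
      ENNReal.ofReal (1 - θ ^ 2) * volume V < η / 2 := by
    have hc : Tendsto (fun θ : ℝ => ENNReal.ofReal (1 - θ ^ 2) * volume V) (𝓝[<] 1) (𝓝 0) := by
      have : Continuous fun θ : ℝ => ENNReal.ofReal (1 - θ ^ 2) :=
        ENNReal.continuous_ofReal.comp (by fun_prop)
      have h1 := (this.tendsto 1).mono_left (nhdsWithin_le_nhds (s := Iio 1))
      have h2 := ENNReal.Tendsto.mul_const (b := volume V) h1 (Or.inr hVv)
      simpa using h2
    have h1 := hc.eventually (gt_mem_nhds (ENNReal.half_pos hη))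
    have h2 : ∀ᶠ θ : ℝ in 𝓝[<] 1, θ ∈ Ioo (0 : ℝ) 1 := Ioo_mem_nhdsLT one_pos
    obtain ⟨θ, h3, h4⟩ := (h1.and h2).exists
    exact ⟨θ, h4.1, h4.2, h3⟩
  have hcl := closure_cell_zero_subset hθ0 hθ1
  have hclc : IsCompact (closure (cell 0 θ)) :=
    (isCompact_closedBall (0 : Plane) 1).of_isClosed_subset isClosed_closure fun x hx => by
      simpa using (norm_lt_one_of_mem_unitSquare (hcl hx)).le
  obtain ⟨χ, hχ, hχc, hχs, V', hV', hKV, hV1⟩ := exists_cutoff hclc isOpen_unitSquare hcl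
  obtain ⟨C, hC0, hC⟩ := exists_isCellBump_cutoff (F := F) hχ hχc hχs
  obtain ⟨L, hL0, hL⟩ := exists_taylorRemainder_le hw hc
  obtain ⟨h, hh0, hhs, A, hAV, hdisj, hAη⟩ := exists_cells hV hVv (ENNReal.half_pos hη).ne'
    (s₀ := min 1 (κ / (C * L + 1))) (by positivity)
  have hh1 : h ≤ 1 := (hhs.trans_le (min_le_left _ _)).le
  have hhκ : C * (L * h) ≤ κ := by
    have h1 := (hhs.trans_le (min_le_right _ _)).le
    rw [le_div_iff₀ (by positivity)] at h1
    nlinarith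
  set R := taylorRemainder w h with hR
  have hbump : ∀ a ∈ A, IsCellBump (C * (L * h)) (C * (L * h)) (χ • R a)
      (fun i => pderiv i (χ • R a)) (fun i j => pderiv j (pderiv i (χ • R a))) := fun a _ =>
    hC (R a) (L * h) (by positivity) (contDiff_taylorRemainder hw h a)
      (fun y hy => (hL h hh0 a y hy).1) (fun i y hy => (hL h hh0 a y hy).2.1 i)
      (fun i j y hy => (hL h hh0 a y hy).2.2 i j)
  have hM0 : 0 ≤ C * (L * h) := by positivity
  have hnot : ∀ x ∉ V, x ∉ ⋃ a ∈ A, cell a h := fun x hx hx' => by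
    obtain ⟨a, ha, hxa⟩ := mem_iUnion₂.1 hx'
    exact hx (hAV a ha hxa)
  have hin : ∀ a, cell a (θ * h) ⊆ cell a h := fun a => cell_subset_cell hθ0 hθ1.le hh0
  refine ⟨paste A h (h ^ 2) fun a => χ • R a, fun i => paste A h h fun a => pderiv i (χ • R a),
    fun i j => paste A h 1 fun a => pderiv j (pderiv i (χ • R a)), A, θ * h,
    fun a i j => pderiv j (pderiv i w) a,
    hasWeakHess_paste hh0 fun a ha => (hbump a ha).hess, by positivity,
    fun x => ?_, fun i x => ?_, fun i j x => ?_, fun x hx => ?_, fun i x hx => ?_,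
    fun i j x hx => ?_, fun a ha => (hin a).trans (hAV a ha),
    fun a ha b hb hab => (hdisj a ha b hb hab).mono (hin a) (hin b), ?_,
    fun a i j => congrFun (pderiv_comm hw i j) a, fun a ha x hx i j => ?_⟩
  · refine (norm_paste_le hdisj (fun a ha => (hbump a ha).eq_zero) hM0 (by positivity)
      (fun a ha => (hbump a ha).le) x).trans ?_
    exact (mul_le_of_le_one_left hM0 (by nlinarith)).trans hhκ
  · refine (norm_paste_le hdisj (fun a ha => (hbump a ha).grad_eq_zero i) hM0 (by positivity)
      (fun a ha => (hbump a ha).grad_le i) x).trans ?_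
    exact (mul_le_of_le_one_left hM0 hh1).trans hhκ
  · refine (norm_paste_le hdisj (fun a ha => (hbump a ha).hess_eq_zero i j) hM0 (by positivity)
      (fun a ha => (hbump a ha).hess_le i j) x).trans ?_
    rwa [one_mul]
  · exact paste_of_notMem (fun a ha => (hbump a ha).eq_zero) (hnot x hx)
  · exact paste_of_notMem (fun a ha => (hbump a ha).grad_eq_zero i) (hnot x hx)
  · exact paste_of_notMem (fun a ha => (hbump a ha).hess_eq_zero i j) (hnot x hx)
  · have hsub : V \ ⋃ a ∈ A, cell a (θ * h)
        ⊆ (V \ ⋃ a ∈ A, cell a h) ∪ ⋃ a ∈ A, (cell a h \ cell a (θ * h)) := by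
      rintro x ⟨hxV, hx⟩
      by_cases hxA : x ∈ ⋃ a ∈ A, cell a h
      · right
        obtain ⟨a, ha, hxa⟩ := mem_iUnion₂.1 hxA
        exact mem_biUnion ha ⟨hxa, fun h' => hx (mem_biUnion ha h')⟩
      · exact Or.inl ⟨hxV, hxA⟩
    have hring : ∀ a, volume (cell a h \ cell a (θ * h))
        = ENNReal.ofReal (1 - θ ^ 2) * volume (cell a h) := by
      intro a
      have hθh : 0 < θ * h := by positivity
      rw [measure_sdiff (hin a) (measurableSet_cell _ _).nullMeasurableSet
        (by rw [volume_cell _ hθh]; exact ENNReal.ofReal_ne_top), volume_cell _ hθh,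
        volume_cell _ hh0, ← ENNReal.ofReal_sub _ (by positivity),
        ← ENNReal.ofReal_mul (by nlinarith)]
      congr 1
      ring
    calc _ ≤ volume (V \ ⋃ a ∈ A, cell a h) + volume (⋃ a ∈ A, (cell a h \ cell a (θ * h))) :=
          (measure_mono hsub).trans (measure_union_le _ _)
      _ ≤ volume (V \ ⋃ a ∈ A, cell a h)
            + ∑ a ∈ A, ENNReal.ofReal (1 - θ ^ 2) * volume (cell a h) := by
          gcongr
          exact (measure_biUnion_finset_le _ _).trans_eq (Finset.sum_congr rfl fun a _ => hring a)
      _ = volume (V \ ⋃ a ∈ A, cell a h)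
            + ENNReal.ofReal (1 - θ ^ 2) * volume (⋃ a ∈ A, cell a h) := by
          rw [measure_biUnion_finset (fun a ha b hb hab => hdisj a ha b hb hab)
            fun a _ => measurableSet_cell _ _, Finset.mul_sum]
      _ ≤ volume (V \ ⋃ a ∈ A, cell a h) + ENNReal.ofReal (1 - θ ^ 2) * volume V := by
          gcongr
          exact iUnion₂_subset hAV
      _ < η / 2 + η / 2 := ENNReal.add_lt_add hAη hθη
      _ = η := ENNReal.add_halves η
  · change pderiv j (pderiv i w) x + paste A h 1 (fun a => pderiv j (pderiv i (χ • R a))) x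
      = pderiv j (pderiv i w) a
    rw [paste_of_mem hdisj (fun a ha => (hbump a ha).hess_eq_zero i j) ha (hin a hx), one_smul]
    have hy : h⁻¹ • (x - a) ∈ cell 0 θ := by
      change θ⁻¹ • (h⁻¹ • (x - a) - 0) ∈ unitSquare
      rw [sub_zero, smul_smul, ← mul_inv]
      exact hx
    have hyV := hKV (subset_closure hy)
    have e : EqOn (χ • R a) (R a) V' := fun y hy => by simp [hV1 y hy]
    rw [pderiv_eqOn hV' (pderiv_eqOn hV' e i) j hyV, hR, pderiv_pderiv_taylorRemainder hw hh0,
      smul_smul, mul_inv_cancel₀ hh0.ne', one_smul, add_sub_cancel, add_sub_cancel]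

theorem isPreconnected_cell (a : Plane) {s : ℝ} (hs : 0 < s) : IsPreconnected (cell a s) := by
  have e : cell a s = (fun y => a + s • y) '' unitSquare := by
    ext x
    constructor
    · intro hx
      refine ⟨s⁻¹ • (x - a), hx, ?_⟩
      simp only
      rw [smul_smul, mul_inv_cancel₀ hs.ne', one_smul, add_sub_cancel]
    · rintro ⟨y, hy, rfl⟩
      change s⁻¹ • (a + s • y - a) ∈ unitSquare
      rwa [add_sub_cancel_left, smul_smul, inv_mul_cancel₀ hs.ne', one_smul]
  rw [e]
  exact convex_unitSquare.isPreconnected.image _ (by fun_prop)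

theorem mem_cell_self (a : Plane) (s : ℝ) : a ∈ cell a s := by
  change s⁻¹ • (a - a) ∈ unitSquare
  rw [sub_self, smul_zero]
  exact zero_mem_unitSquare

/-- A square covered by disjoint open squares lies in one of them, by connectedness. -/
theorem exists_cell_subset_of_subset_iUnion {A : Finset Plane} {s t : ℝ} (ht : 0 < t)
    (hdisj : ∀ a ∈ A, ∀ b ∈ A, a ≠ b → Disjoint (cell a s) (cell b s)) {b : Plane}
    (hb : cell b t ⊆ ⋃ a ∈ A, cell a s) : ∃ a ∈ A, cell b t ⊆ cell a s := by
  classical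
  obtain ⟨a, ha, hba⟩ := mem_iUnion₂.1 (hb (mem_cell_self b t))
  refine ⟨a, ha, ?_⟩
  have hsub : cell b t ⊆ cell a s ∪ ⋃ c ∈ A.erase a, cell c s := by
    intro x hx
    obtain ⟨c, hc, hxc⟩ := mem_iUnion₂.1 (hb hx)
    by_cases h : c = a
    · exact Or.inl (h ▸ hxc)
    · exact Or.inr (mem_biUnion (Finset.mem_erase.2 ⟨h, hc⟩) hxc)
  have hd : Disjoint (cell a s) (⋃ c ∈ A.erase a, cell c s) := by
    rw [disjoint_iUnion₂_right]
    intro c hc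
    have hc' := Finset.mem_erase.1 hc
    exact hdisj a ha c hc'.2 (Ne.symm hc'.1)
  rcases (isPreconnected_cell b ht).subset_or_subset (isOpen_cell a s)
    (isOpen_biUnion fun c _ => isOpen_cell c s) hd hsub with h | h
  · exact h
  · exact absurd (h (mem_cell_self b t)) (Set.disjoint_left.1 hd hba)

/-- Near-minimisers for `Q₂f (ξ a)`, one for each square `cell a s`, transported to the squares
of a fine grid; `α b` is the centre of the coarse square that contains `cell b t`. As there are
finitely many near-minimisers, their common bound `S` makes the correction of order `t * S` in
`C¹`, while its Hessian is only bounded. -/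
theorem exists_oscillation {m : ℕ} {f : HessSpace m → ℝ} {A : Finset Plane} {s : ℝ} (hs : 0 < s)
    (hdisj : ∀ a ∈ A, ∀ b ∈ A, a ≠ b → Disjoint (cell a s) (cell b s)) (ξ : Plane → HessSpace m)
    {κ δ : ℝ} (hκ : 0 < κ) (hδ : 0 < δ) {η : ℝ≥0∞} (hη : η ≠ 0) :
    ∃ (ψ : Plane → EuclideanSpace ℝ (Fin m)) (D : Fin 2 → Plane → EuclideanSpace ℝ (Fin m))
      (H : Fin 2 → Fin 2 → Plane → EuclideanSpace ℝ (Fin m)) (B : Finset Plane) (t M : ℝ)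
      (α : Plane → Plane),
      HasWeakHess ψ D H ∧ 0 < t ∧
      (∀ x, ‖ψ x‖ ≤ κ) ∧ (∀ i x, ‖D i x‖ ≤ κ) ∧ (∀ i j x, ‖H i j x‖ ≤ M) ∧
      (∀ x ∉ ⋃ b ∈ B, cell b t, ψ x = 0) ∧ (∀ i, ∀ x ∉ ⋃ b ∈ B, cell b t, D i x = 0) ∧
      (∀ i j, ∀ x ∉ ⋃ b ∈ B, cell b t, H i j x = 0) ∧
      (∀ b ∈ B, ∀ c ∈ B, b ≠ c → Disjoint (cell b t) (cell c t)) ∧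
      volume ((⋃ a ∈ A, cell a s) \ ⋃ b ∈ B, cell b t) < η ∧
      ∀ b ∈ B, α b ∈ A ∧ cell b t ⊆ cell (α b) s ∧
        ∫ x in cell b t, f (ξ (α b) + hessOf fun i j => H i j x)
          ≤ t ^ 2 * (Q2 f (ξ (α b)) + δ) := by
  classical
  choose u D H M hbump hlt using fun a =>
    exists_isCellBump_of_Q2_lt (f := f) (ξ := ξ a) (lt_add_of_pos_right _ hδ)
  have hM0 : ∀ a, 0 ≤ M a := fun a => (norm_nonneg _).trans ((hbump a).le 0)
  set S := ∑ a ∈ A, M a with hS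
  have hS0 : 0 ≤ S := Finset.sum_nonneg fun a _ => hM0 a
  have hMS : ∀ a ∈ A, M a ≤ S := fun a ha => Finset.single_le_sum (fun a _ => hM0 a) ha
  have hGv : volume (⋃ a ∈ A, cell a s) ≠ ⊤ := by
    refine ((measure_biUnion_finset_le _ _).trans_lt ?_).ne
    exact ENNReal.sum_lt_top.2 fun a _ => by rw [volume_cell _ hs]; exact ENNReal.ofReal_lt_top
  obtain ⟨t, ht0, hts, B, hBG, hBdisj, hBη⟩ := exists_cells
    (isOpen_biUnion fun a (_ : a ∈ A) => isOpen_cell a s) hGv hη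
    (s₀ := min 1 (κ / (S + 1))) (by positivity)
  have ht1 : t ≤ 1 := (hts.trans_le (min_le_left _ _)).le
  have htκ : t * S ≤ κ := by
    have h1 := (hts.trans_le (min_le_right _ _)).le
    rw [le_div_iff₀ (by positivity)] at h1
    nlinarith
  have hex : ∀ b, ∃ a, b ∈ B → a ∈ A ∧ cell b t ⊆ cell a s := fun b => by
    by_cases hb : b ∈ B
    · obtain ⟨a, ha, hba⟩ := exists_cell_subset_of_subset_iUnion ht0 hdisj (hBG b hb)
      exact ⟨a, fun _ => ⟨ha, hba⟩⟩
    · exact ⟨b, fun h => absurd h hb⟩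
  choose α hα using hex
  refine ⟨paste B t (t ^ 2) fun b => u (α b), fun i => paste B t t fun b => D (α b) i,
    fun i j => paste B t 1 fun b => H (α b) i j, B, t, S, α,
    hasWeakHess_paste ht0 fun b _ => (hbump (α b)).hess, ht0,
    fun x => ?_, fun i x => ?_, fun i j x => ?_,
    fun x hx => paste_of_notMem (fun b _ => (hbump (α b)).eq_zero) hx,
    fun i x hx => paste_of_notMem (fun b _ => (hbump (α b)).grad_eq_zero i) hx,
    fun i j x hx => paste_of_notMem (fun b _ => (hbump (α b)).hess_eq_zero i j) hx,
    hBdisj, hBη, fun b hb => ⟨(hα b hb).1, (hα b hb).2, ?_⟩⟩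
  · refine (norm_paste_le hBdisj (fun b _ => (hbump (α b)).eq_zero) hS0 (by positivity)
      (fun b hb x => ((hbump (α b)).le x).trans (hMS _ (hα b hb).1)) x).trans ?_
    exact (mul_le_mul_of_nonneg_right (by nlinarith : t ^ 2 ≤ t) hS0).trans htκ
  · exact (norm_paste_le hBdisj (fun b _ => (hbump (α b)).grad_eq_zero i) hS0 (by positivity)
      (fun b hb x => ((hbump (α b)).grad_le i x).trans (hMS _ (hα b hb).1)) x).trans htκ
  · refine (norm_paste_le hBdisj (fun b _ => (hbump (α b)).hess_eq_zero i j) hS0 (by positivity)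
      (fun b hb x => ((hbump (α b)).hess_le i j x).trans (hMS _ (hα b hb).1)) x).trans ?_
    rw [one_mul]
  · have e : ∀ x ∈ cell b t, f (ξ (α b) + hessOf fun i j => paste B t 1 (fun b => H (α b) i j) x)
        = (fun y => f (ξ (α b) + hessOf fun i j => H (α b) i j y)) (t⁻¹ • (x - b)) := by
      intro x hx
      simp only
      congr 3
      funext i j
      rw [paste_of_mem hBdisj (fun b _ => (hbump (α b)).hess_eq_zero i j) hb hx, one_smul]
    have h1 := setIntegral_cell b ht0
      fun y => f (ξ (α b) + hessOf fun i j => H (α b) i j y)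
    refine ((setIntegral_congr_fun (measurableSet_cell b t) e).trans h1).le.trans ?_
    exact mul_le_mul_of_nonneg_left (hlt (α b)).le (by positivity)

end PiecewiseQuadratic

/-! ### Smoothing in the interior -/

section Smoothing

variable {F : Type*} [NormedAddCommGroup F] [NormedSpace ℝ F] {Ω : Set Plane} {p : ℝ≥0∞}

theorem MemLp.cutoff (hΩ : MeasurableSet Ω) {χ : Plane → ℝ} (hχ : Continuous χ)
    (hχc : HasCompactSupport χ) (hχs : tsupport χ ⊆ Ω) {g : Plane → F}
    (hg : MemLp g p (volume.restrict Ω)) : MemLp (χ • g) p := by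
  obtain ⟨C, hC⟩ := hχ.bounded_above_of_compact_support hχc
  have h1 : MemLp (χ • g) p (volume.restrict Ω) :=
    hg.of_le_mul (c := C) (hχ.aestronglyMeasurable.smul hg.1) (Eventually.of_forall fun x => by
      rw [Pi.smul_apply', norm_smul]
      exact mul_le_mul_of_nonneg_right (hC x) (norm_nonneg _))
  rw [← memLp_indicator_iff_restrict hΩ] at h1
  rwa [indicator_eq_self.2 fun x hx => by_contra fun h => hx ?_] at h1
  rw [Pi.smul_apply', image_eq_zero_of_notMem_tsupport fun h' => h (hχs h'), zero_smul]

/-- A `W^{2,p}` function on `Ω` becomes smooth on most of `Ω` after adding a function that is small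
in `W^{2,p}` and vanishes near the boundary: cut off, then mollify. -/
theorem exists_smooth_correction [CompleteSpace F] (hΩ : IsOpen Ω) (hΩv : volume Ω ≠ ⊤)
    (hp : 1 ≤ p) (hp' : p ≠ ⊤) {u : Plane → F} {D₀ : Fin 2 → Plane → F}
    {H₀ : Fin 2 → Fin 2 → Plane → F} (hu : MemLp u p (volume.restrict Ω))
    (hD : ∀ i, HasWeakDeriv Ω i u (D₀ i)) (hDp : ∀ i, MemLp (D₀ i) p (volume.restrict Ω))
    (hH : ∀ i j, HasWeakDeriv Ω j (D₀ i) (H₀ i j))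
    (hHp : ∀ i j, MemLp (H₀ i j) p (volume.restrict Ω)) {η τ : ℝ≥0∞} (hη : η ≠ 0) (hτ : τ ≠ 0)
    (hτ' : τ ≠ ⊤) :
    ∃ (w ψ : Plane → F) (D : Fin 2 → Plane → F) (H : Fin 2 → Fin 2 → Plane → F) (K V : Set Plane),
      ContDiff ℝ ∞ w ∧ HasCompactSupport w ∧ HasWeakHess ψ D H ∧ IsCompact K ∧ K ⊆ Ω ∧
      IsOpen V ∧ V ⊆ K ∧ volume (Ω \ V) < η ∧
      MemLp ψ p ∧ (∀ i, MemLp (D i) p) ∧ (∀ i j, MemLp (H i j) p) ∧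
      eLpNorm ψ p ≤ τ ∧ (∀ i, eLpNorm (D i) p ≤ τ) ∧ (∀ i j, eLpNorm (H i j) p ≤ τ) ∧
      (∀ x ∉ K, ψ x = 0) ∧ (∀ i, ∀ x ∉ K, D i x = 0) ∧ (∀ i j, ∀ x ∉ K, H i j x = 0) ∧
      ∀ x ∈ V, ∀ i j, H₀ i j x + H i j x = pderiv j (pderiv i w) x := by
  obtain ⟨K₀, hK₀Ω, hK₀, hK₀η⟩ := hΩ.measurableSet.exists_isCompact_sdiff_lt hΩv hη
  obtain ⟨χ, hχ, hχc, hχs, V, hV, hKV, hV1⟩ := exists_cutoff hK₀ hΩ hK₀Ω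
  obtain ⟨r, hr, hrΩ⟩ := hχc.isCompact.exists_cthickening_subset_open hΩ hχs
  have hχ' := fun i => contDiff_pderiv hχ i
  have hχc' := fun i => hasCompactSupport_pderiv hχc i
  have hχs' := fun i => (tsupport_pderiv_subset i χ).trans hχs
  have hχ'' := fun i j => contDiff_pderiv (hχ' i) j
  have hχc'' := fun i j => hasCompactSupport_pderiv (hχc' i) j
  have hχs'' := fun i j => (tsupport_pderiv_subset j _).trans (hχs' i)
  set U := χ • u with hU
  set DU : Fin 2 → Plane → F := fun i => pderiv i χ • u + χ • D₀ i with hDU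
  set HU : Fin 2 → Fin 2 → Plane → F := fun i j =>
    (pderiv j (pderiv i χ) • u + pderiv i χ • D₀ j) + (pderiv j χ • D₀ i + χ • H₀ i j) with hHU
  have hUh : HasWeakHess U DU HU := ⟨fun i => (hD i).cutoff hχ hχc hχs, fun i j =>
    ((hD j).cutoff (hχ' i) (hχc' i) (hχs' i)).add ((hH i j).cutoff hχ hχc hχs)⟩
  have hm := hΩ.measurableSet
  have m0 : MemLp U p := MemLp.cutoff hm hχ.continuous hχc hχs hu
  have m1 : ∀ i, MemLp (DU i) p := fun i =>
    (MemLp.cutoff hm (hχ' i).continuous (hχc' i) (hχs' i) hu).add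
      (MemLp.cutoff hm hχ.continuous hχc hχs (hDp i))
  have m2 : ∀ i j, MemLp (HU i j) p := fun i j =>
    ((MemLp.cutoff hm (hχ'' i j).continuous (hχc'' i j) (hχs'' i j) hu).add
      (MemLp.cutoff hm (hχ' i).continuous (hχc' i) (hχs' i) (hDp j))).add
    ((MemLp.cutoff hm (hχ' j).continuous (hχc' j) (hχs' j) (hDp i)).add
      (MemLp.cutoff hm hχ.continuous hχc hχs (hHp i j)))
  have z0 : ∀ x ∉ tsupport χ, U x = 0 := fun x hx => by
    simp [hU, image_eq_zero_of_notMem_tsupport hx]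
  have z1 : ∀ i, ∀ x ∉ tsupport χ, DU i x = 0 := fun i x hx => by
    simp [hDU, image_eq_zero_of_notMem_tsupport hx, pderiv_eq_zero_of_notMem_tsupport hx]
  have z2 : ∀ i j, ∀ x ∉ tsupport χ, HU i j x = 0 := fun i j x hx => by
    have hx' : ∀ i, x ∉ tsupport (pderiv i χ) := fun i h => hx (tsupport_pderiv_subset i χ h)
    simp [hHU, image_eq_zero_of_notMem_tsupport hx, pderiv_eq_zero_of_notMem_tsupport hx,
      pderiv_eq_zero_of_notMem_tsupport (hx' i)]
  have hl : ∀ {w : Plane → F}, MemLp w p → LocallyIntegrable w := fun hw => hw.locallyIntegrable hp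
  have ev : ∀ {w : Plane → F}, MemLp w p → ∀ᶠ k in atTop, eLpNorm (mollify k w - w) p ≤ τ :=
    fun hw => (tendsto_eLpNorm_mollify_sub hp hp' hw).eventually_le_const (pos_iff_ne_zero.2 hτ)
  have ev' : ∀ᶠ k : ℕ in atTop, 1 / ((k : ℝ) + 1) < r :=
    tendsto_one_div_add_atTop_nhds_zero_nat.eventually_lt_const hr
  obtain ⟨k, hk, hk0, hk1, hk2⟩ := (ev'.and ((ev m0).and ((eventually_all.2 fun i => ev (m1 i)).and
    (eventually_all.2 fun i => eventually_all.2 fun j => ev (m2 i j))))).exists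
  set K := Metric.cthickening r (tsupport χ) with hK
  have hχK : tsupport χ ⊆ K := Metric.self_subset_cthickening _
  have hVχ : V ⊆ tsupport χ := fun x hx => subset_tsupport χ (by simp [hV1 x hx])
  -- the mollification at scale `1 / (k + 1)` only sees points within distance `r`
  have mz : ∀ {w : Plane → F}, (∀ x ∉ tsupport χ, w x = 0) → ∀ x ∉ K, mollify k w x = 0 :=
    fun hw x hx => mollify_eq_zero k fun y hy => hw y fun hy' =>
      hx (Metric.mem_cthickening_of_dist_le x y r _ hy' (by
        rw [dist_comm]; exact (Metric.mem_ball.1 hy).le.trans hk.le))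
  have mz' : ∀ {w : Plane → F}, (∀ x ∉ tsupport χ, w x = 0) → ∀ x ∉ K, (mollify k w - w) x = 0 :=
    fun hw x hx => by
      rw [Pi.sub_apply, mz hw x hx, hw x fun h => hx (hχK h), sub_zero]
  have hKc : IsCompact K := hχc.isCompact.cthickening
  have c0 := contDiff_mollify k (hl m0)
  have e1 : ∀ i, pderiv i (mollify k U) = mollify k (DU i) := fun i => pderiv_mollify k (hUh.1 i)
  have e2 : ∀ i j, pderiv j (mollify k (DU i)) = mollify k (HU i j) := fun i j =>
    pderiv_mollify k (hUh.2 i j)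
  have hsm : HasWeakHess (mollify k U) (fun i => mollify k (DU i))
      fun i j => mollify k (HU i j) := by
    simpa only [e1, e2] using hasWeakHess_of_contDiff c0
  have hcs : HasCompactSupport (mollify k U) := HasCompactSupport.intro hKc (mz z0)
  have M : ∀ {w : Plane → F}, MemLp w p → eLpNorm (mollify k w - w) p ≤ τ →
      AEStronglyMeasurable (mollify k w) → MemLp (mollify k w - w) p := fun hw h hm =>
    ⟨hm.sub hw.1, h.trans_lt (lt_top_iff_ne_top.2 hτ')⟩
  have hcm : ∀ {w : Plane → F}, MemLp w p → AEStronglyMeasurable (mollify k w) := fun hw =>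
    (contDiff_mollify k (hl hw)).continuous.aestronglyMeasurable
  refine ⟨mollify k U, mollify k U - U, (fun i => mollify k (DU i)) - DU,
    (fun i j => mollify k (HU i j)) - HU, K, V, c0, hcs, hsm.sub hUh, hKc, hrΩ, hV,
    hVχ.trans hχK, (measure_mono (sdiff_subset_sdiff_right hKV)).trans_lt hK₀η,
    M m0 hk0 (hcm m0), fun i => M (m1 i) (hk1 i) (hcm (m1 i)),
    fun i j => M (m2 i j) (hk2 i j) (hcm (m2 i j)), hk0, hk1, hk2, mz' z0,
    fun i => mz' (z1 i), fun i j => mz' (z2 i j), fun x hx i j => ?_⟩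
  have hV0 : ∀ i, EqOn (pderiv i χ) 0 V := fun i => by
    have h1 : EqOn χ (fun _ => 1) V := fun y hy => hV1 y hy
    intro y hy
    rw [pderiv_eqOn hV h1 i hy]
    simp [pderiv]
  have hV00 : ∀ i j, pderiv j (pderiv i χ) x = 0 := fun i j => by
    rw [pderiv_eqOn hV (hV0 i) j hx]
    simp [pderiv]
  have e : HU i j x = H₀ i j x := by
    simp [hHU, hV00, hV0 _ hx, hV1 x hx]
  rw [e1, e2, ← e]
  simp

end Smoothing

/-! ### Comparison of energies -/

section Relaxation

theorem exists_pos_forall_eLpNorm_le {X G : Type*} [MeasurableSpace X] (μ : Measure X)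
    [IsFiniteMeasure μ] [NormedAddCommGroup G] (p : ℝ≥0∞) {τ : ℝ≥0∞} (hτ : τ ≠ 0) :
    ∃ κ : ℝ, 0 < κ ∧ ∀ ψ : X → G, (∀ x, ‖ψ x‖ ≤ κ) → eLpNorm ψ p μ ≤ τ := by
  have hfin : μ univ ^ p.toReal⁻¹ ≠ ⊤ :=
    ENNReal.rpow_ne_top_of_nonneg (by positivity) (measure_ne_top μ univ)
  have h1 : Tendsto (fun κ : ℝ => μ univ ^ p.toReal⁻¹ * ENNReal.ofReal κ) (𝓝[>] 0) (𝓝 0) := by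
    have h2 := (ENNReal.continuous_ofReal.tendsto 0).mono_left (nhdsWithin_le_nhds (s := Ioi 0))
    have h3 := ENNReal.Tendsto.const_mul (a := μ univ ^ p.toReal⁻¹) h2 (Or.inr hfin)
    simpa using h3
  obtain ⟨κ, hκ, hκ0⟩ := ((h1.eventually_le_const (pos_iff_ne_zero.2 hτ)).and
    (self_mem_nhdsWithin : Ioi (0 : ℝ) ∈ 𝓝[>] 0)).exists
  exact ⟨κ, hκ0, fun ψ hψ => (eLpNorm_le_of_ae_bound (Eventually.of_forall hψ)).trans hκ⟩

theorem memLp_of_norm_le {G : Type*} [NormedAddCommGroup G] {p : ℝ≥0∞} {K : Set Plane}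
    (hK : IsCompact K) {ψ : Plane → G} (hm : LocallyIntegrable ψ) {M : ℝ} (hM : ∀ x, ‖ψ x‖ ≤ M)
    (h0 : ∀ x ∉ K, ψ x = 0) : MemLp ψ p := by
  have : IsFiniteMeasure (volume.restrict K) := ⟨by simpa using hK.measure_lt_top⟩
  have h1 : MemLp ψ p (volume.restrict K) :=
    MemLp.of_bound hm.aestronglyMeasurable.restrict M (Eventually.of_forall hM)
  rw [← memLp_indicator_iff_restrict hK.isClosed.measurableSet] at h1
  rwa [indicator_eq_self.2 fun x hx => by_contra fun h => hx (h0 x h)] at h1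

/-- Comparison of the energy of `G'` with the relaxed energy of `G`, when the two fields only
differ on finitely many disjoint squares, on each of which `G` is constant and the energy of `G'`
is nearly the relaxed one. -/
theorem setIntegral_comp_le_of_cells {E : Type*} {f g : E → ℝ} {G G' : Plane → E} {ℓ : Plane → ℝ}
    {Ω : Set Plane} (hΩ : MeasurableSet Ω) (hΩv : volume Ω ≠ ⊤) {B : Finset Plane} {t : ℝ}
    (ht : 0 < t) (hB : ∀ b ∈ B, cell b t ⊆ Ω)
    (hdisj : ∀ b ∈ B, ∀ c ∈ B, b ≠ c → Disjoint (cell b t) (cell c t)) (hg0 : ∀ ξ, 0 ≤ g ξ)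
    (hf : IntegrableOn (fun x => f (G' x)) Ω) (hg : IntegrableOn (fun x => g (G x)) Ω)
    (hℓ : IntegrableOn ℓ Ω) (hfℓ : ∀ x, f (G x) ≤ ℓ x) {ξ : Plane → E} {δ ε : ℝ} (hδ : 0 ≤ δ)
    (hG : ∀ b ∈ B, ∀ x ∈ cell b t, G x = ξ b) (hG' : ∀ x ∉ ⋃ b ∈ B, cell b t, G' x = G x)
    (hcell : ∀ b ∈ B, ∫ x in cell b t, f (G' x) ≤ t ^ 2 * (g (ξ b) + δ))
    (hoff : ∫ x in Ω \ ⋃ b ∈ B, cell b t, ℓ x ≤ ε) :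
    ∫ x in Ω, f (G' x) ≤ (∫ x in Ω, g (G x)) + δ * volume.real Ω + ε := by
  set S := ⋃ b ∈ B, cell b t with hS
  have hSm : MeasurableSet S := B.measurableSet_biUnion fun b _ => measurableSet_cell b t
  have hSΩ : S ⊆ Ω := iUnion₂_subset hB
  have hpd : (B : Set Plane).Pairwise (Function.onFun Disjoint fun b => cell b t) :=
    fun b hb c hc hbc => hdisj b hb c hc hbc
  have hvol : ∀ b, volume.real (cell b t) = t ^ 2 := fun b => by
    rw [Measure.real, volume_cell b ht, ENNReal.toReal_ofReal (by positivity)]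
  have hg' : IntegrableOn (fun x => g (G x) + δ) Ω := hg.add (integrableOn_const hΩv)
  have h1 : ∫ x in S, f (G' x) ≤ ∫ x in S, (g (G x) + δ) := by
    rw [integral_biUnion_finset B (fun b _ => measurableSet_cell b t) hpd
        fun b hb => hf.mono_set (hB b hb),
      integral_biUnion_finset B (fun b _ => measurableSet_cell b t) hpd
        fun b hb => hg'.mono_set (hB b hb)]
    refine Finset.sum_le_sum fun b hb => (hcell b hb).trans_eq ?_
    rw [setIntegral_congr_fun (measurableSet_cell b t)
      (g := fun _ => g (ξ b) + δ) fun x hx => by simp only [hG b hb x hx], setIntegral_const,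
      hvol, smul_eq_mul]
  have h2 : ∫ x in S, (g (G x) + δ) ≤ ∫ x in Ω, (g (G x) + δ) :=
    setIntegral_mono_set hg' (Eventually.of_forall fun x => add_nonneg (hg0 _) hδ)
      (Eventually.of_forall hSΩ)
  have h3 : ∫ x in Ω, (g (G x) + δ) = (∫ x in Ω, g (G x)) + δ * volume.real Ω := by
    rw [integral_add hg (integrableOn_const hΩv), setIntegral_const, smul_eq_mul, mul_comm]
  have h4 : ∫ x in Ω \ S, f (G' x) ≤ ∫ x in Ω \ S, ℓ x :=
    setIntegral_mono_on (hf.mono_set sdiff_subset) (hℓ.mono_set sdiff_subset) (hΩ.diff hSm)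
      fun x hx => by rw [hG' x hx.2]; exact hfℓ x
  have h5 := integral_inter_add_sdiff hSm hf
  rw [inter_eq_self_of_subset_right hSΩ] at h5
  linarith

end Relaxation

theorem theorem3p5 {m : ℕ} (p : ℝ) (hp : 1 ≤ p)
    (f : HessSpace m → ℝ) (hf_meas : Measurable f) (C : ℝ)
    (hf : ∀ A : HessSpace m, 0 ≤ f A ∧ f A ≤ C * (1 + ‖A‖ ^ p))
    (Ω : Set Plane) (hΩ : IsCornerDomain Ω)
    (u₀ : Plane → EuclideanSpace ℝ (Fin m)) (hu₀ : MemW2 Ω (ENNReal.ofReal p) u₀)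
    (u : Plane → EuclideanSpace ℝ (Fin m)) (hu : MemW2Zero Ω (ENNReal.ofReal p) (u - u₀))
    (ε : ℝ) (hε : 0 < ε) :
    ∃ v : Plane → EuclideanSpace ℝ (Fin m),
      MemW2Zero Ω (ENNReal.ofReal p) (v - u₀) ∧
      normW1 Ω (ENNReal.ofReal p) (u - v) < ENNReal.ofReal ε ∧
      IntegrableOn (fun x => f (weakHess Ω v x)) Ω ∧
      IntegrableOn (fun x => Q2 f (weakHess Ω u x)) Ω ∧
      ∫ x in Ω, f (weakHess Ω v x) < (∫ x in Ω, Q2 f (weakHess Ω u x)) + ε := by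
  have hΩo := hΩ.isOpen
  have hΩm := hΩo.measurableSet
  have hΩv : volume Ω ≠ ⊤ := hΩ.isBounded.measure_lt_top.ne
  have : IsFiniteMeasure (volume.restrict Ω) := ⟨by simpa using hΩv.lt_top⟩
  have hp0 : 0 < p := zero_lt_one.trans_le hp
  have hp1 : 1 ≤ ENNReal.ofReal p := by
    rw [← ENNReal.ofReal_one]
    exact ENNReal.ofReal_le_ofReal hp
  have hptop : ENNReal.ofReal p ≠ ⊤ := ENNReal.ofReal_ne_top
  -- Growth and boundedness of `f` and of the relaxed integrand `g`.
  have hf0 : ∀ A, 0 ≤ f A := fun A => (hf A).1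
  have hC0 : 0 ≤ C := by
    have h := (hf0 0).trans (hf 0).2
    rw [norm_zero, Real.zero_rpow hp0.ne', add_zero, mul_one] at h
    exact h
  have hb : ∀ R, ∃ B, ∀ A, ‖A‖ ≤ R → ‖f A‖ ≤ B := fun R => ⟨C * (1 + R ^ p), fun A hA => by
    rw [Real.norm_of_nonneg (hf0 A)]
    refine (hf A).2.trans ?_
    gcongr⟩
  -- The factor `4 ^ p` allows for `‖symHess ξ‖ ≤ 4 * ‖ξ‖`.
  set c := C * 4 ^ p with hc
  have h4 : (1 : ℝ) ≤ 4 ^ p := Real.one_le_rpow (by norm_num) hp0.le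
  have hc0 : 0 ≤ c := by positivity
  have hfc : ∀ A, f A ≤ c * (1 + ‖A‖ ^ p) := fun A => by
    refine (hf A).2.trans ?_
    rw [hc]
    gcongr
    exact le_mul_of_one_le_right hC0 h4
  set g : HessSpace m → ℝ := fun ξ => Q2 f (symHess ξ) with hg
  have hgu : UpperSemicontinuous g := upperSemicontinuous_Q2_symHess hf_meas hf0 hb
  have hg0 : ∀ ξ, 0 ≤ g ξ := fun ξ => Q2_nonneg hf0 _
  have hgc : ∀ ξ, g ξ ≤ c * (1 + ‖ξ‖ ^ p) := fun ξ => by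
    refine (Q2_le_self hf0 _).trans ((hf _).2.trans ?_)
    rw [hc, mul_assoc]
    gcongr
    rw [mul_add, mul_one, ← Real.mul_rpow (by norm_num) (norm_nonneg _)]
    exact add_le_add h4 (Real.rpow_le_rpow (norm_nonneg _) (norm_symHess_le ξ) hp0.le)
  -- Weak derivatives of `u`.
  have hu2 : MemW2 Ω (ENNReal.ofReal p) u := by
    have := hu.1.add hu₀
    rwa [sub_add_cancel] at this
  obtain ⟨hup, hu2⟩ := hu2
  choose D₀ hD₀ hD₀1 using hu2
  have hD₀p := fun i => (hD₀1 i).1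
  choose H₀ hH₀ hH₀p using fun i => (hD₀1 i).2
  set G₀ : Plane → HessSpace m := fun x => hessOf fun i j => H₀ i j x with hG₀
  have hG₀p : MemLp G₀ (ENNReal.ofReal p) (volume.restrict Ω) := memLp_hessOf hH₀p
  have huG : weakHess Ω u =ᵐ[volume.restrict Ω] G₀ := weakHess_ae_eq hΩo hD₀ hH₀
  have hQg : (fun x => Q2 f (weakHess Ω u x)) =ᵐ[volume.restrict Ω] fun x => g (G₀ x) := by
    have hs := eventually_all.2 fun i => eventually_all.2 fun j =>
      (hD₀ i).comm hΩo (hD₀ j) (hH₀ i j) (hH₀ j i)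
    filter_upwards [huG, hs] with x h1 h2
    rw [h1, hg]
    simp only
    rw [symHess_eq_self]
    intro i j
    rw [hG₀, hessEntry_hessOf, hessEntry_hessOf]
    exact h2 i j
  have hgi : ∀ {G : Plane → HessSpace m}, MemLp G (ENNReal.ofReal p) (volume.restrict Ω) →
      IntegrableOn (fun x => g (G x)) Ω := fun hG =>
    integrable_of_growth hp hgu.measurable hg0 hgc hG
  have hfi : ∀ {G : Plane → HessSpace m}, MemLp G (ENNReal.ofReal p) (volume.restrict Ω) →
      IntegrableOn (fun x => f (G x)) Ω := fun hG => integrable_of_growth hp hf_meas hf0 hfc hG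
  -- Tolerances. The `W^{1,p}` norm of the sum of the corrections consists of nine norms
  -- at most `τ`.
  have hε4 : 0 < ε / 4 := by positivity
  obtain ⟨η₁, hη₁, hlim⟩ := exists_forall_integral_lt_of_upperSemicontinuous hp hc0 hgu hg0 hgc
    hG₀p hε4
  obtain ⟨η₂, hη₂, hgrowth⟩ := exists_forall_setIntegral_growth_le hp hc0 hG₀p hε4
  set δ := ε / (4 * (volume.real Ω + 1)) with hδ
  have hΩr : 0 ≤ volume.real Ω := measureReal_nonneg
  have hδ0 : 0 < δ := by positivity
  have hδΩ : δ * volume.real Ω ≤ ε / 4 := by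
    have e : δ * (volume.real Ω + 1) = ε / 4 := by rw [hδ]; field_simp
    linarith
  set τ₀ := min ε (min η₁ η₂) / 16 with hτ₀
  have hm0 : 0 < min ε (min η₁ η₂) := lt_min hε (lt_min hη₁ hη₂)
  have hτ₀0 : 0 < τ₀ := by positivity
  set τ := ENNReal.ofReal τ₀ with hτ
  have hττ : τ ≠ 0 := (ENNReal.ofReal_pos.2 hτ₀0).ne'
  have hτm : ∀ r, min ε (min η₁ η₂) ≤ r → 9 * τ < ENNReal.ofReal r := fun r hr => by
    rw [hτ, show (9 : ℝ≥0∞) = ENNReal.ofReal 9 by simp, ← ENNReal.ofReal_mul (by norm_num)]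
    exact (ENNReal.ofReal_lt_ofReal_iff (hm0.trans_le hr)).2 (by linarith)
  have hη₂3 : ENNReal.ofReal (η₂ / 3) ≠ 0 := (ENNReal.ofReal_pos.2 (by positivity)).ne'
  -- The three corrections.
  obtain ⟨w, ψ₁, D₁, H₁, K, V, hw, hwc, hψ₁, hK, hKΩ, hV, hVK, hVη, m₁, mD₁, mH₁, n₁, nD₁, nH₁,
    z₁, zD₁, zH₁, hwV⟩ := exists_smooth_correction hΩo hΩv hp1 hptop hup hD₀ hD₀p hH₀ hH₀p hη₂3 hττ
      ENNReal.ofReal_ne_top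
  have hVΩ := hVK.trans hKΩ
  have hVv : volume V ≠ ⊤ := measure_ne_top_of_subset hVΩ hΩv
  obtain ⟨κ, hκ, hκτ⟩ := exists_pos_forall_eLpNorm_le (G := EuclideanSpace ℝ (Fin m))
    (volume.restrict Ω) (ENNReal.ofReal p) hττ
  obtain ⟨ψ₂, D₂, H₂, A, s, Ξ, hψ₂, hs, b₂, bD₂, bH₂, z₂, zD₂, zH₂, hAV, hAd, hAη, hΞ, hAΞ⟩ :=
    exists_quadratic_correction hw hwc hV hVv hκ hη₂3
  obtain ⟨ψ₃, D₃, H₃, B, t, M, α, hψ₃, ht, b₃, bD₃, bH₃, z₃, zD₃, zH₃, hBd, hBη, hBα⟩ :=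
    exists_oscillation (f := f) hs hAd (fun a => hessOf (Ξ a)) hκ hδ0 hη₂3
  have hBV : ∀ b ∈ B, cell b t ⊆ V := fun b hb => (hBα b hb).2.1.trans (hAV _ (hBα b hb).1)
  have hBK : ∀ x ∉ K, x ∉ ⋃ b ∈ B, cell b t := fun x hx h =>
    hx (hVK (iUnion₂_subset hBV h))
  have hVK' : ∀ x ∉ K, x ∉ V := fun x hx h => hx (hVK h)
  set ψ := ψ₁ + ψ₂ + ψ₃ with hψ
  set D := D₁ + D₂ + D₃ with hD
  set H := H₁ + H₂ + H₃ with hH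
  have hψh : HasWeakHess ψ D H := (hψ₁.add hψ₂).add hψ₃
  have lg : ∀ {v w : Plane → EuclideanSpace ℝ (Fin m)} {i}, HasWeakDeriv univ i v w →
      LocallyIntegrable v ∧ LocallyIntegrable w := fun h =>
    ⟨locallyIntegrableOn_univ.1 h.1, locallyIntegrableOn_univ.1 h.2⟩
  have m₂ : MemLp ψ₂ (ENNReal.ofReal p) := memLp_of_norm_le hK (lg (hψ₂.1 0)).1 b₂
    fun x hx => z₂ x (hVK' x hx)
  have mD₂ : ∀ i, MemLp (D₂ i) (ENNReal.ofReal p) := fun i =>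
    memLp_of_norm_le hK (lg (hψ₂.1 i)).2 (bD₂ i) fun x hx => zD₂ i x (hVK' x hx)
  have mH₂ : ∀ i j, MemLp (H₂ i j) (ENNReal.ofReal p) := fun i j =>
    memLp_of_norm_le hK (lg (hψ₂.2 i j)).2 (bH₂ i j) fun x hx => zH₂ i j x (hVK' x hx)
  have m₃ : MemLp ψ₃ (ENNReal.ofReal p) := memLp_of_norm_le hK (lg (hψ₃.1 0)).1 b₃
    fun x hx => z₃ x (hBK x hx)
  have mD₃ : ∀ i, MemLp (D₃ i) (ENNReal.ofReal p) := fun i =>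
    memLp_of_norm_le hK (lg (hψ₃.1 i)).2 (bD₃ i) fun x hx => zD₃ i x (hBK x hx)
  have mH₃ : ∀ i j, MemLp (H₃ i j) (ENNReal.ofReal p) := fun i j =>
    memLp_of_norm_le hK (lg (hψ₃.2 i j)).2 (bH₃ i j) fun x hx => zH₃ i j x (hBK x hx)
  have hψ0 : MemW2Zero Ω (ENNReal.ofReal p) ψ := by
    refine memW2Zero_of_isCompact hΩo hp1 hK hKΩ hψh ((m₁.add m₂).add m₃)
      (fun i => ((mD₁ i).add (mD₂ i)).add (mD₃ i))
      (fun i j => ((mH₁ i j).add (mH₂ i j)).add (mH₃ i j)) (fun x hx => ?_) (fun i x hx => ?_)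
      fun i j x hx => ?_
    · simp [hψ, z₁ x hx, z₂ x (hVK' x hx), z₃ x (hBK x hx)]
    · simp [hD, zD₁ i x hx, zD₂ i x (hVK' x hx), zD₃ i x (hBK x hx)]
    · simp [hH, zH₁ i j x hx, zH₂ i j x (hVK' x hx), zH₃ i j x (hBK x hx)]
  have hr : ∀ (w : Plane → EuclideanSpace ℝ (Fin m)), eLpNorm w (ENNReal.ofReal p) volume ≤ τ →
      eLpNorm w (ENNReal.ofReal p) (volume.restrict Ω) ≤ τ := fun w h =>
    (eLpNorm_mono_measure _ Measure.restrict_le_self).trans h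
  have add3 : ∀ {a b c : Plane → EuclideanSpace ℝ (Fin m)}, MemLp a (ENNReal.ofReal p) →
      MemLp b (ENNReal.ofReal p) → MemLp c (ENNReal.ofReal p) →
      eLpNorm a (ENNReal.ofReal p) (volume.restrict Ω) ≤ τ →
      eLpNorm b (ENNReal.ofReal p) (volume.restrict Ω) ≤ τ →
      eLpNorm c (ENNReal.ofReal p) (volume.restrict Ω) ≤ τ →
      eLpNorm (-(a + b + c)) (ENNReal.ofReal p) (volume.restrict Ω) ≤ τ + τ + τ := by
    intro a b c ha hb hc h1 h2 h3
    rw [eLpNorm_neg]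
    refine (eLpNorm_add_le ((ha.add hb).restrict Ω).1 (hc.restrict Ω).1 hp1).trans ?_
    exact add_le_add ((eLpNorm_add_le (ha.restrict Ω).1 (hb.restrict Ω).1 hp1).trans
      (add_le_add h1 h2)) h3
  -- The Hessian fields before (`G`) and after (`G'`) the oscillation is added.
  set G : Plane → HessSpace m := fun x => hessOf fun i j => (H₀ i j + H₁ i j + H₂ i j) x with hG
  set G' : Plane → HessSpace m := fun x => hessOf fun i j => (H₀ i j + H i j) x with hG'
  have hGp : MemLp G (ENNReal.ofReal p) (volume.restrict Ω) := memLp_hessOf fun i j =>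
    ((hH₀p i j).add ((mH₁ i j).restrict Ω)).add ((mH₂ i j).restrict Ω)
  have hG'p : MemLp G' (ENNReal.ofReal p) (volume.restrict Ω) := memLp_hessOf fun i j =>
    (hH₀p i j).add (((mH₁ i j).restrict Ω).add ((mH₂ i j).restrict Ω) |>.add ((mH₃ i j).restrict Ω))
  have hG'G : ∀ x, G' x = G x + hessOf fun i j => H₃ i j x := fun x => by
    rw [hG', hG]
    simp only
    rw [← hessOf_add]
    congr 1
    funext i j
    simp [hH, add_assoc]
  have hGG₀ : ∀ r, min ε (min η₁ η₂) ≤ r →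
      eLpNorm (G - G₀) (ENNReal.ofReal p) (volume.restrict Ω) < ENNReal.ofReal r := by
    intro r hr'
    have e : G - G₀ = fun x => hessOf fun i j => (H₁ i j + H₂ i j) x := by
      funext x
      rw [Pi.sub_apply, sub_eq_iff_eq_add, hG, hG₀]
      simp only
      rw [← hessOf_add]
      congr 1
      funext i j
      simp only [Pi.add_apply]
      abel
    rw [e]
    refine (eLpNorm_hessOf_le hp1 fun i j =>
      (((mH₁ i j).add (mH₂ i j)).restrict Ω).1).trans_lt ?_
    calc _ ≤ ∑ i : Fin 2, ∑ j : Fin 2, (τ + τ) :=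
          Finset.sum_le_sum fun i _ => Finset.sum_le_sum fun j _ =>
            (eLpNorm_add_le ((mH₁ i j).restrict Ω).1 ((mH₂ i j).restrict Ω).1 hp1).trans
              (add_le_add (hr _ (nH₁ i j)) (hκτ _ (bH₂ i j)))
      _ = 8 * τ := by simp only [Fin.sum_univ_two]; ring
      _ ≤ 9 * τ := by gcongr; norm_num
      _ < _ := hτm r hr'
  have hvG : weakHess Ω (u + ψ) =ᵐ[volume.restrict Ω] G' :=
    weakHess_ae_eq hΩo (fun i => (hD₀ i).add ((hψh.1 i).mono (subset_univ _)))
      fun i j => (hH₀ i j).add ((hψh.2 i j).mono (subset_univ _))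
  have hfv : (fun x => f (weakHess Ω (u + ψ) x)) =ᵐ[volume.restrict Ω] fun x => f (G' x) := by
    filter_upwards [hvG] with x hx
    rw [hx]
  refine ⟨u + ψ, ?_, ?_, (hfi hG'p).congr hfv.symm, (hgi hG₀p).congr hQg.symm, ?_⟩
  · rw [add_sub_right_comm]
    exact hu.add hΩo hψ0
  · rw [sub_add_cancel_left, normW1_eq hΩo fun i => ((hψh.1 i).mono (subset_univ _)).neg]
    calc _ ≤ (τ + τ + τ) + ∑ i : Fin 2, (τ + τ + τ) :=
          add_le_add (add3 m₁ m₂ m₃ (hr _ n₁) (hκτ _ b₂) (hκτ _ b₃))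
            (Finset.sum_le_sum fun i _ =>
              add3 (mD₁ i) (mD₂ i) (mD₃ i) (hr _ (nD₁ i)) (hκτ _ (bD₂ i)) (hκτ _ (bD₃ i)))
      _ = 9 * τ := by simp only [Fin.sum_univ_two]; ring
      _ < _ := hτm ε (min_le_left _ _)
  · have hGξ : ∀ b ∈ B, ∀ x ∈ cell b t, G x = hessOf (Ξ (α b)) := fun b hb x hx => by
      rw [hG]
      simp only
      congr 1
      funext i j
      have hxA := (hBα b hb).2.1 hx
      rw [Pi.add_apply, Pi.add_apply, hwV x (hBV b hb hx), hAΞ _ (hBα b hb).1 x hxA]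
    -- Off the fine squares no oscillation is added, and that set is small.
    have hsmall : volume (Ω \ ⋃ b ∈ B, cell b t) < ENNReal.ofReal η₂ := by
      have hsub : Ω \ ⋃ b ∈ B, cell b t ⊆ (Ω \ V) ∪ (V \ ⋃ a ∈ A, cell a s)
          ∪ ((⋃ a ∈ A, cell a s) \ ⋃ b ∈ B, cell b t) := by
        rintro x ⟨hx, hx'⟩
        by_cases h1 : x ∈ V
        · by_cases h2 : x ∈ ⋃ a ∈ A, cell a s
          · exact Or.inr ⟨h2, hx'⟩
          · exact Or.inl (Or.inr ⟨h1, h2⟩)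
        · exact Or.inl (Or.inl ⟨hx, h1⟩)
      calc _ ≤ volume (Ω \ V) + volume (V \ ⋃ a ∈ A, cell a s)
            + volume ((⋃ a ∈ A, cell a s) \ ⋃ b ∈ B, cell b t) :=
            (measure_mono hsub).trans ((measure_union_le _ _).trans
              (add_le_add_left (measure_union_le _ _) _))
        _ < ENNReal.ofReal (η₂ / 3) + ENNReal.ofReal (η₂ / 3) + ENNReal.ofReal (η₂ / 3) :=
            ENNReal.add_lt_add (ENNReal.add_lt_add hVη hAη) hBη
        _ = ENNReal.ofReal η₂ := by
            rw [← ENNReal.ofReal_add (by positivity) (by positivity),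
              ← ENNReal.ofReal_add (by positivity) (by positivity)]
            congr 1
            ring
    have hSm : MeasurableSet (Ω \ ⋃ b ∈ B, cell b t) :=
      hΩm.diff (B.measurableSet_biUnion fun b _ => measurableSet_cell b t)
    have hoff := hgrowth G hGp (hGG₀ η₂ ((min_le_right _ _).trans (min_le_right _ _))) _ hSm
      ((Measure.restrict_apply_le _ _).trans_lt hsmall)
    rw [Measure.restrict_restrict hSm, inter_eq_self_of_subset_left sdiff_subset] at hoff
    have hmain := setIntegral_comp_le_of_cells hΩm hΩv ht (fun b hb => (hBV b hb).trans hVΩ) hBd hg0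
      (hfi hG'p) (hgi hGp) (integrable_mul_one_add_rpow hp c hGp) (fun x => hfc (G x)) hδ0.le hGξ
      (fun x hx => by
        rw [hG'G, show (fun i j => H₃ i j x) = 0 from funext fun i => funext fun j => zH₃ i j x hx,
          hessOf_zero, add_zero])
      (fun b hb => by
        have e : g (hessOf (Ξ (α b))) = Q2 f (hessOf (Ξ (α b))) := by
          rw [hg]
          simp only
          rw [symHess_eq_self]
          intro i j
          rw [hessEntry_hessOf, hessEntry_hessOf, hΞ]
        rw [e]
        refine (setIntegral_congr_fun (measurableSet_cell b t) fun x hx => ?_).le.trans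
          (hBα b hb).2.2
        rw [hG'G, hGξ b hb x hx]) hoff
    have hlast := hlim G hGp (hGG₀ η₁ ((min_le_right _ _).trans (min_le_left _ _)))
    rw [integral_congr_ae hfv, integral_congr_ae hQg]
    linarith

end
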